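/- Let $m_1,m_2,m_3\in\mathbb{R}^2$ be three non-collinear points, put $d_{ij}=\|m_i-m_j\|$, and let $\mathcal{T}:\mathbb{R}^2\to\mathbb{R}^3$, $\mathcal{T}(x)=(\|x-m_1\|,\|x-m_2\|,\|x-m_3\|)$. Let $\mathcal{E}$ be the convex hull of the image $\mathrm{Im}(\mathcal{T})$ and let $Q$ be the polyhedron of all $(T_1,T_2,T_3)\in\mathbb{R}^3$ with $$-d_{ij}\le T_i-T_j\le d_{ij},\qquad T_i+T_j\ge d_{ij}\qquad(1\le i<j\le 3),$$ $$d_{32}T_1+d_{31}T_2-d_{21}T_3\ge 0,\quad d_{32}T_1-d_{31}T_2+d_{21}T_3\ge 0,\quad -d_{32}T_1+d_{31}T_2+d_{21}T_3\ge 0.$$ For $(i,j,k)\in\{(1,2,3),(2,1,3),(3,1,2)\}$ let $r_i^0$ be the segment $[m_j,m_k]$; let $r_i^+$ (resp. $r_i^-$) be the closed half-line of the line $m_jm_k$ originating from $m_j$ and not containing $m_k$ (resp. originating from $m_k$ and not containing $m_j$); and let $\Gamma_i$ be the closed arc with endpoints $m_j,m_k$ and not containing $m_i$ of the circle through $m_1,m_2,m_3$.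 Let $e_i=[\mathcal{T}(m_j),\mathcal{T}(m_k)]$, and for $a\in\{1,2,3\}$ let $\ell_a$ be the unbounded edge $\{\mathcal{T}(m_a)+s(1,1,1): s\ge 0\}$ of $Q$, that is, the set of $T\in Q$ with $T_b-T_a=d_{ab}$ for both $b\ne a$. Consider the following closed subsets of facets of $Q$: * $\mathcal{F}_{ijk}$, the region bounded by $\mathcal{T}(\Gamma_i)\cup e_i$ in the facet $Q\cap\{d_{jk}T_i=d_{ik}T_j+d_{ij}T_k\}$; * $\mathcal{G}_{ijk}$, the region bounded by $\mathcal{T}(r_i^0)\cup e_i$ in the facet $Q\cap\{T_j+T_k=d_{jk}\}$; * $\mathcal{L}_i^+$, the unbounded region bounded by $\mathcal{T}(r_i^+)\cup\ell_j$ in the facet $Q\cap\{T_k-T_j=d_{jk}\}$, and $\mathcal{L}_i^-$, the unbounded region bounded by $\mathcal{T}(r_i^-)\cup\ell_k$ in the facet $Q\cap\{T_j-T_k=d_{jk}\}$. Here the region bounded by $J$ in a facet $Q\cap\Pi$, with $\Pi$ the plane of the facet, is the union of $J$ and of the connected components of $\Pi\setminus J$ that are contained in $Q$. Then the set of points of $\mathrm{Im}(\mathcal{T})\setminus\{\mathcal{T}(m_1),\mathcal{T}(m_2),\mathcal{T}(m_3)\}$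 at which the Gaussian curvature of the surface $\mathrm{Im}(\mathcal{T})$ is nonnegative determines exactly four regions $\mathcal{V}_0,\dots,\mathcal{V}_3$ (the closures of its connected components), and $$\partial\mathcal{E}=\bigcup_{i=0}^{3}\mathcal{V}_i\;\cup\bigcup_{(i,j,k)}\left(\mathcal{F}_{ijk}\cup\mathcal{G}_{ijk}\right)\cup\bigcup_{i=1}^{3}\left(\mathcal{L}_i^+\cup\mathcal{L}_i^-\right).$$ Moreover, $\mathcal{E}$ is the closed domain enclosed by $\partial\mathcal{E}$ (the union of $\partial\mathcal{E}$ and of the connected components of $\mathbb{R}^3\setminus\partial\mathcal{E}$ that are contained in $Q$) minus the three unbounded edges without their endpoints, $\ell_a\setminus\{\mathcal{T}(m_a)\}$, $a=1,2,3$. -/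

import Mathlib

noncomputable section

namespace RangeHull

/-- The `x`-plane. -/
abbrev Plane : Type := EuclideanSpace ℝ (Fin 2)

/-- The space of range measurements. -/
abbrev TSpace : Type := EuclideanSpace ℝ (Fin 3)

/-! ### The range map, its image and the convex hull -/

/-- The range map `x ↦ (d₁(x), d₂(x), d₃(x))` of the receivers `m 0`, `m 1`, `m 2`. -/
def rangeMap (m : Fin 3 → Plane) (x : Plane) : TSpace :=
  WithLp.toLp 2 (fun i => dist x (m i))

/-- The convex hull of the image of the range map. -/
def hull (m : Fin 3 → Plane) : Set TSpace :=
  convexHull ℝ (Set.range (rangeMap m))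

/-! ### Gaussian curvature of a parametrized surface -/

/-- Partial derivative with respect to the `i`-th coordinate of the plane. -/
def partialD (σ : Plane → TSpace) (i : Fin 2) (x : Plane) : TSpace :=
  fderiv ℝ σ x (EuclideanSpace.single i 1)

/-- Second partial derivatives. -/
def partialD2 (σ : Plane → TSpace) (i j : Fin 2) (x : Plane) : TSpace :=
  partialD (partialD σ i) j x

/-- The (non-normalized) normal vector `σ_u × σ_v`. -/
def normalVec (σ : Plane → TSpace) (x : Plane) : TSpace :=
  WithLp.toLp 2 (crossProduct (WithLp.ofLp (partialD σ 0 x)) (WithLp.ofLp (partialD σ 1 x)))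

/-- The unit normal vector. -/
def unitNormal (σ : Plane → TSpace) (x : Plane) : TSpace :=
  ‖normalVec σ x‖⁻¹ • normalVec σ x

/-- Coefficients of the first fundamental form. -/
def firstForm (σ : Plane → TSpace) (i j : Fin 2) (x : Plane) : ℝ :=
  inner ℝ (partialD σ i x) (partialD σ j x)

/-- Coefficients of the second fundamental form. -/
def secondForm (σ : Plane → TSpace) (i j : Fin 2) (x : Plane) : ℝ :=
  inner ℝ (partialD2 σ i j x) (unitNormal σ x)

/-- Gaussian curvature at `σ x` of a parametrized surface `σ` that is regular at `x`. -/
def gaussCurvature (σ : Plane → TSpace) (x : Plane) : ℝ :=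
  (secondForm σ 0 0 x * secondForm σ 1 1 x - secondForm σ 0 1 x ^ 2) /
    (firstForm σ 0 0 x * firstForm σ 1 1 x - firstForm σ 0 1 x ^ 2)

/-- The points of the surface, other than the images of the receivers (where the surface is
singular), at which the Gaussian curvature is nonnegative. -/
def nonnegCurved (m : Fin 3 → Plane) : Set TSpace :=
  rangeMap m '' {x | x ∉ Set.range m ∧ 0 ≤ gaussCurvature (rangeMap m) x}

/-- The regions of nonnegative Gaussian curvature: the closures of the connected components of
the set of points of nonnegative curvature. -/
def curvedRegions (m : Fin 3 → Plane) : Set (Set TSpace) :=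
  {V | ∃ p ∈ nonnegCurved m, V = closure (connectedComponentIn (nonnegCurved m) p)}

/-! ### Loci in the plane of the receivers

For `i : Fin 3` the other two indices are `jj i < kk i`. -/

/-- The smaller of the two indices different from `i`. -/
def jj (i : Fin 3) : Fin 3 := ![1, 0, 0] i

/-- The larger of the two indices different from `i`. -/
def kk (i : Fin 3) : Fin 3 := ![2, 2, 1] i

/-- The side of the triangle opposite to `m i`. -/
def side (m : Fin 3 → Plane) (i : Fin 3) : Set Plane :=
  segment ℝ (m (jj i)) (m (kk i))

/-- The closed half-line of the line through `a` and `b` that originates from `a` and does not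
contain `b`. -/
def halfLine (a b : Plane) : Set Plane :=
  {x | ∃ s : ℝ, 0 ≤ s ∧ x = a + s • (a - b)}

/-- The circle through the three receivers. -/
def circle (m : Fin 3 → Plane) : Set Plane :=
  {x | EuclideanGeometry.Cospherical (insert x (Set.range m))}

/-- The closed arc of the circle that joins the two receivers other than `m i` and does not
contain `m i`: the points of the circle that do not lie strictly on the same side as `m i` of the
line through the other two receivers. -/
def arc (m : Fin 3 → Plane) (i : Fin 3) : Set Plane :=
  {x | x ∈ circle m ∧ (line[ℝ, m (jj i), m (kk i)]).WOppSide (m i) x}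

/-! ### The polyhedron, its facets and its edges -/

/-- The plane that contains the image of `arc m i`. -/
def planeF (m : Fin 3 → Plane) (i : Fin 3) : Set TSpace :=
  {p | dist (m (jj i)) (m (kk i)) * p i
    = dist (m i) (m (kk i)) * p (jj i) + dist (m i) (m (jj i)) * p (kk i)}

/-- The plane that contains the image of `side m i`. -/
def planeG (m : Fin 3 → Plane) (i : Fin 3) : Set TSpace :=
  {p | p (jj i) + p (kk i) = dist (m (jj i)) (m (kk i))}

/-- The plane that contains the image of the half-line originating from `m a` and not
containing `m b`. -/
def planeL (m : Fin 3 → Plane) (a b : Fin 3) : Set TSpace :=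
  {p | p b - p a = dist (m a) (m b)}

/-- The polyhedron that is cut out by the twelve linear inequalities. -/
def polyhedron (m : Fin 3 → Plane) : Set TSpace :=
  {p | (∀ i j : Fin 3, i < j →
        -dist (m j) (m i) ≤ p i - p j ∧ p i - p j ≤ dist (m j) (m i) ∧
        dist (m j) (m i) ≤ p i + p j) ∧
      0 ≤ dist (m 2) (m 1) * p 0 + dist (m 2) (m 0) * p 1 - dist (m 1) (m 0) * p 2 ∧
      0 ≤ dist (m 2) (m 1) * p 0 - dist (m 2) (m 0) * p 1 + dist (m 1) (m 0) * p 2 ∧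
      0 ≤ -(dist (m 2) (m 1) * p 0) + dist (m 2) (m 0) * p 1 + dist (m 1) (m 0) * p 2}

/-- The bounded edge with endpoints the images of the two receivers other than `m i`. -/
def boundedEdge (m : Fin 3 → Plane) (i : Fin 3) : Set TSpace :=
  segment ℝ (rangeMap m (m (jj i))) (rangeMap m (m (kk i)))

/-- The unbounded edge with endpoint the image of `m a`, namely the intersection of the two
facets in the planes `p b - p a = d_{ba}`, `b ≠ a`. It is the half-line with origin
`rangeMap m (m a)` and direction `(1, 1, 1)`. -/
def unboundedEdge (m : Fin 3 → Plane) (a : Fin 3) : Set TSpace :=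
  {p | p ∈ polyhedron m ∧ ∀ b : Fin 3, b ≠ a → p b - p a = dist (m a) (m b)}

/-! ### Regions with a given boundary -/

/-- The part of `Y` that is enclosed by `J` in the ambient set `X`, with `J` included: the union
of `J` and of the connected components of `X \ J` that are contained in `Y`. -/
def enclosedRegion (X Y J : Set TSpace) : Set TSpace :=
  J ∪ {p | p ∈ X \ J ∧ connectedComponentIn (X \ J) p ⊆ Y}

/-- The subset of a facet bounded by the image of `arc m i` and a bounded edge. -/
def pieceF (m : Fin 3 → Plane) (i : Fin 3) : Set TSpace :=
  enclosedRegion (planeF m i) (polyhedron m ∩ planeF m i)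
    (rangeMap m '' arc m i ∪ boundedEdge m i)

/-- The subset of a facet bounded by the image of `side m i` and a bounded edge. -/
def pieceG (m : Fin 3 → Plane) (i : Fin 3) : Set TSpace :=
  enclosedRegion (planeG m i) (polyhedron m ∩ planeG m i)
    (rangeMap m '' side m i ∪ boundedEdge m i)

/-- The unbounded subset of a facet bounded by the image of the half-line originating from `m a`
and not containing `m b`, and by the unbounded edge with endpoint the image of `m a`. -/
def pieceL (m : Fin 3 → Plane) (a b : Fin 3) : Set TSpace :=
  enclosedRegion (planeL m a b) (polyhedron m ∩ planeL m a b)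
    (rangeMap m '' halfLine (m a) (m b) ∪ unboundedEdge m a)

end RangeHull

end

/-! For weights w put f_w(z) = ∑ w_b |z - m_b|. The linear functional with coefficients w supports
the hull at T(y) exactly when y minimizes f_w globally, so the theorem is a study of the minimizers
of such functions.

Let β_b be the barycentric coordinates of y and pw y = ∑ β_b |y - m_b|², which is minus the power of
y with respect to the circle. Since ∑ β_b (y - m_b) = 0, the complex numbers conj(y - m_b)(z - m_b),
weighted by β_b, add up to pw y for every z (`sum_bary_cx`). Taking norms shows that y minimizes f_w
for w_b = β_b |y - m_b| in two cases: y is in the triangle (`pw_le_of_tri`), or y is beyond one side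
and not inside the circle (`pw_le_of_reg`). With all inequalities strict the minimizer is unique
(`eq_of_tri`, `eq_of_reg`). Conversely, at a minimizer that is not a receiver the first order
condition makes w proportional to these weights (`exists_scale`), and the Hessian determinant then
has the sign of β₀β₁β₂ · pw (`hessian_det`). The same weights are, up to a factor, the coordinates
of the surface normal, so this is also the sign of the Gaussian curvature
(`gaussCurvature_nonneg_iff`). The sign is nonnegative exactly on the triangle and on three outer
regions (`posLocus_eq`). These four closed sets meet only at receivers and stay connected without
them, whence the four components.

The closure of the hull is the hull plus the half-line spanned by (1,1,1), the only direction at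
infinity of the image (`exists_of_mem_closure`). Hence a frontier point is, up to a multiple of
(1,1,1), in the convex hull of the images of the minimizers of some f_w (`exists_face`). If some
minimizer is not a receiver, then either it is the only one, or a coordinate β_i vanishes and the
minimizers fill part of a side or of a half-line, or pw vanishes and all minimizers give equality in
Ptolemy's inequality (`onPieces_of_critical`). If all are receivers, the result is a point of an
edge (`onPieces_of_receivers`).

The flat pieces are described by explicit convex sets `regionF`, `regionG`, `regionL`. They agree
with the topologically enclosed regions because any component outside such a convex set contains
rays in several directions, while the polyhedron contains rays only in the direction (1,1,1)
(`enclosedRegion_eq`). -/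

noncomputable section

namespace RangeHull

/-! ### Barycentric coordinates, the power of a point, and the sign locus -/

section

/-- The determinant of two vectors of the plane. -/
def cr (a b : Plane) : ℝ := a 0 * b 1 - a 1 * b 0

/-- Twice the signed area of the triangle of the receivers. -/
def area (m : Fin 3 → Plane) : ℝ := cr (m 1 - m 0) (m 2 - m 0)

/-- Barycentric coordinates with respect to the receivers. -/
def bary (m : Fin 3 → Plane) (i : Fin 3) (x : Plane) : ℝ :=
  cr (m (i + 1) - x) (m (i + 2) - x) / area m

/-- The negative of the power of a point with respect to the circle through the receivers. -/
def pw (m : Fin 3 → Plane) (x : Plane) : ℝ := ∑ i, bary m i x * dist x (m i) ^ 2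

lemma sum_three {M : Type*} [AddCommMonoid M] {i j k : Fin 3} (hij : i ≠ j) (hik : i ≠ k)
    (hjk : j ≠ k) (f : Fin 3 → M) : ∑ b, f b = f i + f j + f k := by
  rw [Fin.sum_univ_three]
  fin_cases i <;> fin_cases j <;> fin_cases k <;> first
    | exact absurd rfl hij
    | exact absurd rfl hik
    | exact absurd rfl hjk
    | (dsimp <;> abel)

lemma forall_three {i j k : Fin 3} (hij : i ≠ j) (hik : i ≠ k) (hjk : j ≠ k) (b : Fin 3) :
    b = i ∨ b = j ∨ b = k := by
  omega

lemma dist_sq (x y : Plane) : dist x y ^ 2 = (x 0 - y 0) ^ 2 + (x 1 - y 1) ^ 2 := by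
  rw [EuclideanSpace.dist_eq, Real.sq_sqrt (by positivity), Fin.sum_univ_two, Real.dist_eq,
    Real.dist_eq, sq_abs, sq_abs]

lemma plane_ext {x y : Plane} (h0 : x 0 = y 0) (h1 : x 1 = y 1) : x = y := by
  ext c; fin_cases c
  · exact h0
  · exact h1

lemma area_ne_zero {m : Fin 3 → Plane} (hm : ¬ Collinear ℝ (Set.range m)) : area m ≠ 0 := by
  intro h
  apply hm
  rw [collinear_iff_of_mem (Set.mem_range_self (0 : Fin 3))]
  simp only [area, cr, PiLp.sub_apply] at h
  by_cases h1 : m 1 = m 0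
  · refine ⟨m 2 - m 0, ?_⟩
    rintro _ ⟨b, rfl⟩
    fin_cases b
    · exact ⟨0, by simp⟩
    · exact ⟨0, by simp [h1]⟩
    · exact ⟨1, by simp⟩
  · refine ⟨m 1 - m 0, ?_⟩
    rintro _ ⟨b, rfl⟩
    fin_cases b
    · exact ⟨0, by simp⟩
    · exact ⟨1, by simp⟩
    · by_cases h0 : m 1 0 - m 0 0 = 0
      · have h2 : m 1 1 - m 0 1 ≠ 0 := fun h2 => h1 (plane_ext (by linarith) (by linarith))
        refine ⟨(m 2 1 - m 0 1) / (m 1 1 - m 0 1), plane_ext ?_ ?_⟩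
        · have : (m 2 0 - m 0 0) = 0 := by
            rw [h0, zero_mul, zero_sub, neg_eq_zero] at h
            exact (mul_eq_zero.1 h).resolve_left h2
          simp [h0]; linarith
        · simp; field_simp; ring
      · refine ⟨(m 2 0 - m 0 0) / (m 1 0 - m 0 0), plane_ext ?_ ?_⟩
        · simp; field_simp; ring
        · simp; field_simp; linarith

/-- Before division by the area this is a polynomial identity, so it holds for collinear receivers
too, where every coordinate is 0 by the convention on division. -/
lemma bary_vec (m : Fin 3 → Plane) (x : Plane) (c : Fin 2) : ∑ b, bary m b x * (x c - m b c) = 0 := by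
  rw [Fin.sum_univ_three]
  simp only [bary, div_mul_eq_mul_div]
  rw [← add_div, ← add_div]
  apply div_eq_zero_iff.2; left
  fin_cases c <;> simp [cr] <;> ring

section
variable {m : Fin 3 → Plane} (hm : ¬ Collinear ℝ (Set.range m))
include hm

lemma bary_sum (x : Plane) : ∑ b, bary m b x = 1 := by
  have h := area_ne_zero hm
  rw [Fin.sum_univ_three]
  simp only [bary]
  rw [← add_div, ← add_div, div_eq_one_iff_eq h]
  simp [area, cr]
  ring

/-- Cramer's rule: the vectors x - m_b satisfy only one linear relation up to a factor. Applied to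
the gradient of a weighted sum of distances, this determines the weights at a critical point. -/
lemma bary_unique (x : Plane) (c : Fin 3 → ℝ) (h : ∀ e, ∑ b, c b * (x e - m b e) = 0) (b : Fin 3) :
    c b = (∑ b, c b) * bary m b x := by
  have hD := area_ne_zero hm
  have h0 := h 0
  have h1 := h 1
  rw [bary, mul_div_assoc', eq_div_iff hD]
  rw [Fin.sum_univ_three] at h0 h1 ⊢
  fin_cases b <;> simp [area, cr]
  · linear_combination -(m 1 1 - m 2 1) * h0 + (m 1 0 - m 2 0) * h1
  · linear_combination -(m 2 1 - m 0 1) * h0 + (m 2 0 - m 0 0) * h1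
  · linear_combination -(m 0 1 - m 1 1) * h0 + (m 0 0 - m 1 0) * h1

lemma bary_eq_of_combo {x : Plane} {l : Fin 3 → ℝ} (hl : ∑ b, l b = 1) (hx : x = ∑ b, l b • m b)
    (b : Fin 3) : bary m b x = l b := by
  have := bary_unique hm x l (fun e => by
    have h1 : x e = ∑ b, l b * m b e := by rw [hx]; simp
    simp only [mul_sub, Finset.sum_sub_distrib]
    rw [← Finset.sum_mul, hl, ← h1]; ring) b
  rw [this, hl, one_mul]

lemma eq_combo (x : Plane) : x = ∑ b, bary m b x • m b := by
  ext c
  have := bary_vec m x c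
  simp only [mul_sub, Finset.sum_sub_distrib] at this
  rw [← Finset.sum_mul, bary_sum hm] at this
  simp
  linarith

lemma bary_self (i : Fin 3) : bary m i (m i) = 1 := by
  rw [bary_eq_of_combo hm (l := fun b => if b = i then 1 else 0) (by simp) (by simp)]
  simp

lemma bary_of_ne {i b : Fin 3} (h : b ≠ i) : bary m b (m i) = 0 := by
  rw [bary_eq_of_combo hm (l := fun b => if b = i then 1 else 0) (by simp) (by simp)]
  simp [h]

/-- If z ≠ y, the vanishing determinants put all three receivers on the line through y and z. This
is how the equality cases of the norm inequalities yield uniqueness of the minimizer. -/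
lemma eq_of_cr_eq_zero {y z : Plane} (h : ∀ b, cr (y - m b) (z - m b) = 0) : z = y := by
  have hD := area_ne_zero hm
  have h0 := h 0
  have h1 := h 1
  have h2 := h 2
  simp [cr] at h0 h1 h2
  have hA : area m = m 1 0 * m 2 1 - m 1 0 * m 0 1 - m 0 0 * m 2 1 - m 1 1 * m 2 0
    + m 1 1 * m 0 0 + m 0 1 * m 2 0 := by simp [area, cr]; ring
  apply plane_ext
  · apply mul_left_cancel₀ hD
    rw [hA]
    linear_combination (m 1 0 - m 0 0) * h2 + (m 2 0 - m 1 0) * h0 + (m 0 0 - m 2 0) * h1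
  · apply mul_left_cancel₀ hD
    rw [hA]
    linear_combination (m 1 1 - m 0 1) * h2 + (m 2 1 - m 1 1) * h0 + (m 0 1 - m 2 1) * h1

lemma receivers_ne {i j : Fin 3} (h : i ≠ j) : m i ≠ m j := by
  intro e
  have := bary_self hm i
  rw [e, bary_of_ne hm h] at this
  exact zero_ne_one this

lemma receivers_dist_pos {i j : Fin 3} (h : i ≠ j) : 0 < dist (m i) (m j) :=
  dist_pos.2 (receivers_ne hm h)

/-- Lagrange's formula for the moment of inertia of masses β_b of total mass 1 about their centre of
mass x. -/
lemma pw_eq {i j k : Fin 3} (hij : i ≠ j) (hik : i ≠ k) (hjk : j ≠ k) (x : Plane) :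
    pw m x = bary m i x * bary m j x * dist (m i) (m j) ^ 2 +
      bary m i x * bary m k x * dist (m i) (m k) ^ 2 +
      bary m j x * bary m k x * dist (m j) (m k) ^ 2 := by
  have hs := bary_sum hm x
  have h0 := bary_vec m x 0
  have h1 := bary_vec m x 1
  rw [sum_three hij hik hjk] at hs h0 h1
  rw [pw, sum_three hij hik hjk]
  simp only [dist_sq]
  generalize bary m i x = a at *
  generalize bary m j x = b at *
  generalize bary m k x = c at *
  linear_combination (-a * ((x 0 - m i 0) ^ 2 + (x 1 - m i 1) ^ 2)
    - b * ((x 0 - m j 0) ^ 2 + (x 1 - m j 1) ^ 2)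
    - c * ((x 0 - m k 0) ^ 2 + (x 1 - m k 1) ^ 2)) * hs
    + (a * (x 0 - m i 0) + b * (x 0 - m j 0) + c * (x 0 - m k 0)) * h0
    + (a * (x 1 - m i 1) + b * (x 1 - m j 1) + c * (x 1 - m k 1)) * h1

/-- Where two barycentric coordinates are negative, the point is outside the circle. -/
lemma pw_neg_of_neg {i j k : Fin 3} (hij : i ≠ j) (hik : i ≠ k) (hjk : j ≠ k) {x : Plane}
    (hj : bary m j x < 0) (hk : bary m k x < 0) : pw m x < 0 := by
  have hs := bary_sum hm x
  rw [sum_three hij hik hjk] at hs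
  rw [pw_eq hm hij hik hjk]
  have h1 := receivers_dist_pos hm hij
  have h2 := receivers_dist_pos hm hik
  have h3 : dist (m j) (m k) ≤ dist (m i) (m j) + dist (m i) (m k) := by
    rw [dist_comm (m i) (m j)]; exact dist_triangle _ _ _
  have h4 : 0 ≤ dist (m j) (m k) := dist_nonneg
  generalize dist (m i) (m j) = p at *
  generalize dist (m i) (m k) = q at *
  generalize dist (m j) (m k) = d at *
  generalize bary m i x = a at *
  obtain ⟨b, hb⟩ : ∃ b, b = -bary m j x := ⟨_, rfl⟩
  obtain ⟨c, hc⟩ : ∃ c, c = -bary m k x := ⟨_, rfl⟩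
  have hj' : bary m j x = -b := by linarith
  have hk' : bary m k x = -c := by linarith
  rw [hj', hk'] at *
  have hb0 : 0 < b := by linarith
  have hc0 : 0 < c := by linarith
  have ha : a = 1 + b + c := by linarith
  -- Replacing d by p + q bounds the value above by -b p² - c q² - (b p - c q)².
  have hd : d ^ 2 ≤ (p + q) ^ 2 := pow_le_pow_left₀ h4 h3 2
  have hbc := mul_le_mul_of_nonneg_left hd (mul_pos hb0 hc0).le
  have e1 : 0 < b * p ^ 2 := by positivity
  have e2 : 0 < c * q ^ 2 := by positivity
  subst ha
  nlinarith [sq_nonneg (b * p - c * q)]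

end

/-- The closed triangle of the receivers. -/
def tri (m : Fin 3 → Plane) : Set Plane := {x | ∀ b, 0 ≤ bary m b x}

/-- The closed region beyond the side opposite to `m i` and outside the circle. -/
def reg (m : Fin 3 → Plane) (i : Fin 3) : Set Plane :=
  {x | bary m i x ≤ 0 ∧ (∀ b, b ≠ i → 0 ≤ bary m b x) ∧ pw m x ≤ 0}

/-- The locus of the sign condition that characterizes nonnegative curvature. -/
def posLocus (m : Fin 3 → Plane) : Set Plane :=
  {x | 0 ≤ bary m 0 x * bary m 1 x * bary m 2 x * pw m x}

lemma prod_three {i j k : Fin 3} (hij : i ≠ j) (hik : i ≠ k) (hjk : j ≠ k) (f : Fin 3 → ℝ) :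
    f 0 * f 1 * f 2 = f i * f j * f k := by
  fin_cases i <;> fin_cases j <;> fin_cases k <;> first
    | exact absurd rfl hij
    | exact absurd rfl hik
    | exact absurd rfl hjk
    | (dsimp <;> ring)

lemma exists_others (i : Fin 3) : ∃ j k : Fin 3, i ≠ j ∧ i ≠ k ∧ j ≠ k := by
  fin_cases i
  · exact ⟨1, 2, by decide, by decide, by decide⟩
  · exact ⟨0, 2, by decide, by decide, by decide⟩
  · exact ⟨0, 1, by decide, by decide, by decide⟩

lemma exists_third {i j : Fin 3} (h : i ≠ j) : ∃ k : Fin 3, i ≠ k ∧ j ≠ k := by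
  revert i j; decide

/-- Two negative coordinates make the third positive and `pw` negative, so the product is negative.
With exactly one negative coordinate β_i, a positive `pw` forces β_j β_k = 0, and then the remaining
terms of `pw_eq` are nonpositive, a contradiction. -/
lemma posLocus_eq {m : Fin 3 → Plane} (hm : ¬ Collinear ℝ (Set.range m)) :
    posLocus m = tri m ∪ ⋃ i, reg m i := by
  ext x
  simp only [posLocus, Set.mem_ofPred_eq, Set.mem_union, Set.mem_iUnion]
  constructor
  · intro h
    by_cases ht : ∀ b, 0 ≤ bary m b x
    · exact Or.inl ht
    push Not at ht
    obtain ⟨i, hi⟩ := ht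
    right
    obtain ⟨j, k, hij, hik, hjk⟩ := exists_others i
    have hs := bary_sum hm x
    rw [sum_three hij hik hjk] at hs
    rw [prod_three hij hik hjk (fun b => bary m b x)] at h
    have key : ∀ j k : Fin 3, i ≠ j → i ≠ k → j ≠ k →
        0 ≤ bary m i x * bary m j x * bary m k x * pw m x → 0 ≤ bary m j x := by
      intro j k hij hik hjk h
      have hs := bary_sum hm x
      rw [sum_three hij hik hjk] at hs
      by_contra! hj
      have := pw_neg_of_neg hm hik.symm hjk.symm hij hi hj
      have h1 : 0 < bary m i x * bary m j x := mul_pos_of_neg_of_neg hi hj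
      have h2 : 0 < bary m i x * bary m j x * bary m k x := mul_pos h1 (by linarith)
      nlinarith
    have hj := key j k hij hik hjk h
    have hk := key k j hik hij hjk.symm (by linarith)
    refine ⟨i, hi.le, ?_, ?_⟩
    · intro b hb
      rcases forall_three hij hik hjk b with rfl | rfl | rfl
      · exact absurd rfl hb
      · exact hj
      · exact hk
    · by_contra! hp
      have h1 : bary m j x * bary m k x ≤ 0 := by
        by_contra! h2
        have := mul_pos h2 hp
        nlinarith
      have h0 : bary m j x * bary m k x = 0 := le_antisymm h1 (mul_nonneg hj hk)
      rw [pw_eq hm hij hik hjk, h0] at hp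
      have e1 : bary m i x * bary m j x ≤ 0 := mul_nonpos_of_nonpos_of_nonneg hi.le hj
      have e2 : bary m i x * bary m k x ≤ 0 := mul_nonpos_of_nonpos_of_nonneg hi.le hk
      nlinarith [mul_nonneg (neg_nonneg.2 e1) (sq_nonneg (dist (m i) (m j))),
        mul_nonneg (neg_nonneg.2 e2) (sq_nonneg (dist (m i) (m k)))]
  · rintro (h | ⟨i, h1, h2, h3⟩)
    · have : 0 ≤ pw m x := Finset.sum_nonneg fun b _ => mul_nonneg (h b) (sq_nonneg _)
      exact mul_nonneg (mul_nonneg (mul_nonneg (h 0) (h 1)) (h 2)) this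
    · obtain ⟨j, k, hij, hik, hjk⟩ := exists_others i
      rw [prod_three hij hik hjk (fun b => bary m b x)]
      have := mul_nonneg (h2 j hij.symm) (h2 k hik.symm)
      have := mul_nonneg_of_nonpos_of_nonpos h1 h3
      nlinarith

end

/-! ### The complex identity behind minimality, and Ptolemy's inequality -/

section

/-- The complex number `conj e * f` for vectors of the plane. -/
def cx (e f : Plane) : ℂ := ⟨e 0 * f 0 + e 1 * f 1, cr e f⟩

lemma norm_cx (y z p : Plane) : ‖cx (y - p) (z - p)‖ = dist y p * dist z p := by
  have h : ‖cx (y - p) (z - p)‖ ^ 2 = (dist y p * dist z p) ^ 2 := by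
    rw [mul_pow, dist_sq, dist_sq, ← Complex.normSq_eq_norm_sq, Complex.normSq_apply]
    simp [cx, cr]
    ring
  exact (pow_left_inj₀ (norm_nonneg _) (by positivity) two_ne_zero).1 h

lemma im_eq_zero_of_norm_le {c : ℂ} (h : ‖c‖ ≤ c.re) : c.im = 0 := by
  have h1 : ‖c‖ ^ 2 ≤ c.re ^ 2 := pow_le_pow_left₀ (norm_nonneg _) h 2
  rw [← Complex.normSq_eq_norm_sq, Complex.normSq_apply] at h1
  nlinarith [sq_nonneg c.im]

/-- Equality in the triangle inequality with a positive real summand forces the other summand onto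
the real axis. -/
lemma im_eq_zero_of_norm_add {q : ℝ} (hq : 0 < q) {c : ℂ} (h : q + ‖c‖ ≤ ‖(q : ℂ) + c‖) :
    c.im = 0 := by
  apply im_eq_zero_of_norm_le
  have h1 : (q + ‖c‖) ^ 2 ≤ ‖(q : ℂ) + c‖ ^ 2 := pow_le_pow_left₀ (by positivity) h 2
  have h2 : ‖c‖ ^ 2 = c.re * c.re + c.im * c.im := by
    rw [← Complex.normSq_eq_norm_sq, Complex.normSq_apply]
  rw [← Complex.normSq_eq_norm_sq ((q : ℂ) + c), Complex.normSq_apply] at h1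
  simp at h1
  nlinarith

section
variable {m : Fin 3 → Plane} (hm : ¬ Collinear ℝ (Set.range m))

/-- The relation ∑ β_b conj(y - m_b) = 0 allows z to be replaced by y, which leaves ∑ β_b |y -
m_b|². All the minimality statements are read off from the independence of z. -/
lemma sum_bary_cx (m : Fin 3 → Plane) (y z : Plane) :
    ∑ b, (bary m b y : ℂ) * cx (y - m b) (z - m b) = (pw m y : ℂ) := by
  have h0 := bary_vec m y 0
  have h1 := bary_vec m y 1
  rw [Fin.sum_univ_three] at *
  apply Complex.ext
  · rw [Complex.ofReal_re, pw, Fin.sum_univ_three]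
    simp [cx, dist_sq]
    linear_combination (z 0 - y 0) * h0 + (z 1 - y 1) * h1
  · simp [cx, cr]
    linear_combination (z 1 - y 1) * h0 - (z 0 - y 0) * h1

/-- Each term of `sum_bary_cx` has real part at most its norm. The right side equals `pw m y` at z =
y, so y is a global minimizer. -/
lemma pw_le_of_tri {y : Plane} (hy : y ∈ tri m) (z : Plane) :
    pw m y ≤ ∑ b, bary m b y * dist y (m b) * dist z (m b) := by
  have h := congrArg Complex.re (sum_bary_cx m y z)
  simp only [Complex.re_sum, Complex.re_ofReal_mul, Complex.ofReal_re] at h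
  rw [← h]
  refine Finset.sum_le_sum fun b _ => ?_
  rw [mul_assoc, ← norm_cx]
  exact mul_le_mul_of_nonneg_left (Complex.re_le_norm _) (hy b)

include hm in
-- Equality holds term by term, so each conj(y - m_b)(z - m_b) is real.
lemma eq_of_tri {y : Plane} (hy : ∀ b, 0 < bary m b y) {z : Plane}
    (hz : ∑ b, bary m b y * dist y (m b) * dist z (m b) ≤ pw m y) : z = y := by
  apply eq_of_cr_eq_zero hm
  have h := congrArg Complex.re (sum_bary_cx m y z)
  simp only [Complex.re_sum, Complex.re_ofReal_mul, Complex.ofReal_re] at h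
  rw [← h] at hz
  have hle : ∀ b ∈ Finset.univ, bary m b y * (cx (y - m b) (z - m b)).re ≤
      bary m b y * dist y (m b) * dist z (m b) := fun b _ => by
    rw [mul_assoc, ← norm_cx]
    exact mul_le_mul_of_nonneg_left (Complex.re_le_norm _) (hy b).le
  have := (Finset.sum_eq_sum_iff_of_le hle).1 (le_antisymm (Finset.sum_le_sum hle) hz)
  intro b
  have hb := this b (Finset.mem_univ b)
  rw [mul_assoc, ← norm_cx] at hb
  exact im_eq_zero_of_norm_le (mul_left_cancel₀ (hy b).ne' hb).ge

lemma norm_bary_cx (m : Fin 3 → Plane) (b : Fin 3) (y z : Plane) :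
    ‖(bary m b y : ℂ) * cx (y - m b) (z - m b)‖ = |bary m b y| * dist y (m b) * dist z (m b) := by
  rw [norm_mul, norm_cx, Complex.norm_real, Real.norm_eq_abs, mul_assoc]

/-- Only the term of index i has a nonpositive coefficient. Isolating it, X = pw - A - B, the
triangle inequality gives |X| ≤ -pw + |A| + |B|. -/
lemma pw_le_of_reg {i : Fin 3} {y : Plane} (hy : y ∈ reg m i) (z : Plane) :
    pw m y ≤ ∑ b, bary m b y * dist y (m b) * dist z (m b) := by
  obtain ⟨j, k, hij, hik, hjk⟩ := exists_others i
  obtain ⟨h1, h2, h3⟩ := hy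
  have h := sum_bary_cx m y z
  have eA := norm_bary_cx m j y z
  have eB := norm_bary_cx m k y z
  have eX := norm_bary_cx m i y z
  rw [sum_three hij hik hjk] at h ⊢
  rw [abs_of_nonneg (h2 j hij.symm)] at eA
  rw [abs_of_nonneg (h2 k hik.symm)] at eB
  rw [abs_of_nonpos h1] at eX
  have key : ∀ X A B : ℂ, X + A + B = (pw m y : ℂ) → ‖X‖ ≤ -pw m y + ‖A‖ + ‖B‖ := by
    intro X A B h
    have : X = (pw m y : ℂ) - A - B := by rw [← h]; ring
    rw [this]
    refine (norm_sub_le _ _).trans (add_le_add_left ((norm_sub_le _ _).trans ?_) _)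
    rw [Complex.norm_real, Real.norm_eq_abs, abs_of_nonpos h3]
  have := key _ _ _ h
  linarith

include hm in
-- Strict negativity of `pw` supplies a nonzero real summand that fixes the common direction of the
-- terms. On the circle this summand is absent and uniqueness fails.
lemma eq_of_reg {i : Fin 3} {y : Plane} (hi : bary m i y < 0) (hb : ∀ b, b ≠ i → 0 < bary m b y)
    (hp : pw m y < 0) {z : Plane}
    (hz : ∑ b, bary m b y * dist y (m b) * dist z (m b) ≤ pw m y) : z = y := by
  obtain ⟨j, k, hij, hik, hjk⟩ := exists_others i
  have h := sum_bary_cx m y z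
  have eA := norm_bary_cx m j y z
  have eB := norm_bary_cx m k y z
  have eX := norm_bary_cx m i y z
  rw [sum_three hij hik hjk] at h hz
  have hj := hb j hij.symm
  have hk := hb k hik.symm
  rw [abs_of_pos hj] at eA
  rw [abs_of_pos hk] at eB
  rw [abs_of_neg hi] at eX
  have key : ∀ X A B : ℂ, X + A + B = (pw m y : ℂ) → -pw m y + ‖A‖ + ‖B‖ ≤ ‖X‖ →
      X.im = 0 ∧ A.im = 0 ∧ B.im = 0 := by
    intro X A B h hX
    have hq : 0 < -pw m y := by linarith
    have e : ‖X‖ = ‖((-pw m y : ℝ) : ℂ) + A + B‖ := by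
      rw [← norm_neg X]; congr 1; push_cast; rw [← h]; ring
    have hA : A.im = 0 := im_eq_zero_of_norm_add hq (by
      have := norm_add_le (((-pw m y : ℝ) : ℂ) + A) B
      linarith)
    have hB : B.im = 0 := im_eq_zero_of_norm_add hq (by
      have := norm_add_le (((-pw m y : ℝ) : ℂ) + B) A
      rw [add_right_comm] at this
      linarith)
    have := congrArg Complex.im h
    simp only [Complex.add_im, Complex.ofReal_im, hA, hB] at this
    exact ⟨by linarith, hA, hB⟩
  have hk3 := key _ _ _ h (by linarith)
  simp only [Complex.im_ofReal_mul] at hk3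
  apply eq_of_cr_eq_zero hm
  intro b
  rcases forall_three hij hik hjk b with rfl | rfl | rfl
  · exact (mul_eq_zero.1 hk3.1).resolve_left hi.ne
  · exact (mul_eq_zero.1 hk3.2.1).resolve_left hj.ne'
  · exact (mul_eq_zero.1 hk3.2.2).resolve_left hk.ne'

/-- On an arc of the circle the weights `bary m b y * dist y (m b)` are proportional to the
sides of the triangle. -/
lemma weights_of_arc {i j k : Fin 3} (hij : i ≠ j) (hik : i ≠ k) (hjk : j ≠ k) {y : Plane}
    (hy : y ∈ reg m i) (hp : pw m y = 0) :
    bary m j y * dist y (m j) * dist (m j) (m k) =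
      -bary m i y * dist y (m i) * dist (m i) (m k) := by
  -- The choice z = m k kills one term; since pw y = 0 the other two are opposite and have equal
  -- norms.
  have h := sum_bary_cx m y (m k)
  have eA := norm_bary_cx m j y (m k)
  have eX := norm_bary_cx m i y (m k)
  have eB := norm_bary_cx m k y (m k)
  rw [dist_self, mul_zero, norm_eq_zero] at eB
  rw [sum_three hij hik hjk, hp, eB, add_zero, Complex.ofReal_zero, add_eq_zero_iff_eq_neg] at h
  rw [abs_of_nonneg (hy.2.1 j hij.symm)] at eA
  rw [h, norm_neg, eA, abs_of_nonpos hy.1, dist_comm (m k), dist_comm (m k)] at eX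
  exact eX

/-- The inner product of the sides of the triangle at the vertex `m i`. -/
def sideInner (m : Fin 3 → Plane) (i j k : Fin 3) : ℝ :=
  (m j 0 - m i 0) * (m k 0 - m i 0) + (m j 1 - m i 1) * (m k 1 - m i 1)

lemma sideInner_sq (m : Fin 3 → Plane) (i j k : Fin 3) :
    sideInner m i j k ^ 2 + cr (m j - m i) (m k - m i) ^ 2
      = (dist (m i) (m j) * dist (m i) (m k)) ^ 2 := by
  rw [mul_pow, dist_sq, dist_sq]; simp [sideInner, cr]; ring

/-- The squared norm of the complex identity (z - m_i)(m_j - m_k) = (z - m_j)(m_i - m_k) - (z -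
m_k)(m_i - m_j). The law of cosines expresses the inner product of z - m_j and z - m_k through
distances. -/
lemma sq_dist_opposite (m : Fin 3 → Plane) (i j k : Fin 3) (z : Plane) :
    (dist (m j) (m k) * dist z (m i)) ^ 2 = (dist (m i) (m k) * dist z (m j)) ^ 2 +
      (dist (m i) (m j) * dist z (m k)) ^ 2 -
      2 * ((dist z (m j) ^ 2 + dist z (m k) ^ 2 - dist (m j) (m k) ^ 2) / 2 * sideInner m i j k +
        cr (m j - z) (m k - z) * cr (m j - m i) (m k - m i)) := by
  simp only [mul_pow, dist_sq]; simp [sideInner, cr]; ring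

/-- The squares of the inner product and of the determinant of two vectors add up to the square of
the product of their norms; the inner product is again written by the law of cosines. -/
lemma heron (m : Fin 3 → Plane) (j k : Fin 3) (z : Plane) :
    ((dist z (m j) ^ 2 + dist z (m k) ^ 2 - dist (m j) (m k) ^ 2) / 2) ^ 2 +
      cr (m j - z) (m k - z) ^ 2 = (dist z (m j) * dist z (m k)) ^ 2 := by
  simp only [mul_pow, dist_sq]; simp [cr]; ring

include hm in
-- Valid for both orientations of i, j, k, whereas `bary` is defined through the cyclic order:
-- exchanging j and k changes the sign of both determinants.
lemma bary_mul_cr {i j k : Fin 3} (hij : i ≠ j) (hik : i ≠ k) (hjk : j ≠ k) (x : Plane) :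
    bary m i x * cr (m j - m i) (m k - m i) = cr (m j - x) (m k - x) := by
  have hs := bary_sum hm x
  have h0 := bary_vec m x 0
  have h1 := bary_vec m x 1
  rw [sum_three hij hik hjk] at hs h0 h1
  simp only [cr, PiLp.sub_apply]
  linear_combination (m k 1 - m j 1) * h0 - (m k 0 - m j 0) * h1
    + ((m j 0 - x 0) * (m k 1 - x 1) - (m j 1 - x 1) * (m k 0 - x 0)) * hs

include hm in
lemma cr_sides_ne_zero {i j k : Fin 3} (hij : i ≠ j) (hik : i ≠ k) (hjk : j ≠ k) :
    cr (m j - m i) (m k - m i) ≠ 0 := by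
  intro h
  have := bary_mul_cr hm hij.symm hjk hik (m j)
  rw [bary_self hm] at this
  have h2 : cr (m i - m j) (m k - m j) = - cr (m j - m i) (m k - m i) := by simp [cr]; ring
  have h3 : ∀ x, cr (m j - x) (m k - x) = 0 := fun x => by
    rw [← bary_mul_cr hm hij hik hjk, h, mul_zero]
  have hjk' := receivers_ne hm hjk
  apply hjk'
  have e0 := h3 (m j + !₂[1, 0])
  have e1 := h3 (m j + !₂[0, 1])
  simp [cr] at e0 e1
  exact plane_ext (by linarith) (by linarith)

include hm in
-- A form of the inscribed angle theorem: `pw` vanishes when the angles subtended by the side m_j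
-- m_k at x and at m_i have the same cotangent.
lemma cr_mul_pw {i j k : Fin 3} (hij : i ≠ j) (hik : i ≠ k) (hjk : j ≠ k) (x : Plane) :
    cr (m j - m i) (m k - m i) * pw m x = cr (m j - x) (m k - x) * sideInner m i j k -
      (dist x (m j) ^ 2 + dist x (m k) ^ 2 - dist (m j) (m k) ^ 2) / 2 *
        cr (m j - m i) (m k - m i) := by
  have hi := bary_mul_cr hm hij hik hjk x
  have hj := bary_mul_cr hm hjk hij.symm hik.symm x
  have hk := bary_mul_cr hm hik.symm hjk.symm hij x
  have ej : cr (m k - m j) (m i - m j) = cr (m j - m i) (m k - m i) := by simp [cr]; ring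
  have ek : cr (m i - m k) (m j - m k) = cr (m j - m i) (m k - m i) := by simp [cr]; ring
  rw [ej] at hj
  rw [ek] at hk
  rw [pw, sum_three hij hik hjk]
  simp only [dist_sq]
  simp only [cr, PiLp.sub_apply, sideInner] at *
  linear_combination ((x 0 - m i 0) ^ 2 + (x 1 - m i 1) ^ 2) * hi +
    ((x 0 - m j 0) ^ 2 + (x 1 - m j 1) ^ 2) * hj + ((x 0 - m k 0) ^ 2 + (x 1 - m k 1) ^ 2) * hk

/-- The case of equality of Ptolemy's inequality. -/
lemma ptolemy_eq (m : Fin 3 → Plane) {i j k : Fin 3} {z : Plane}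
    (h : dist (m j) (m k) * dist z (m i) =
      dist (m i) (m k) * dist z (m j) + dist (m i) (m j) * dist z (m k)) :
    dist (m i) (m j) * dist (m i) (m k) *
      (dist z (m j) ^ 2 + dist z (m k) ^ 2 - dist (m j) (m k) ^ 2) +
      2 * sideInner m i j k * (dist z (m j) * dist z (m k)) = 0 := by
  have h1 := sq_dist_opposite m i j k z
  have h2 := heron m j k z
  have h3 := sideInner_sq m i j k
  rw [h] at h1
  generalize hr : (dist z (m j) ^ 2 + dist z (m k) ^ 2 - dist (m j) (m k) ^ 2) = r at *
  generalize cr (m j - z) (m k - z) = s at *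
  generalize cr (m j - m i) (m k - m i) = c at *
  generalize sideInner m i j k = b at *
  -- By `h2` and `h3` the vectors (r/2, s) and (b, c) have norms |z - m_j||z - m_k| and |m_i -
  -- m_j||m_i - m_k|. By `h1`, equality in Ptolemy says that their inner product is minus the
  -- product of these norms, so they are antiparallel.
  have h4 : (dist (m i) (m j) * dist (m i) (m k) * (r / 2) + b * (dist z (m j) * dist z (m k))) ^ 2
      + (dist (m i) (m j) * dist (m i) (m k) * s + c * (dist z (m j) * dist z (m k))) ^ 2 = 0 := by
    linear_combination (dist (m i) (m j) * dist (m i) (m k)) ^ 2 * h2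
      + (dist z (m j) * dist z (m k)) ^ 2 * h3
      + (dist (m i) (m j) * dist (m i) (m k)) * (dist z (m j) * dist z (m k)) * h1
  have h5 := pow_eq_zero_iff (two_ne_zero) |>.1
    (le_antisymm (by nlinarith [sq_nonneg (dist (m i) (m j) * dist (m i) (m k) * s
      + c * (dist z (m j) * dist z (m k)))]) (sq_nonneg (dist (m i) (m j) * dist (m i) (m k)
      * (r / 2) + b * (dist z (m j) * dist z (m k)))))
  linarith

include hm in
/-- A point with given distances from two receivers, on the far side of the third one. -/
lemma exists_arc_point {i j k : Fin 3} (hij : i ≠ j) (hik : i ≠ k) (hjk : j ≠ k) {p q t : ℝ}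
    (hp : 0 ≤ p) (hq : 0 ≤ q) (ht : dist (m j) (m k) * t =
      dist (m i) (m k) * p + dist (m i) (m j) * q)
    (h : dist (m i) (m j) * dist (m i) (m k) * (p ^ 2 + q ^ 2 - dist (m j) (m k) ^ 2) +
      2 * sideInner m i j k * (p * q) = 0) :
    ∃ z, dist z (m j) = p ∧ dist z (m k) = q ∧ dist z (m i) = t ∧ bary m i z ≤ 0 ∧ pw m z = 0 := by
  have hd := receivers_dist_pos hm hjk
  have hd1 := receivers_dist_pos hm hij
  have hd2 := receivers_dist_pos hm hik
  have hc := cr_sides_ne_zero hm hij hik hjk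
  have h3 := sideInner_sq m i j k
  obtain ⟨Q, hQ⟩ : ∃ Q, Q = dist (m i) (m j) * dist (m i) (m k) := ⟨_, rfl⟩
  have hQ0 : 0 < Q := by rw [hQ]; positivity
  rw [← hQ] at h h3
  obtain ⟨c, hcd⟩ : ∃ c, c = cr (m j - m i) (m k - m i) := ⟨_, rfl⟩
  rw [← hcd] at hc h3
  obtain ⟨b, hb⟩ : ∃ b, b = sideInner m i j k := ⟨_, rfl⟩
  rw [← hb] at h h3
  obtain ⟨d, hdd⟩ : ∃ d, d = dist (m j) (m k) := ⟨_, rfl⟩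
  have hdsq := dist_sq (m j) (m k)
  rw [← hdd] at h hd hdsq ht
  -- The required value of cr (m j - z) (m k - z); its sign, opposite to that of c, puts z beyond
  -- the side. The number a below is the inner product of z - m_j and m_k - m_j, so that z is found
  -- from its components along the side and orthogonal to it.
  obtain ⟨s, hs⟩ : ∃ s, s = -c * (p * q) / Q := ⟨_, rfl⟩
  obtain ⟨a, ha⟩ : ∃ a, a = (p ^ 2 + d ^ 2 - q ^ 2) / 2 := ⟨_, rfl⟩
  have hsQ : s * Q = -c * (p * q) := by rw [hs]; field_simp
  have hs2 : a ^ 2 + s ^ 2 = p ^ 2 * d ^ 2 := by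
    have e : ((p ^ 2 + q ^ 2 - d ^ 2) / 2) ^ 2 + s ^ 2 = (p * q) ^ 2 := by
      have hQ2 : Q ^ 2 ≠ 0 := by positivity
      apply mul_left_cancel₀ hQ2
      have e1 : (s * Q) ^ 2 = (-c * (p * q)) ^ 2 := by rw [hsQ]
      linear_combination e1 + (p * q) ^ 2 * h3
        + (Q * (p ^ 2 + q ^ 2 - d ^ 2) - 2 * b * (p * q)) / 4 * h
    rw [ha]; linear_combination e
  obtain ⟨z, hz0, hz1⟩ : ∃ z : Plane, z 0 = m j 0 + (a * (m k 0 - m j 0) - s * (m k 1 - m j 1)) / d ^ 2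
      ∧ z 1 = m j 1 + (a * (m k 1 - m j 1) + s * (m k 0 - m j 0)) / d ^ 2 :=
    ⟨!₂[_, _], rfl, rfl⟩
  have hd2' : d ^ 2 ≠ 0 := by positivity
  have f1 : dist z (m j) = p := by
    rw [← pow_left_inj₀ dist_nonneg hp two_ne_zero, dist_sq, hz0, hz1]
    field_simp
    linear_combination d ^ 2 * hs2 - (a ^ 2 + s ^ 2) * hdsq
  have f2 : dist z (m k) = q := by
    rw [← pow_left_inj₀ dist_nonneg hq two_ne_zero, dist_sq, hz0, hz1]
    have e : a * 2 = p ^ 2 + d ^ 2 - q ^ 2 := by rw [ha]; ring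
    field_simp
    linear_combination d ^ 2 * hs2 - (a ^ 2 + s ^ 2 - 2 * a * d ^ 2 + d ^ 4) * hdsq - d ^ 4 * e
  have f3 : cr (m j - z) (m k - z) = s := by
    simp only [cr, PiLp.sub_apply, hz0, hz1]
    field_simp
    linear_combination -d ^ 2 * s * hdsq
  have f4 : dist z (m i) = t := by
    have e := sq_dist_opposite m i j k z
    rw [f1, f2, f3, ← hcd, ← hdd, ← hb] at e
    have ht0 : 0 ≤ t := by
      by_contra! h0
      have := mul_pos_of_neg_of_neg h0 (neg_neg_of_pos hd)
      have : 0 ≤ dist (m i) (m k) * p + dist (m i) (m j) * q := by positivity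
      nlinarith
    have e2 : (d * dist z (m i)) ^ 2 = (d * t) ^ 2 := by
      rw [e, ht]
      have hQ2 : Q ≠ 0 := hQ0.ne'
      apply mul_left_cancel₀ hQ2
      linear_combination (-2 * c) * hsQ - b * h + 2 * (p * q) * h3 + 2 * (p * q) * Q * hQ
    exact mul_left_cancel₀ hd.ne' ((pow_left_inj₀ (by positivity) (by positivity) two_ne_zero).1 e2)
  refine ⟨z, f1, f2, f4, ?_, ?_⟩
  · have := bary_mul_cr hm hij hik hjk z
    rw [f3, ← hcd] at this
    have e : bary m i z = -(p * q) / Q := by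
      apply mul_right_cancel₀ hc
      rw [this, hs]; ring
    rw [e, neg_div]
    exact neg_nonpos.2 (by positivity)
  · have := cr_mul_pw hm hij hik hjk z
    rw [f1, f2, f3, ← hcd, ← hdd, ← hb] at this
    have e : Q * c * pw m z = 0 := by
      linear_combination Q * this + b * hsQ - c / 2 * h
    exact (mul_eq_zero.1 e).resolve_left (mul_ne_zero hQ0.ne' hc)

end

end

/-! ### The circle, its arcs and the sides of the lines in barycentric terms -/

section

lemma bary_sub (m : Fin 3 → Plane) (i : Fin 3) (x y : Plane) :
    bary m i x - bary m i y = cr (x - y) (m (i + 1) - m (i + 2)) / area m := by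
  rw [bary, bary, ← sub_div]; congr 1; simp [cr]; ring

lemma continuous_bary (m : Fin 3 → Plane) (i : Fin 3) : Continuous (bary m i) := by
  unfold bary cr; fun_prop

lemma continuous_pw (m : Fin 3 → Plane) : Continuous (pw m) := by
  unfold pw
  exact continuous_finsetSum _ fun b _ => (continuous_bary m b).mul (by fun_prop)

section
variable {m : Fin 3 → Plane} (hm : ¬ Collinear ℝ (Set.range m))
include hm

/-- Leibniz's formula: expanding |m_b - o|² around x, the cross terms vanish. With o the
circumcentre it gives pw x = R² - |x - o|². -/
lemma sum_bary_dist_sq (x o : Plane) :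
    ∑ b, bary m b x * dist (m b) o ^ 2 = pw m x + dist x o ^ 2 := by
  have hs := bary_sum hm x
  have h0 := bary_vec m x 0
  have h1 := bary_vec m x 1
  rw [pw]
  rw [Fin.sum_univ_three] at *
  rw [Fin.sum_univ_three]
  simp only [dist_sq]
  linear_combination ((x 0 - o 0) ^ 2 + (x 1 - o 1) ^ 2) * hs - 2 * (x 0 - o 0) * h0
    - 2 * (x 1 - o 1) * h1

lemma mem_circle_iff (x : Plane) : x ∈ circle m ↔ pw m x = 0 := by
  constructor
  · rintro ⟨o, r, h⟩
    have := sum_bary_dist_sq hm x o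
    rw [h x (Set.mem_insert _ _), Finset.sum_congr rfl (fun b _ => by
      rw [h (m b) (Set.mem_insert_of_mem _ (Set.mem_range_self b))]), ← Finset.sum_mul,
      bary_sum hm, one_mul] at this
    linarith
  · intro h
    have ha := affineIndependent_iff_not_collinear.2 hm
    obtain ⟨s, ⟨-, hs⟩, -⟩ := ha.existsUnique_dist_eq
    have hs' : ∀ b, dist (m b) s.center = s.radius := fun b => hs (Set.mem_range_self b)
    refine ⟨s.center, s.radius, ?_⟩
    rintro p (rfl | ⟨b, rfl⟩)
    · have := sum_bary_dist_sq hm p s.center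
      rw [h, Finset.sum_congr rfl (fun b _ => by rw [hs' b]), ← Finset.sum_mul,
        bary_sum hm, one_mul, zero_add] at this
      have hr : 0 ≤ s.radius := by rw [← hs' 0]; exact dist_nonneg
      exact ((pow_left_inj₀ hr dist_nonneg two_ne_zero).1 this).symm
    · exact hs' b

lemma mem_line_iff {i j k : Fin 3} (hij : i ≠ j) (hik : i ≠ k) (hjk : j ≠ k) (x : Plane) :
    x ∈ line[ℝ, m j, m k] ↔ bary m i x = 0 := by
  rw [mem_affineSpan_pair_iff_exists_lineMap_eq]
  constructor
  · rintro ⟨r, rfl⟩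
    refine (bary_eq_of_combo hm (l := fun b => if b = i then 0 else if b = j then 1 - r else r)
      ?_ ?_ i).trans (by simp)
    · rw [sum_three hij hik hjk]; simp [hij.symm, hik.symm, hjk.symm]
    · rw [sum_three hij hik hjk]; simp [hij.symm, hik.symm, hjk.symm, AffineMap.lineMap_apply]
      module
  · intro h
    refine ⟨bary m k x, ?_⟩
    have hs := bary_sum hm x
    conv_rhs => rw [eq_combo hm x]
    rw [sum_three hij hik hjk] at hs ⊢
    rw [h, zero_add] at hs
    have : bary m j x = 1 - bary m k x := by linarith
    rw [h, this]
    simp [AffineMap.lineMap_apply]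
    module

lemma wOppSide_iff {i j k : Fin 3} (hij : i ≠ j) (hik : i ≠ k) (hjk : j ≠ k) (x : Plane) :
    (line[ℝ, m j, m k]).WOppSide (m i) x ↔ bary m i x ≤ 0 := by
  have hD := area_ne_zero hm
  constructor
  · rintro ⟨p, hp, q, hq, h⟩
    rw [mem_line_iff hm hij hik hjk] at hp hq
    have e1 := bary_sub m i (m i) p
    have e2 := bary_sub m i q x
    rw [bary_self hm, hp] at e1
    rw [hq] at e2
    simp only [vsub_eq_sub] at h
    rcases h with h | h | ⟨r, s, hr, hs, h⟩
    · rw [h] at e1; simp [cr] at e1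
    · rw [h] at e2; simp [cr] at e2; linarith
    · have h0 : r * (m i 0 - p 0) = s * (q 0 - x 0) := by simpa using congrArg (fun v => v 0) h
      have h1 : r * (m i 1 - p 1) = s * (q 1 - x 1) := by simpa using congrArg (fun v => v 1) h
      have : r * 1 = s * (0 - bary m i x) := by
        rw [e2, ← sub_zero (1 : ℝ), e1]
        simp only [cr, PiLp.sub_apply]
        field_simp
        linear_combination (m (i + 1) 1 - m (i + 2) 1) * h0 - (m (i + 1) 0 - m (i + 2) 0) * h1
      by_contra! h3
      nlinarith [mul_pos hs h3]
  · intro h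
    -- The second point on the line is the projection of x parallel to m_i - m_j.
    refine ⟨m j, left_mem_affineSpan_pair _ _ _, x + (-bary m i x) • (m i - m j), ?_, ?_⟩
    · rw [mem_line_iff hm hij hik hjk]
      have e1 := bary_sub m i (m i) (m j)
      have e2 := bary_sub m i (x + (-bary m i x) • (m i - m j)) x
      rw [bary_self hm, bary_of_ne hm hij] at e1
      have e3 : cr (x + (-bary m i x) • (m i - m j) - x) (m (i + 1) - m (i + 2)) / area m =
        -bary m i x * (cr (m i - m j) (m (i + 1) - m (i + 2)) / area m) := by
        simp [cr]; ring
      rw [e3, ← e1] at e2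
      linarith
    · simp only [vsub_eq_sub, add_sub_cancel_left]
      exact SameRay.sameRay_nonneg_smul_right _ (by linarith)

/-- On the circle the single sign condition suffices: a second negative coordinate would make `pw`
negative, also when β_i = 0. -/
lemma mem_reg_of_pw {i : Fin 3} {x : Plane} (h : bary m i x ≤ 0) (hp : pw m x = 0) :
    x ∈ reg m i := by
  refine ⟨h, fun j hj => ?_, hp.le⟩
  by_contra! hj0
  obtain ⟨k, hjk, hik⟩ := exists_third hj
  rcases h.lt_or_eq with h | h
  · exact (pw_neg_of_neg hm hjk.symm hik.symm hj hj0 h).ne hp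
  · have hs := bary_sum hm x
    rw [pw_eq hm hj.symm hik hjk, h] at hp
    rw [sum_three hj.symm hik hjk, h] at hs
    have h1 := receivers_dist_pos hm hjk
    have : bary m j x * bary m k x < 0 := mul_neg_of_neg_of_pos hj0 (by linarith)
    nlinarith [mul_neg_of_neg_of_pos this (pow_pos h1 2)]

end

lemma jj_ne (i : Fin 3) : i ≠ jj i := by fin_cases i <;> decide
lemma kk_ne (i : Fin 3) : i ≠ kk i := by fin_cases i <;> decide
lemma jj_ne_kk (i : Fin 3) : jj i ≠ kk i := by fin_cases i <;> decide

lemma mem_arc_iff {m : Fin 3 → Plane} (hm : ¬ Collinear ℝ (Set.range m)) (i : Fin 3) (x : Plane) :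
    x ∈ arc m i ↔ bary m i x ≤ 0 ∧ pw m x = 0 := by
  rw [arc, Set.mem_ofPred_eq, mem_circle_iff hm, wOppSide_iff hm (jj_ne i) (kk_ne i) (jj_ne_kk i),
    and_comm]

/-! ### First and second order conditions for weighted sums of distances -/

/-- The inner product of two vectors of the plane. -/
def dot (e f : Plane) : ℝ := e 0 * f 0 + e 1 * f 1

lemma dist_eq_sqrt (x y : Plane) : dist x y = √((x 0 - y 0) ^ 2 + (x 1 - y 1) ^ 2) := by
  rw [← dist_sq, Real.sqrt_sq dist_nonneg]

lemma hasDerivAt_dist {y v a : Plane} {t : ℝ} (h : y + t • v ≠ a) :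
    HasDerivAt (fun s : ℝ => dist (y + s • v) a)
      (dot (y + t • v - a) v / dist (y + t • v) a) t := by
  have hpos : 0 < dist (y + t • v) a := dist_pos.2 h
  have hq : HasDerivAt (fun s : ℝ => (y 0 + s * v 0 - a 0) ^ 2 + (y 1 + s * v 1 - a 1) ^ 2)
      (2 * dot (y + t • v - a) v) t := by
    have h0 : HasDerivAt (fun s : ℝ => y 0 + s * v 0 - a 0) (v 0) t := by
      simpa using (((hasDerivAt_id t).mul_const (v 0)).const_add (y 0)).sub_const (a 0)
    have h1 : HasDerivAt (fun s : ℝ => y 1 + s * v 1 - a 1) (v 1) t := by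
      simpa using (((hasDerivAt_id t).mul_const (v 1)).const_add (y 1)).sub_const (a 1)
    refine ((h0.pow 2).add (h1.pow 2)).congr_deriv ?_
    simp only [dot, PiLp.sub_apply, PiLp.add_apply, PiLp.smul_apply, smul_eq_mul]
    ring
  have hne : (y 0 + t * v 0 - a 0) ^ 2 + (y 1 + t * v 1 - a 1) ^ 2 ≠ 0 := by
    have := dist_sq (y + t • v) a
    simp at this
    rw [← this]; positivity
  have := hq.sqrt hne
  have e : (fun s : ℝ => dist (y + s • v) a) =
      fun s : ℝ => √((y 0 + s * v 0 - a 0) ^ 2 + (y 1 + s * v 1 - a 1) ^ 2) := by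
    ext s; rw [dist_eq_sqrt]; simp
  rw [e]
  refine this.congr_deriv ?_
  have e2 := congrFun e t
  simp only at e2
  rw [← e2]
  field_simp

lemma hasDerivAt_dot_div {y v a : Plane} (u : Plane) (h : y ≠ a) :
    HasDerivAt (fun s : ℝ => dot (y + s • v - a) u / dist (y + s • v) a)
      ((dot v u * dist y a ^ 2 - dot (y - a) u * dot (y - a) v) / dist y a ^ 3) 0 := by
  have hpos : 0 < dist y a := dist_pos.2 h
  have h1 : HasDerivAt (fun s : ℝ => dot (y + s • v - a) u) (dot v u) 0 := by
    have e : (fun s : ℝ => dot (y + s • v - a) u) = fun s => dot (y - a) u + s * dot v u := by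
      ext s; simp [dot]; ring
    rw [e]
    simpa using ((hasDerivAt_id (0 : ℝ)).mul_const (dot v u)).const_add (dot (y - a) u)
  have h2 := hasDerivAt_dist (y := y) (v := v) (a := a) (t := 0) (by simpa using h)
  have := h1.div h2 (by simpa using hpos.ne')
  refine this.congr_deriv ?_
  simp only [zero_smul, add_zero]
  field_simp

/-- The weighted sum of the distances from the receivers. -/
def wdist (m : Fin 3 → Plane) (w : Fin 3 → ℝ) (z : Plane) : ℝ := ∑ b, w b * dist z (m b)

lemma tendsto_line (y v : Plane) : Filter.Tendsto (fun t : ℝ => y + t • v) (nhds 0) (nhds y) := by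
  have : Continuous (fun t : ℝ => y + t • v) := by fun_prop
  simpa using this.tendsto 0

lemma eventually_nonreceiver {m : Fin 3 → Plane} {y : Plane} (hy : y ∉ Set.range m) :
    ∀ᶠ z in nhds y, z ∉ Set.range m :=
  (Set.finite_range m).isClosed.isOpen_compl.mem_nhds hy

lemma hasDerivAt_wdist {m : Fin 3 → Plane} (w : Fin 3 → ℝ) {y v : Plane} {t : ℝ}
    (h : y + t • v ∉ Set.range m) :
    HasDerivAt (fun s : ℝ => wdist m w (y + s • v))
      (∑ b, w b * (dot (y + t • v - m b) v / dist (y + t • v) (m b))) t := by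
  unfold wdist
  exact HasDerivAt.fun_sum fun b _ =>
    (hasDerivAt_dist (fun e => h ⟨b, e.symm⟩)).const_mul (w b)

section
variable {m : Fin 3 → Plane} {w : Fin 3 → ℝ} {y : Plane}

lemma isLocalMin_line (hmin : ∀ z, wdist m w y ≤ wdist m w z) (v : Plane) :
    IsLocalMin (fun s : ℝ => wdist m w (y + s • v)) 0 :=
  Filter.Eventually.of_forall fun s => by simpa using hmin (y + s • v)

lemma first_order (hy : y ∉ Set.range m) (hmin : ∀ z, wdist m w y ≤ wdist m w z) (v : Plane) :
    ∑ b, w b * (dot (y - m b) v / dist y (m b)) = 0 := by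
  have := (isLocalMin_line hmin v).hasDerivAt_eq_zero
    (hasDerivAt_wdist w (t := 0) (by simpa using hy))
  simpa using this

/-- The second derivative of the distance from m_b along v is cr (y - m b) v ^ 2 / dist y (m b) ^ 3,
since only the transverse component contributes. -/
lemma second_order (hy : y ∉ Set.range m) (hmin : ∀ z, wdist m w y ≤ wdist m w z) (v : Plane) :
    0 ≤ ∑ b, w b * (cr (y - m b) v ^ 2 / dist y (m b) ^ 3) := by
  have hne : ∀ b, y ≠ m b := fun b e => hy ⟨b, e.symm⟩
  set g : ℝ → ℝ := fun s => wdist m w (y + s • v) with hg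
  have hd : deriv g =ᶠ[nhds 0]
      fun t => ∑ b, w b * (dot (y + t • v - m b) v / dist (y + t • v) (m b)) :=
    ((tendsto_line y v).eventually (eventually_nonreceiver hy)).mono
      fun t ht => (hasDerivAt_wdist w ht).deriv
  have h2 : deriv (deriv g) 0 = ∑ b, w b * (cr (y - m b) v ^ 2 / dist y (m b) ^ 3) := by
    rw [hd.deriv_eq]
    rw [(HasDerivAt.fun_sum fun b _ =>
      (hasDerivAt_dot_div (v := v) v (hne b)).const_mul (w b)).deriv]
    refine Finset.sum_congr rfl fun b _ => ?_
    congr 2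
    rw [dist_sq]; simp [dot, cr]; ring
  rw [← h2]
  -- A negative second derivative would make the minimum a local maximum as well; the function would
  -- be locally constant and its second derivative 0.
  by_contra! hneg
  have hmin' := isLocalMin_line hmin v
  have hmax : IsLocalMax g 0 := isLocalMax_of_deriv_deriv_neg hneg hmin'.deriv_eq_zero
    (hasDerivAt_wdist w (t := 0) (by simpa using hy)).continuousAt
  have hc : g =ᶠ[nhds 0] fun _ => g 0 := by
    filter_upwards [hmax, hmin'] with t h1 h2 using le_antisymm h1 h2
  have h3 : deriv g =ᶠ[nhds 0] fun _ => 0 := by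
    have := hc.deriv
    simpa using this
  rw [h3.deriv_eq] at hneg
  simp at hneg

/-- At m_i the distance from m_i has only the one-sided derivative ‖v‖, so minimality gives an
inequality for the right derivative in each direction. -/
lemma first_order_receiver (hm : ¬ Collinear ℝ (Set.range m)) {i j k : Fin 3} (hij : i ≠ j)
    (hik : i ≠ k) (hjk : j ≠ k) (hmin : ∀ z, wdist m w (m i) ≤ wdist m w z) (v : Plane) :
    0 ≤ w i * ‖v‖ + w j * (dot (m i - m j) v / dist (m i) (m j)) +
      w k * (dot (m i - m k) v / dist (m i) (m k)) := by
  have hj := (hasDerivAt_dist (y := m i) (v := v) (a := m j) (t := 0)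
    (by simpa using receivers_ne hm hij)).const_mul (w j)
  have hk := (hasDerivAt_dist (y := m i) (v := v) (a := m k) (t := 0)
    (by simpa using receivers_ne hm hik)).const_mul (w k)
  have hi : HasDerivAt (fun t : ℝ => w i * (t * ‖v‖)) (w i * ‖v‖) 0 := by
    simpa using ((hasDerivAt_id (0 : ℝ)).mul_const ‖v‖).const_mul (w i)
  have h := (hi.add hj).add hk
  simp only [zero_smul, add_zero] at h
  refine ge_of_tendsto (hasDerivAt_iff_tendsto_slope_zero.1 h |>.mono_left
    (nhdsWithin_mono 0 (fun t ht => ne_of_gt ht) : nhdsWithin (0 : ℝ) (Set.Ioi 0) ≤ _)) ?_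
  filter_upwards [self_mem_nhdsWithin] with t (ht : 0 < t)
  have h1 := hmin (m i + t • v)
  rw [wdist, wdist, sum_three hij hik hjk, sum_three hij hik hjk, dist_self,
    dist_self_add_left, norm_smul, Real.norm_eq_abs, abs_of_pos ht] at h1
  simp only [Pi.add_apply, smul_eq_mul, zero_add, zero_mul, zero_smul, add_zero, mul_zero]
  exact mul_nonneg (inv_nonneg.2 ht.le) (by linarith)

end

end

/-! ### Supporting functionals, faces and the closure of the hull -/

section

/-- The linear functional with coefficients `w`. -/
def lin (w : Fin 3 → ℝ) : TSpace →ₗ[ℝ] ℝ where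
  toFun p := ∑ b, w b * p b
  map_add' p q := by simp [mul_add, Finset.sum_add_distrib]
  map_smul' c p := by simp [Finset.mul_sum, mul_left_comm]

lemma lin_apply (w : Fin 3 → ℝ) (p : TSpace) : lin w p = ∑ b, w b * p b := rfl

lemma continuous_lin (w : Fin 3 → ℝ) : Continuous (lin w) :=
  (lin w).continuous_of_finiteDimensional

lemma lin_rangeMap (m : Fin 3 → Plane) (w : Fin 3 → ℝ) (z : Plane) :
    lin w (rangeMap m z) = wdist m w z := rfl

lemma exists_eq_lin (f : TSpace →ₗ[ℝ] ℝ) : ∃ w, f = lin w := by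
  refine ⟨fun b => f (EuclideanSpace.single b 1), ?_⟩
  refine (EuclideanSpace.basisFun (Fin 3) ℝ).toBasis.ext fun b => ?_
  simp [lin_apply]

/-- The direction of the unbounded edges. -/
def one : TSpace := WithLp.toLp 2 (fun _ => 1)

@[simp] lemma one_apply (b : Fin 3) : one b = 1 := rfl

lemma lin_one (w : Fin 3 → ℝ) : lin w one = ∑ b, w b := by simp [lin_apply]

/-- The face of a convex hull is the hull of the generators on it: in a combination with positive
coefficients the minimal value M forces the value M at both ends. -/
lemma mem_convexHull_face {E : Type*} [AddCommGroup E] [Module ℝ E] (f : E →ₗ[ℝ] ℝ) {S : Set E}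
    {M : ℝ} (h : ∀ p ∈ S, M ≤ f p) {q : E} (hq : q ∈ convexHull ℝ S) :
    M ≤ f q ∧ (f q = M → q ∈ convexHull ℝ {p ∈ S | f p = M}) := by
  have hc : Convex ℝ {q | M ≤ f q ∧ (f q = M → q ∈ convexHull ℝ {p ∈ S | f p = M})} := by
    rw [convex_iff_forall_pos]
    intro x hxx y hyy a b ha hb hab
    obtain ⟨hx, hx'⟩ := hxx
    obtain ⟨hy, hy'⟩ := hyy
    have e : f (a • x + b • y) = a * f x + b * f y := by simp
    have h1 := mul_le_mul_of_nonneg_left hx ha.le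
    have h2 := mul_le_mul_of_nonneg_left hy hb.le
    have h3 : a * M + b * M = M := by rw [← add_mul, hab, one_mul]
    refine ⟨by rw [e]; linarith, fun he => ?_⟩
    rw [e] at he
    have ex : f x = M := mul_left_cancel₀ ha.ne' (by linarith)
    have ey : f y = M := mul_left_cancel₀ hb.ne' (by linarith)
    exact convex_convexHull ℝ _ (hx' ex) (hy' ey) ha.le hb.le hab
  refine convexHull_min ?_ hc hq
  exact fun p hp => ⟨h p hp, fun e => subset_convexHull ℝ _ ⟨hp, e⟩⟩

/-- In finite dimension the convex hull of a compact set is compact. -/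
lemma isCompact_convexHull {E : Type*} [NormedAddCommGroup E] [NormedSpace ℝ E]
    [FiniteDimensional ℝ E] {s : Set E} (hs : IsCompact s) : IsCompact (convexHull ℝ s) := by
  -- Carathéodory: dim + 1 points suffice, so the hull is a continuous image of the compact product
  -- of the simplex and s^κ.
  let κ := Fin (Module.finrank ℝ E + 1)
  have h : convexHull ℝ s = (fun q : (κ → ℝ) × (κ → E) => ∑ i, q.1 i • q.2 i) ''
      (stdSimplex ℝ κ ×ˢ Set.pi Set.univ fun _ => s) := by
    apply Set.Subset.antisymm
    · intro x hx
      obtain ⟨ι, _, z, w, hz, hi, hw, hw1, hx⟩ := eq_pos_convex_span_of_mem_convexHull hx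
      have hcard : Fintype.card ι ≤ Fintype.card κ := by
        rw [Fintype.card_fin]
        exact hi.card_le_finrank_succ.trans (Nat.add_le_add_right (Submodule.finrank_le _) 1)
      obtain ⟨e⟩ := Function.Embedding.nonempty_of_card_le hcard
      obtain ⟨i₀⟩ : Nonempty ι := by
        by_contra hne
        rw [not_nonempty_iff] at hne
        simp at hw1
      -- Unused slots get weight 0 and the arbitrary point z i₀ of s.
      refine ⟨(Function.extend e w 0, Function.extend e z fun _ => z i₀), ⟨⟨?_, ?_⟩, ?_⟩, ?_⟩
      · intro k
        by_cases hk : ∃ i, e i = k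
        · obtain ⟨i, rfl⟩ := hk
          simpa [e.injective.extend_apply] using (hw i).le
        · simp [Function.extend_apply' _ _ _ hk]
      · rw [← hw1]
        refine (Fintype.sum_of_injective e e.injective _ _ (fun k hk => ?_) fun i => ?_).symm
        · simp [Function.extend_apply' _ _ _ (show ¬ ∃ i, e i = k from hk)]
        · simp [e.injective.extend_apply]
      · intro k _
        by_cases hk : ∃ i, e i = k
        · obtain ⟨i, rfl⟩ := hk
          simpa [e.injective.extend_apply] using hz ⟨i, rfl⟩
        · simpa [Function.extend_apply' _ _ _ hk] using hz ⟨i₀, rfl⟩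
      · rw [← hx]
        refine (Fintype.sum_of_injective e e.injective _ _ (fun k hk => ?_) fun i => ?_).symm
        · simp [Function.extend_apply' _ _ _ (show ¬ ∃ i, e i = k from hk)]
        · simp [e.injective.extend_apply]
    · rintro _ ⟨⟨w, z⟩, ⟨hw, hz⟩, rfl⟩
      exact (convex_convexHull ℝ s).sum_mem (fun i _ => hw.1 i) hw.2
        fun i _ => subset_convexHull ℝ s (hz i trivial)
  rw [h]
  exact ((isCompact_stdSimplex ℝ κ).prod (isCompact_univ_pi fun _ => hs)).image (by fun_prop)

variable (m : Fin 3 → Plane)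

lemma convex_hull : Convex ℝ (hull m) := convex_convexHull ℝ _

lemma rangeMap_mem_hull (z : Plane) : rangeMap m z ∈ hull m :=
  subset_convexHull ℝ _ (Set.mem_range_self z)

/-- A compactification of the cone over the image of the range map. -/
def conePoint (y : Plane) : TSpace × ℝ :=
  (WithLp.toLp 2 (fun b => ‖y - (1 - ‖y‖) • m b‖), 1 - ‖y‖)

lemma continuous_conePoint : Continuous (conePoint m) := by
  unfold conePoint; fun_prop

/-- This is the cone over the hull enlarged by the direction (1,1,1). It contains the points of
`conePoint` from the open disc, at positive height, and from the unit circle, at height 0. -/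
lemma convex_coneHull : Convex ℝ {z : TSpace × ℝ | 0 ≤ z.2 ∧ ∃ c : ℝ, 0 ≤ c ∧ ∃ q ∈ hull m,
    z.1 = z.2 • q + c • one} := by
  rintro ⟨v, s⟩ ⟨hs, c, hc, q, hq, h⟩ ⟨v', s'⟩ ⟨hs', c', hc', q', hq', h'⟩ a b ha hb hab
  simp only at hs hs' h h'
  have h1 := mul_nonneg ha hs
  have h2 := mul_nonneg hb hs'
  refine ⟨by simpa using add_nonneg h1 h2, a * c + b * c', by positivity, ?_⟩
  rcases (add_nonneg h1 h2).eq_or_lt with h0 | h0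
  · refine ⟨q, hq, ?_⟩
    have e1 : a * s = 0 := by linarith
    have e2 : b * s' = 0 := by linarith
    simp [h, h', smul_smul, e1, e2, add_smul]
  · refine ⟨_, convex_hull m hq hq' (div_nonneg h1 h0.le) (div_nonneg h2 h0.le)
      (by rw [← add_div, div_self h0.ne']), ?_⟩
    simp only [Prod.smul_mk, Prod.mk_add_mk, smul_eq_mul, h, h', smul_add, smul_smul,
      mul_div_cancel₀ _ h0.ne']
    module

lemma conePoint_mem {y : Plane} (hy : y ∈ Metric.closedBall (0 : Plane) 1) :
    conePoint m y ∈ {z : TSpace × ℝ | 0 ≤ z.2 ∧ ∃ c : ℝ, 0 ≤ c ∧ ∃ q ∈ hull m,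
      z.1 = z.2 • q + c • one} := by
  rw [mem_closedBall_zero_iff] at hy
  refine ⟨sub_nonneg.2 hy, ?_⟩
  rcases hy.lt_or_eq with h | h
  · have h1 : 0 < 1 - ‖y‖ := sub_pos.2 h
    refine ⟨0, le_rfl, _, rangeMap_mem_hull m ((1 - ‖y‖)⁻¹ • y), ?_⟩
    ext b
    simp only [conePoint, rangeMap, zero_smul, add_zero, PiLp.smul_apply, smul_eq_mul]
    rw [dist_eq_norm]
    rw [show y - (1 - ‖y‖) • m b = (1 - ‖y‖) • ((1 - ‖y‖)⁻¹ • y - m b) by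
      rw [smul_sub, smul_smul, mul_inv_cancel₀ h1.ne', one_smul], norm_smul,
      Real.norm_of_nonneg h1.le]
  · refine ⟨1, zero_le_one, _, rangeMap_mem_hull m 0, ?_⟩
    ext b
    simp [conePoint, h]

/-- The plane is identified with the open unit disc by x ↦ x / (1 + ‖x‖). On the unit circle
`conePoint` takes the value (one, 0), which represents infinity. -/
lemma rangeMap_eq_conePoint (x : Plane) : (rangeMap m x, (1 : ℝ)) =
    (1 + ‖x‖) • conePoint m ((1 + ‖x‖)⁻¹ • x) := by
  have h : 0 < 1 + ‖x‖ := by positivity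
  have e : 1 - ‖(1 + ‖x‖)⁻¹ • x‖ = (1 + ‖x‖)⁻¹ := by
    rw [norm_smul, norm_inv, Real.norm_of_nonneg h.le]; field_simp; ring
  rw [conePoint, e, Prod.smul_mk, smul_eq_mul, mul_inv_cancel₀ h.ne']
  congr 1
  ext b
  simp only [rangeMap, PiLp.smul_apply, smul_eq_mul]
  rw [← smul_sub, norm_smul, norm_inv, Real.norm_of_nonneg h.le, dist_eq_norm]
  field_simp

lemma norm_smul_mem_ball (x : Plane) : (1 + ‖x‖)⁻¹ • x ∈ Metric.closedBall (0 : Plane) 1 := by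
  have h : 0 < 1 + ‖x‖ := by positivity
  rw [mem_closedBall_zero_iff, norm_smul, norm_inv, Real.norm_of_nonneg h.le, inv_mul_le_one₀ h]
  linarith

/-- The convex hull of the image of `conePoint`. -/
def coneHull : Set (TSpace × ℝ) := convexHull ℝ (conePoint m '' Metric.closedBall 0 1)

lemma isCompact_coneHull : IsCompact (coneHull m) :=
  isCompact_convexHull ((isCompact_closedBall _ _).image (continuous_conePoint m))

lemma exists_smul_coneHull {q : TSpace} (hq : q ∈ hull m) :
    ∃ t : ℝ, 0 < t ∧ ∃ z ∈ coneHull m, t • z = (q, (1 : ℝ)) := by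
  have hKconv : Convex ℝ (coneHull m) := convex_convexHull ℝ _
  have hcv : Convex ℝ ((fun q : TSpace => (q, (1 : ℝ))) ⁻¹'
      (ConvexCone.hull ℝ (coneHull m) : Set (TSpace × ℝ))) := by
    intro x hx y hy a b ha hb hab
    have := (ConvexCone.hull ℝ (coneHull m)).convex hx hy ha hb hab
    simpa [hab] using this
  refine (ConvexCone.mem_hull_of_convex hKconv).1 (convexHull_min ?_ hcv hq)
  rintro _ ⟨x, rfl⟩
  exact (ConvexCone.mem_hull_of_convex hKconv).2 ⟨1 + ‖x‖, by positivity, _,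
    subset_convexHull ℝ _ ⟨_, norm_smul_mem_ball x, rfl⟩, (rangeMap_eq_conePoint m x).symm⟩

/-- On the circle at infinity the last coordinate vanishes but the first three are 1. Positivity on
a compact set later bounds the scalars needed to reach height 1. -/
lemma coneHull_pos {ψ : TSpace × ℝ →ₗ[ℝ] ℝ} (hψ : ∀ v s, ψ (v, s) = ∑ b, v b + s)
    {z : TSpace × ℝ} (hz : z ∈ coneHull m) : 0 < ψ z := by
  refine convexHull_min ?_ (convex_halfSpace_gt ψ.isLinear 0) hz
  rintro _ ⟨y, hy, rfl⟩
  rw [mem_closedBall_zero_iff] at hy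
  rw [Set.mem_ofPred_eq, conePoint, hψ]
  rcases hy.lt_or_eq with h | h
  · exact add_pos_of_nonneg_of_pos (Finset.sum_nonneg fun b _ => norm_nonneg _) (by linarith)
  · simp [h]

lemma isClosed_slice {E : Type*} [NormedAddCommGroup E] [NormedSpace ℝ E] {K : Set (E × ℝ)}
    (hK : IsCompact K) (B : ℝ) :
    IsClosed {q : E | ∃ t : ℝ, 0 ≤ t ∧ t ≤ B ∧ ∃ z ∈ K, t • z = (q, (1 : ℝ))} := by
  have hC : IsCompact ((fun q : ℝ × (E × ℝ) => q.1 • q.2) '' (Set.Icc 0 B ×ˢ K)) :=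
    (isCompact_Icc.prod hK).image (by fun_prop)
  convert hC.isClosed.preimage (show Continuous fun q : E => (q, (1 : ℝ)) by fun_prop) using 1
  ext q
  constructor
  · rintro ⟨t, h0, h1, z, hz, h⟩
    exact ⟨(t, z), ⟨⟨h0, h1⟩, hz⟩, h⟩
  · rintro ⟨⟨t, z⟩, ⟨⟨h0, h1⟩, hz⟩, h⟩
    exact ⟨t, h0, h1, z, hz, h⟩

lemma exists_of_mem_coneHull {z : TSpace × ℝ} (hz : z ∈ coneHull m) :
    ∃ c : ℝ, 0 ≤ c ∧ ∃ q ∈ hull m, z.1 = z.2 • q + c • one := by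
  have hsub : conePoint m '' Metric.closedBall 0 1 ⊆ {z : TSpace × ℝ | 0 ≤ z.2 ∧
      ∃ c : ℝ, 0 ≤ c ∧ ∃ q ∈ hull m, z.1 = z.2 • q + c • one} := by
    rintro _ ⟨y, hy, rfl⟩
    exact conePoint_mem m hy
  have h := convexHull_min hsub (convex_coneHull m) hz
  rw [Set.mem_ofPred_eq] at h
  exact h.2

lemma isMinOn_bound {K : Set (TSpace × ℝ)} (hK : IsCompact K) (hne : K.Nonempty)
    {ψ : TSpace × ℝ →ₗ[ℝ] ℝ} (hψ : ∀ z ∈ K, 0 < ψ z) : ∃ ε > 0, ∀ z ∈ K, ε ≤ ψ z := by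
  obtain ⟨z₀, hz₀, hmin⟩ := hK.exists_isMinOn hne ψ.continuous_of_finiteDimensional.continuousOn
  exact ⟨ψ z₀, hψ z₀ hz₀, fun z hz => hmin hz⟩

/-- The closure of the convex hull is the sum of the hull and of a half-line. -/
lemma exists_of_mem_closure {p : TSpace} (hp : p ∈ closure (hull m)) :
    ∃ q ∈ hull m, ∃ c : ℝ, 0 ≤ c ∧ p = q + c • one := by
  obtain ⟨ψ, hψ⟩ : ∃ ψ : TSpace × ℝ →ₗ[ℝ] ℝ, ∀ v s, ψ (v, s) = ∑ b, v b + s :=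
    ⟨(lin (fun _ => 1)).coprod LinearMap.id, fun v s => by simp [lin_apply]⟩
  have hψc : Continuous ψ := ψ.continuous_of_finiteDimensional
  have hKne : (coneHull m).Nonempty := ⟨_, subset_convexHull ℝ _ ⟨0, by simp, rfl⟩⟩
  obtain ⟨ε, hε, hmin⟩ := isMinOn_bound (isCompact_coneHull m) hKne fun z => coneHull_pos m hψ
  -- Near p the form ψ is bounded above, and it is at least ε on the compact set `coneHull m`, so
  -- the scalars t stay bounded and `isClosed_slice` permits passing to the limit.
  have hmem : p ∈ {q : TSpace | ∃ t : ℝ, 0 ≤ t ∧ t ≤ (ψ (p, 1) + 1) / ε ∧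
      ∃ z ∈ coneHull m, t • z = (q, (1 : ℝ))} := by
    have hev : ∀ᶠ q in nhds p, ψ (q, 1) < ψ (p, 1) + 1 := by
      have hc : Continuous fun q : TSpace => ψ (q, 1) := hψc.comp (by fun_prop)
      exact (hc.tendsto p).eventually_lt_const (by linarith)
    refine (isClosed_slice (isCompact_coneHull m) _).mem_of_frequently_of_tendsto ?_
      (Filter.tendsto_id (x := nhds p))
    refine ((mem_closure_iff_frequently.1 hp).and_eventually hev).mono ?_
    rintro q ⟨hq, hlt⟩
    obtain ⟨t, ht, z, hz, h⟩ := exists_smul_coneHull m hq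
    refine ⟨t, ht.le, ?_, z, hz, h⟩
    have h1 : ψ (q, 1) = t * ψ z := by rw [← h, map_smul, smul_eq_mul]
    have h2 : ε ≤ ψ z := hmin z hz
    rw [le_div_iff₀ hε]
    nlinarith
  obtain ⟨t, ht, -, z, hz, h⟩ := hmem
  obtain ⟨c, hc, q, hq, hz1⟩ := exists_of_mem_coneHull m hz
  refine ⟨q, hq, t * c, mul_nonneg ht hc, ?_⟩
  have e1 : t • z.1 = p := congrArg Prod.fst h
  have e2 : t * z.2 = 1 := congrArg Prod.snd h
  rw [← e1, hz1, smul_add, smul_smul, smul_smul, e2, one_smul]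

/-- For a unit vector v, s T(v/s) tends to (1,1,1) as s → 0⁺, so mixing q with T(v/s) with weight c
s tends to q + c · one. -/
lemma add_smul_one_mem_closure {q : TSpace} (hq : q ∈ hull m) {c : ℝ} (hc : 0 ≤ c) :
    q + c • one ∈ closure (hull m) := by
  let v : Plane := EuclideanSpace.single 0 1
  let F : ℝ → TSpace := fun s => (1 - c * s) • q + c • WithLp.toLp 2 (fun b => ‖v - s • m b‖)
  have hF : Continuous F := by fun_prop
  have h0 : F 0 = q + c • one := by
    simp [F, one, v]
  rw [← h0]
  refine mem_closure_of_tendsto ((hF.tendsto 0).mono_left nhdsWithin_le_nhds :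
    Filter.Tendsto F (nhdsWithin 0 (Set.Ioi 0)) _) ?_
  have hlt : ∀ᶠ s : ℝ in nhdsWithin 0 (Set.Ioi 0), c * s < 1 :=
    ((Continuous.tendsto (f := fun s : ℝ => c * s) (by fun_prop) 0).mono_left
      nhdsWithin_le_nhds).eventually_lt_const (by simp)
  filter_upwards [self_mem_nhdsWithin, hlt] with s (hs : 0 < s) hs1
  have : F s = (1 - c * s) • q + (c * s) • rangeMap m (s⁻¹ • v) := by
    ext b
    simp only [F, rangeMap, PiLp.add_apply, PiLp.smul_apply, smul_eq_mul, dist_eq_norm]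
    rw [show v - s • m b = s • (s⁻¹ • v - m b) by
      rw [smul_sub, smul_smul, mul_inv_cancel₀ hs.ne', one_smul], norm_smul,
      Real.norm_of_nonneg hs.le]
    ring
  rw [this]
  exact convex_hull m hq (rangeMap_mem_hull m _) (by linarith) (by positivity) (by ring)

variable {m}

lemma closure_le_lin {w : Fin 3 → ℝ} {M : ℝ} (h : ∀ z, M ≤ wdist m w z) {p : TSpace}
    (hp : p ∈ closure (hull m)) : M ≤ lin w p := by
  refine closure_minimal (s := hull m) (t := {p | M ≤ lin w p}) ?_
    (isClosed_le continuous_const (continuous_lin w)) hp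
  exact convexHull_min (by rintro _ ⟨z, rfl⟩; exact h z) (convex_halfSpace_ge (lin w).isLinear M)

/-- The lower bound extends to the closure, which contains a half-line in the direction (1,1,1),
where the functional grows at rate ∑ w_b. -/
lemma sum_nonneg_of_bounded {w : Fin 3 → ℝ} {M : ℝ} (h : ∀ z, M ≤ wdist m w z) :
    0 ≤ ∑ b, w b := by
  by_contra! hneg
  have h1 : ∀ c : ℝ, 0 ≤ c → M ≤ wdist m w 0 + c * ∑ b, w b := fun c hc => by
    have := closure_le_lin h (add_smul_one_mem_closure m (rangeMap_mem_hull m 0) hc)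
    rwa [map_add, map_smul, lin_one, lin_rangeMap, smul_eq_mul] at this
  have h2 := h1 ((wdist m w 0 - M + 1) / -∑ b, w b) (div_nonneg (by linarith [h 0]) (by linarith))
  rw [div_neg, neg_mul, div_mul_cancel₀ _ hneg.ne] at h2
  linarith

section
variable (hm : ¬ Collinear ℝ (Set.range m))
include hm

/-- Adding the one-sided conditions for v and -v cancels the smooth terms and leaves 2 w_i ‖v‖ ≥ 0.
-/
lemma weight_nonneg_of_receiver {w : Fin 3 → ℝ} {i : Fin 3}
    (h : ∀ z, wdist m w (m i) ≤ wdist m w z) : 0 ≤ w i := by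
  obtain ⟨j, k, hij, hik, hjk⟩ := exists_others i
  let v : Plane := EuclideanSpace.single 0 1
  have h1 := first_order_receiver hm hij hik hjk h v
  have h2 := first_order_receiver hm hij hik hjk h (-v)
  have e : ∀ a : Plane, dot a (-v) = -dot a v := fun a => by simp [dot]; ring
  have hv : ‖v‖ = 1 := by simp [v]
  rw [hv] at h1
  rw [norm_neg, e, e, hv, neg_div, neg_div] at h2
  linarith

/-- A nonzero functional constant on the image would be minimal at each receiver, and so would its
negative; then every weight is both nonnegative and nonpositive. -/
lemma interior_hull_nonempty : (interior (hull m)).Nonempty := by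
  rw [hull, interior_convexHull_nonempty_iff_affineSpan_eq_top]
  by_contra hne
  have hd : vectorSpan ℝ (Set.range (rangeMap m)) < ⊤ := by
    rw [lt_top_iff_ne_top]
    intro h
    exact hne ((AffineSubspace.affineSpan_eq_top_iff_vectorSpan_eq_top_of_nonempty ℝ _ _
      (Set.range_nonempty _)).2 h)
  obtain ⟨f, hf, hle⟩ := Submodule.exists_le_ker_of_lt_top _ hd
  obtain ⟨w, rfl⟩ := exists_eq_lin f
  have hc : ∀ y z, wdist m w y = wdist m w z := fun y z => by
    have := hle (vsub_mem_vectorSpan ℝ (Set.mem_range_self y) (Set.mem_range_self z))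
    rw [LinearMap.mem_ker, vsub_eq_sub, map_sub, lin_rangeMap, lin_rangeMap] at this
    linarith
  apply hf
  ext p
  rw [lin_apply]
  refine Finset.sum_eq_zero fun b _ => ?_
  have h1 : 0 ≤ w b := weight_nonneg_of_receiver hm fun z => (hc _ z).le
  have h2 : 0 ≤ (-w) b := weight_nonneg_of_receiver hm fun z => by
    have := hc (m b) z
    simp only [wdist, Pi.neg_apply, neg_mul, Finset.sum_neg_distrib] at this ⊢
    linarith
  rw [Pi.neg_apply] at h2
  rw [show w b = 0 by linarith, zero_mul]

lemma exists_support {p : TSpace} (hp : p ∈ frontier (hull m)) :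
    ∃ w : Fin 3 → ℝ, w ≠ 0 ∧ ∀ z, lin w p ≤ wdist m w z := by
  obtain ⟨f, hf⟩ := geometric_hahn_banach_open_point (convex_hull m).interior isOpen_interior hp.2
  obtain ⟨w, hw⟩ := exists_eq_lin (-(f : TSpace →ₗ[ℝ] ℝ))
  have hw' : ∀ q, lin w q = -f q := fun q => by rw [← hw]; rfl
  refine ⟨w, ?_, fun z => ?_⟩
  · rintro rfl
    obtain ⟨a, ha⟩ := interior_hull_nonempty hm
    have h1 := hf a ha
    have h2 := hw' a
    have h3 := hw' p
    simp [lin_apply] at h2 h3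
    linarith
  · rw [← lin_rangeMap, hw', hw', neg_le_neg_iff]
    have hz : rangeMap m z ∈ closure (interior (hull m)) := by
      rw [(convex_hull m).closure_interior_eq_closure_of_nonempty_interior
        (interior_hull_nonempty hm)]
      exact subset_closure (rangeMap_mem_hull m z)
    exact closure_minimal (s := interior (hull m)) (t := {q | f q ≤ f p})
      (fun a ha => (hf a ha).le) (isClosed_le f.continuous continuous_const) hz

omit hm in
lemma mem_frontier_of_support {p : TSpace} (hp : p ∈ closure (hull m)) {w : Fin 3 → ℝ} (hw : w ≠ 0)
    (h : ∀ z, lin w p ≤ wdist m w z) : p ∈ frontier (hull m) := by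
  refine ⟨hp, fun hi => hw ?_⟩
  have hmin : IsLocalMin (lin w) p := by
    filter_upwards [isOpen_interior.mem_nhds hi] with q hq
    exact closure_le_lin h (subset_closure (interior_subset hq))
  have h0 := hmin.hasFDerivAt_eq_zero
    (f' := LinearMap.toContinuousLinearMap (lin w)) (LinearMap.toContinuousLinearMap (lin w)).hasFDerivAt
  ext b
  have := congrArg (fun f => f (EuclideanSpace.single b 1)) h0
  simpa [lin_apply] using this

/-- Write p = q + c · one with q in the hull. Both w(q) ≥ w(p) and c ∑ w_b ≥ 0 hold, and w(p) = w(q)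
+ c ∑ w_b, so both are equalities and q lies in the face cut out by w. -/
lemma exists_face {p : TSpace} (hp : p ∈ frontier (hull m)) :
    ∃ w : Fin 3 → ℝ, w ≠ 0 ∧ 0 ≤ ∑ b, w b ∧ ∃ (M : ℝ) (q : TSpace) (c : ℝ), 0 ≤ c ∧
      c * ∑ b, w b = 0 ∧ p = q + c • one ∧ (∀ z, M ≤ wdist m w z) ∧
      q ∈ convexHull ℝ (rangeMap m '' {z | wdist m w z = M}) := by
  obtain ⟨w, hw, h⟩ := exists_support hm hp
  obtain ⟨q, hq, c, hc, rfl⟩ := exists_of_mem_closure m hp.1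
  have hs := sum_nonneg_of_bounded h
  have hle := closure_le_lin h (subset_closure hq)
  have e : lin w (q + c • one) = lin w q + c * ∑ b, w b := by
    rw [map_add, map_smul, lin_one, smul_eq_mul]
  have h0 := mul_nonneg hc hs
  refine ⟨w, hw, hs, lin w (q + c • one), q, c, hc, by linarith, rfl, h, ?_⟩
  refine convexHull_mono ?_ ((mem_convexHull_face (lin w) (S := Set.range (rangeMap m))
    (by rintro _ ⟨z, rfl⟩; exact h z) hq).2 (by linarith))
  rintro _ ⟨⟨z, rfl⟩, hz⟩
  exact ⟨z, hz, rfl⟩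

end

end

/-! ### The polyhedron, and regions enclosed by a relative boundary -/

section

/-- The weights `α`, `β`, `γ` at `i`, at `j` and at the third index. -/
def wt (i j : Fin 3) (α β γ : ℝ) : Fin 3 → ℝ := fun b => if b = i then α else if b = j then β else γ

section
variable {i j k : Fin 3} (hij : i ≠ j) (hik : i ≠ k) (hjk : j ≠ k)
include hij hik hjk

lemma sum_wt (α β γ : ℝ) (f : Fin 3 → ℝ) :
    ∑ b, wt i j α β γ b * f b = α * f i + β * f j + γ * f k := by
  rw [sum_three hij hik hjk]; simp [wt, hij.symm, hik.symm, hjk.symm]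

lemma lin_wt (α β γ : ℝ) (p : TSpace) : lin (wt i j α β γ) p = α * p i + β * p j + γ * p k :=
  sum_wt hij hik hjk α β γ p

lemma wdist_wt (m : Fin 3 → Plane) (α β γ : ℝ) (z : Plane) : wdist m (wt i j α β γ) z =
    α * dist z (m i) + β * dist z (m j) + γ * dist z (m k) :=
  sum_wt hij hik hjk α β γ fun b => dist z (m b)

omit hij hik hjk in
lemma wt_ne_zero {i j : Fin 3} {α β γ : ℝ} (h : α ≠ 0) : wt i j α β γ ≠ 0 := fun e => h (by
  have := congrFun e i
  simpa [wt] using this)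

variable {m : Fin 3 → Plane}

lemma sub_le_of_mem_closure {p : TSpace} (hp : p ∈ closure (hull m)) :
    p j - p i ≤ dist (m i) (m j) := by
  have := closure_le_lin (w := wt i j 1 (-1) 0) (M := -dist (m i) (m j)) (fun z => by
    rw [wdist_wt hij hik hjk]
    have := dist_triangle z (m i) (m j)
    linarith) hp
  rw [lin_wt hij hik hjk] at this
  linarith

lemma le_add_of_mem_closure {p : TSpace} (hp : p ∈ closure (hull m)) :
    dist (m i) (m j) ≤ p i + p j := by
  have := closure_le_lin (w := wt i j 1 1 0) (M := dist (m i) (m j)) (fun z => by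
    rw [wdist_wt hij hik hjk]
    have := dist_triangle_left (m i) (m j) z
    linarith) hp
  rw [lin_wt hij hik hjk] at this
  linarith

omit hij hik hjk in
lemma ptolemy (m : Fin 3 → Plane) (i j k : Fin 3) (z : Plane) :
    dist (m j) (m k) * dist z (m i) ≤
      dist (m i) (m k) * dist z (m j) + dist (m i) (m j) * dist z (m k) := by
  have := EuclideanGeometry.mul_dist_le_mul_dist_add_mul_dist z (m j) (m i) (m k)
  rw [dist_comm (m j) (m i)] at this
  linarith

lemma ptolemy_of_mem_closure {p : TSpace} (hp : p ∈ closure (hull m)) :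
    dist (m j) (m k) * p i ≤ dist (m i) (m k) * p j + dist (m i) (m j) * p k := by
  have := closure_le_lin (w := wt i j (-dist (m j) (m k)) (dist (m i) (m k)) (dist (m i) (m j)))
    (M := 0) (fun z => by
      rw [wdist_wt hij hik hjk]
      have := ptolemy m i j k z
      linarith) hp
  rw [lin_wt hij hik hjk] at this
  linarith

end

/-- The twelve inequalities are nine triangle inequalities and the three Ptolemy inequalities, all
linear in the distances. -/
lemma closure_hull_subset_polyhedron (m : Fin 3 → Plane) : closure (hull m) ⊆ polyhedron m := by
  intro p hp
  refine ⟨fun i j hij => ?_, ?_, ?_, ?_⟩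
  · obtain ⟨k, hik, hjk⟩ := exists_third hij.ne
    have h1 := sub_le_of_mem_closure hij.ne hik hjk hp
    have h2 := sub_le_of_mem_closure hij.ne' hjk hik hp
    have h3 := le_add_of_mem_closure hij.ne' hjk hik hp
    rw [dist_comm (m i)] at h1
    exact ⟨by linarith, by linarith, by linarith⟩
  · have := ptolemy_of_mem_closure (i := 2) (j := 1) (k := 0) (by decide) (by decide) (by decide) hp
    linarith
  · have := ptolemy_of_mem_closure (i := 1) (j := 2) (k := 0) (by decide) (by decide) (by decide) hp
    rw [dist_comm (m 1) (m 2)] at this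
    linarith
  · have := ptolemy_of_mem_closure (i := 0) (j := 1) (k := 2) (by decide) (by decide) (by decide) hp
    rw [dist_comm (m 1) (m 2), dist_comm (m 0), dist_comm (m 0)] at this
    linarith

lemma eq_zero_of_bounded {a b d : ℝ} (h : ∀ t : ℝ, 0 ≤ t → a + t * b ≤ d) : b ≤ 0 := by
  by_contra! hb
  have := h (|d - a| / b + 1) (by positivity)
  rw [add_mul, div_mul_cancel₀ _ hb.ne'] at this
  linarith [le_abs_self (d - a)]

/-- The polyhedron contains no half-line in a direction different from `one`. -/
lemma eq_smul_one_of_ray {m : Fin 3 → Plane} {p v : TSpace}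
    (h : ∀ t : ℝ, 0 ≤ t → p + t • v ∈ polyhedron m) : v = v 0 • one := by
  have key : ∀ i j : Fin 3, i < j → v i = v j := by
    intro i j hij
    have h1 := eq_zero_of_bounded (a := p i - p j) (b := v i - v j) (d := dist (m j) (m i))
      fun t ht => by
        have := ((h t ht).1 i j hij).2.1
        simp only [PiLp.add_apply, PiLp.smul_apply, smul_eq_mul] at this
        linarith
    have h2 := eq_zero_of_bounded (a := p j - p i) (b := v j - v i) (d := dist (m j) (m i))
      fun t ht => by
        have := ((h t ht).1 i j hij).1
        simp only [PiLp.add_apply, PiLp.smul_apply, smul_eq_mul] at this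
        linarith
    linarith
  ext b
  simp only [PiLp.smul_apply, one_apply, smul_eq_mul, mul_one]
  fin_cases b
  · rfl
  · exact (key 0 1 (by decide)).symm
  · exact (key 0 2 (by decide)).symm

/-- A convex set is the region enclosed by its relative boundary. -/
lemma enclosedRegion_eq {m : Fin 3 → Plane} {X Y C J U : Set TSpace}
    (hX : ∀ p ∈ X, ∀ c ∈ X, ∀ t : ℝ, 0 ≤ t → p + t • (p - c) ∈ X) (hC : Convex ℝ C)
    (hcl : IsClosed C) (hCX : C ⊆ X) (hCY : C ⊆ Y) (hY : Y ⊆ polyhedron m) (hJ : J ⊆ C)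
    (hU : IsOpen U) (hUX : ∀ p ∈ X, p ∈ U ↔ p ∈ C ∧ p ∉ J) {c₀ c₁ : TSpace} (h₀ : c₀ ∈ C)
    (h₁ : c₁ ∈ C) (hne : ∀ r : ℝ, c₀ - c₁ ≠ r • one) : enclosedRegion X Y J = C := by
  apply Set.Subset.antisymm
  · rintro p (hp | ⟨⟨hpX, hpJ⟩, hp⟩)
    · exact hJ hp
    · by_contra hpC
      -- By convexity the ray from p pointing away from c never meets C, so it stays in the
      -- component of p and hence in the polyhedron, whose only ray direction is `one`. Applied to
      -- c₀ and c₁ this makes c₀ - c₁ a multiple of `one`.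
      have key : ∀ c ∈ C, ∃ r : ℝ, p - c = r • one := by
        intro c hc
        refine ⟨(p - c) 0, eq_smul_one_of_ray (m := m) (p := p) fun t ht => hY (hp ?_)⟩
        have hnot : ∀ s : ℝ, 0 ≤ s → p + s • (p - c) ∉ C := fun s hs hmem => hpC (by
          have := hC hc hmem (a := s / (1 + s)) (b := 1 / (1 + s)) (by positivity) (by positivity)
            (by field_simp; ring)
          convert this using 1
          have : (1 + s) ≠ 0 := by positivity
          ext b
          simp only [PiLp.add_apply, PiLp.smul_apply, PiLp.sub_apply, smul_eq_mul]
          field_simp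
          ring)
        have hpre : IsPreconnected ((fun s : ℝ => p + s • (p - c)) '' Set.Ici 0) :=
          isPreconnected_Ici.image _ (by fun_prop)
        refine hpre.subset_connectedComponentIn ⟨0, Set.mem_Ici.2 le_rfl, by simp⟩ ?_
          ⟨t, ht, rfl⟩
        rintro _ ⟨s, hs, rfl⟩
        exact ⟨hX p hpX c (hCX hc) s hs, fun hJ' => hnot s hs (hJ hJ')⟩
      obtain ⟨r, hr⟩ := key c₀ h₀
      obtain ⟨s, hs⟩ := key c₁ h₁
      exact hne (s - r) (by rw [sub_smul, ← hr, ← hs]; abel)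
  · intro p hp
    by_cases hpJ : p ∈ J
    · exact Or.inl hpJ
    right
    refine ⟨⟨hCX hp, hpJ⟩, ?_⟩
    -- Away from J the component is covered by the open sets U and Cᶜ, which do not meet inside it;
    -- being connected and meeting U, it lies in U.
    have hsub : connectedComponentIn (X \ J) p ⊆ U := by
      intro q hq
      by_contra hqU
      have hcov : connectedComponentIn (X \ J) p ⊆ U ∪ Cᶜ := by
        intro r hr
        have hr' := connectedComponentIn_subset _ _ hr
        by_cases hrC : r ∈ C
        · exact Or.inl ((hUX r hr'.1).2 ⟨hrC, hr'.2⟩)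
        · exact Or.inr hrC
      obtain ⟨r, hr, hrU, hrC⟩ := isPreconnected_connectedComponentIn U Cᶜ hU hcl.isOpen_compl hcov
        ⟨p, mem_connectedComponentIn ⟨hCX hp, hpJ⟩, (hUX p (hCX hp)).2 ⟨hp, hpJ⟩⟩
        ⟨q, hq, (hcov hq).resolve_left hqU⟩
      exact hrC ((hUX r (connectedComponentIn_subset _ _ hr).1).1 hrU).1
    intro q hq
    exact hCY ((hUX q (connectedComponentIn_subset _ _ hq).1).1 (hsub hq)).1

lemma mem_segment_of_eq_off {p q r : TSpace} {i : Fin 3} (h1 : ∀ b, b ≠ i → p b = r b)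
    (h2 : ∀ b, b ≠ i → q b = r b) (hp : p i ≤ r i) (hq : r i ≤ q i) : r ∈ segment ℝ p q := by
  rcases hp.eq_or_lt with h | h
  · have : p = r := by
      ext b
      by_cases hb : b = i
      · rw [hb, h]
      · exact h1 b hb
    rw [← this]; exact left_mem_segment ℝ _ _
  · have hpos : 0 < q i - p i := by linarith
    refine ⟨(q i - r i) / (q i - p i), (r i - p i) / (q i - p i), div_nonneg (by linarith) hpos.le,
      div_nonneg (by linarith) hpos.le, by field_simp; ring, ?_⟩
    ext b
    simp only [PiLp.add_apply, PiLp.smul_apply, smul_eq_mul]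
    by_cases hb : b = i
    · rw [hb]; field_simp; ring
    · rw [h1 b hb, h2 b hb]; field_simp; ring

end

/-! ### Facet regions cut off by the arcs -/

section

lemma isClosed_and {X : Type*} [TopologicalSpace X] {P Q : X → Prop} (hP : IsClosed {x | P x})
    (hQ : IsClosed {x | Q x}) : IsClosed {x | P x ∧ Q x} := hP.inter hQ

lemma isOpen_and {X : Type*} [TopologicalSpace X] {P Q : X → Prop} (hP : IsOpen {x | P x})
    (hQ : IsOpen {x | Q x}) : IsOpen {x | P x ∧ Q x} := hP.inter hQ

/-- The convex subset of the facet bounded by the image of an arc of the circle. -/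
def regionF (m : Fin 3 → Plane) (i j k : Fin 3) : Set TSpace :=
  {p | dist (m j) (m k) * p i = dist (m i) (m k) * p j + dist (m i) (m j) * p k ∧
    dist (m j) (m k) ≤ p j + p k ∧
    dist (m i) (m j) * dist (m i) (m k) * (p j ^ 2 + p k ^ 2 - dist (m j) (m k) ^ 2) +
      2 * sideInner m i j k * (p j * p k) ≤ 0}

section
variable {m : Fin 3 → Plane} (hm : ¬ Collinear ℝ (Set.range m)) {i j k : Fin 3} (hij : i ≠ j)
  (hik : i ≠ k) (hjk : j ≠ k)
include hm hij hik hjk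

/-- Strict Cauchy-Schwarz, as the receivers are not collinear. -/
lemma abs_sideInner_lt : |sideInner m i j k| < dist (m i) (m j) * dist (m i) (m k) := by
  have h := sideInner_sq m i j k
  have hc := cr_sides_ne_zero hm hij hik hjk
  apply abs_lt_of_sq_lt_sq _ (by positivity)
  nlinarith [pow_pos (abs_pos.2 hc) 2, sq_abs (cr (m j - m i) (m k - m i))]

/-- Comparing the quadratic inequality with (p_j + p_k)² ≥ d² gives (Q - β) p_j p_k ≥ 0 with Q > β;
thus the two coordinates have the same sign, and their sum is positive. -/
lemma regionF_nonneg {p : TSpace} (hp : p ∈ regionF m i j k) : 0 ≤ p j ∧ 0 ≤ p k := by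
  obtain ⟨-, h1, h2⟩ := hp
  have hb := abs_lt.1 (abs_sideInner_lt hm hij hik hjk)
  have hd := receivers_dist_pos hm hjk
  have hQ : 0 < dist (m i) (m j) * dist (m i) (m k) :=
    mul_pos (receivers_dist_pos hm hij) (receivers_dist_pos hm hik)
  generalize dist (m i) (m j) * dist (m i) (m k) = Q at *
  generalize sideInner m i j k = β at *
  generalize dist (m j) (m k) = d at *
  have h3 : 0 ≤ (Q - β) * (p j * p k) := by
    have : 0 ≤ Q * ((p j + p k) ^ 2 - d ^ 2) := mul_nonneg hQ.le (by nlinarith)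
    nlinarith
  have h4 : 0 ≤ p j * p k := nonneg_of_mul_nonneg_right h3 (by linarith)
  constructor
  · by_contra! h; nlinarith
  · by_contra! h; nlinarith

lemma convex_regionF : Convex ℝ (regionF m i j k) := by
  have hb := abs_lt.1 (abs_sideInner_lt hm hij hik hjk)
  have hQ : 0 < dist (m i) (m j) * dist (m i) (m k) :=
    mul_pos (receivers_dist_pos hm hij) (receivers_dist_pos hm hik)
  rintro x ⟨x1, x2, x3⟩ y ⟨y1, y2, y3⟩ a b ha hb' hab
  simp only [regionF, Set.mem_ofPred_eq, PiLp.add_apply, PiLp.smul_apply, smul_eq_mul]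
  generalize dist (m i) (m j) * dist (m i) (m k) = Q at *
  generalize sideInner m i j k = β at *
  generalize dist (m j) (m k) = d at *
  refine ⟨by linear_combination a * x1 + b * y1, ?_, ?_⟩
  · have e1 := mul_le_mul_of_nonneg_left x2 ha
    have e2 := mul_le_mul_of_nonneg_left y2 hb'
    have e3 : a * d + b * d = d := by rw [← add_mul, hab, one_mul]
    linarith
  · have e1 := mul_nonpos_of_nonneg_of_nonpos ha x3
    have e2 := mul_nonpos_of_nonneg_of_nonpos hb' y3
    -- The quadratic form is positive semidefinite because |β| < Q; the two squares below
    -- diagonalize it.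
    have e4 : 0 ≤ Q * ((x j - y j) ^ 2 + (x k - y k) ^ 2) + 2 * β * ((x j - y j) * (x k - y k)) := by
      nlinarith [mul_nonneg (show 0 ≤ Q + β by linarith) (sq_nonneg (x j - y j + (x k - y k))),
        mul_nonneg (show 0 ≤ Q - β by linarith) (sq_nonneg (x j - y j - (x k - y k)))]
    have e5 := mul_nonneg (mul_nonneg ha hb') e4
    obtain rfl : b = 1 - a := by linarith
    nlinarith

omit hm hij hik hjk in
lemma isClosed_regionF : IsClosed (regionF m i j k) := by
  refine isClosed_and (isClosed_eq ?_ ?_) (isClosed_and (isClosed_le ?_ ?_) (isClosed_le ?_ ?_)) <;>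
    fun_prop

omit hm hij hik hjk in
lemma rangeMap_mem_regionF {z : Plane} (h : dist (m j) (m k) * dist z (m i) =
    dist (m i) (m k) * dist z (m j) + dist (m i) (m j) * dist z (m k)) :
    rangeMap m z ∈ regionF m i j k :=
  ⟨h, dist_triangle_left _ _ _, (ptolemy_eq m h).le⟩

/-- Ptolemy's equality on the arc. -/
lemma ptolemy_of_arc {z : Plane} (hz : bary m i z ≤ 0) (hp : pw m z = 0) :
    dist (m j) (m k) * dist z (m i) =
      dist (m i) (m k) * dist z (m j) + dist (m i) (m j) * dist z (m k) := by
  have hreg := mem_reg_of_pw hm hz hp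
  have h1 := weights_of_arc hij hik hjk hreg hp
  have h2 := weights_of_arc hik hij hjk.symm hreg hp
  rw [dist_comm (m k) (m j)] at h2
  have h3 := hp
  rw [pw, sum_three hij hik hjk] at h3
  rcases hz.lt_or_eq with h | h
  · rcases eq_or_ne z (m i) with rfl | hne
    · rw [bary_self hm] at h; linarith
    have hT : 0 < dist z (m i) := dist_pos.2 hne
    -- By `h1` and `h2` the three weights are proportional to the sides of the triangle, so
    -- multiplying by this nonzero factor turns pw z = 0 into the claim.
    have : bary m i z * dist z (m i) ≠ 0 := mul_ne_zero h.ne hT.ne'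
    apply mul_left_cancel₀ this
    linear_combination dist (m j) (m k) * h3 - dist z (m j) * h1 - dist z (m k) * h2
  · rw [h] at h1 h2
    have hd := (receivers_dist_pos hm hjk).ne'
    simp only [neg_zero, zero_mul, mul_eq_zero, hd, or_false] at h1 h2
    have hs := bary_sum hm z
    rw [sum_three hij hik hjk, h, zero_add] at hs
    rcases h1 with h1 | h1
    · rw [h1, zero_add] at hs
      rw [hs] at h2
      have : z = m k := dist_eq_zero.1 (h2.resolve_left one_ne_zero)
      subst this
      rw [dist_self, dist_comm (m k) (m i), dist_comm (m k) (m j)]; ring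
    · have : z = m j := dist_eq_zero.1 h1
      subst this
      rw [dist_self, dist_comm (m j) (m i)]; ring

omit hm hij hik hjk in
lemma receiver_mem_regionF : rangeMap m (m j) ∈ regionF m i j k :=
  rangeMap_mem_regionF (by rw [dist_self, dist_comm (m j) (m i)]; ring)

omit hm hij hik hjk in
lemma receiver_mem_regionF' : rangeMap m (m k) ∈ regionF m i j k :=
  rangeMap_mem_regionF
    (by rw [dist_self, dist_comm (m k) (m i), dist_comm (m k) (m j)]; ring)

/-- The bounded edge consists of the points of the facet with minimal sum of coordinates. -/
lemma mem_edge_of_sum_eq {p : TSpace} (h : dist (m j) (m k) * p i =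
    dist (m i) (m k) * p j + dist (m i) (m j) * p k) (hs : p j + p k = dist (m j) (m k))
    (hj : 0 ≤ p j) (hk : 0 ≤ p k) : p ∈ segment ℝ (rangeMap m (m j)) (rangeMap m (m k)) := by
  have hd := receivers_dist_pos hm hjk
  refine ⟨p k / dist (m j) (m k), p j / dist (m j) (m k), div_nonneg hk hd.le,
    div_nonneg hj hd.le, by rw [← add_div, add_comm, hs, div_self hd.ne'], ?_⟩
  ext b
  simp only [rangeMap, PiLp.add_apply, PiLp.smul_apply, smul_eq_mul]
  rcases forall_three hij hik hjk b with rfl | rfl | rfl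
  · rw [dist_comm (m j) (m b), dist_comm (m k) (m b)]; field_simp; linarith
  · rw [dist_self, dist_comm (m k)]; field_simp; ring
  · rw [dist_self]; field_simp; ring

lemma regionF_arc {p : TSpace} (hp : p ∈ regionF m i j k)
    (h : dist (m i) (m j) * dist (m i) (m k) * (p j ^ 2 + p k ^ 2 - dist (m j) (m k) ^ 2) +
      2 * sideInner m i j k * (p j * p k) = 0) :
    ∃ z, bary m i z ≤ 0 ∧ pw m z = 0 ∧ rangeMap m z = p := by
  obtain ⟨h0, h1⟩ := regionF_nonneg hm hij hik hjk hp
  obtain ⟨z, z1, z2, z3, z4, z5⟩ := exists_arc_point hm hij hik hjk h0 h1 hp.1 h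
  refine ⟨z, z4, z5, ?_⟩
  ext b
  rcases forall_three hij hik hjk b with rfl | rfl | rfl
  · exact z3
  · exact z1
  · exact z2

/-- On the line through p in the facet plane along which p_j and p_k grow at equal rates, moving up
reaches the image of the arc and moving down reaches the bounded edge. So p lies between two points
of the hull. -/
lemma regionF_subset_hull : regionF m i j k ⊆ hull m := by
  intro p hp
  have hb := abs_lt.1 (abs_sideInner_lt hm hij hik hjk)
  have hQ : 0 < dist (m i) (m j) * dist (m i) (m k) :=
    mul_pos (receivers_dist_pos hm hij) (receivers_dist_pos hm hik)
  have hd := receivers_dist_pos hm hjk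
  have hedge : ∀ q ∈ regionF m i j k, q j + q k = dist (m j) (m k) → q ∈ hull m := fun q hq h => by
    obtain ⟨h0, h1⟩ := regionF_nonneg hm hij hik hjk hq
    exact (convex_hull m).segment_subset (rangeMap_mem_hull m _) (rangeMap_mem_hull m _)
      (mem_edge_of_sum_eq hm hij hik hjk hq.1 h h0 h1)
  obtain ⟨v, vi, vj, vk⟩ : ∃ v : TSpace, dist (m j) (m k) * v i =
      dist (m i) (m k) + dist (m i) (m j) ∧ v j = 1 ∧ v k = 1 := by
    refine ⟨WithLp.toLp 2 (wt i j ((dist (m i) (m k) + dist (m i) (m j)) / dist (m j) (m k)) 1 1),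
      ?_, ?_, ?_⟩
    · simp [wt, mul_div_cancel₀ _ hd.ne']
    · simp [wt, hij.symm]
    · simp [wt, hik.symm]
  obtain ⟨h1, h2, h3⟩ := hp
  set f : ℝ → ℝ := fun t => dist (m i) (m j) * dist (m i) (m k) *
    ((p j + t) ^ 2 + (p k + t) ^ 2 - dist (m j) (m k) ^ 2) +
      2 * sideInner m i j k * ((p j + t) * (p k + t)) with hf
  have hfe : ∀ t, f t = f 0 + 2 * (dist (m i) (m j) * dist (m i) (m k) + sideInner m i j k) *
      (t * (p j + p k) + t ^ 2) := fun t => by simp only [hf]; ring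
  have hf0 : f 0 ≤ 0 := by simp only [hf, add_zero]; exact h3
  have hplane : ∀ t : ℝ, dist (m j) (m k) * (p + t • v) i =
      dist (m i) (m k) * (p + t • v) j + dist (m i) (m j) * (p + t • v) k := fun t => by
    simp only [PiLp.add_apply, PiLp.smul_apply, smul_eq_mul, vj, vk]
    linear_combination h1 + t * vi
  have hmem : ∀ t : ℝ, dist (m j) (m k) ≤ p j + p k + 2 * t → f t ≤ 0 → p + t • v ∈ regionF m i j k :=
    fun t ht hft => by
      refine ⟨hplane t, ?_, ?_⟩
      · simp only [PiLp.add_apply, PiLp.smul_apply, smul_eq_mul, vj, vk]; linarith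
      · simpa only [PiLp.add_apply, PiLp.smul_apply, smul_eq_mul, vj, vk, mul_one] using hft
  have hS : 0 < p j + p k := by linarith
  have hA : 0 < 2 * (dist (m i) (m j) * dist (m i) (m k) + sideInner m i j k) := by linarith
  obtain ⟨t, ht0, ht⟩ : ∃ t, 0 ≤ t ∧ f t = 0 := by
    -- The linear part of f alone already brings f from f 0 to 0 at t₀, and the quadratic part only
    -- helps, so f vanishes somewhere in [0, t₀].
    set t₀ := -f 0 / (2 * (dist (m i) (m j) * dist (m i) (m k) + sideInner m i j k) * (p j + p k))
    have ht₀ : 0 ≤ t₀ := div_nonneg (by linarith) (by positivity)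
    have h4 : 0 ≤ f t₀ := by
      have e : 2 * (dist (m i) (m j) * dist (m i) (m k) + sideInner m i j k) * (t₀ * (p j + p k))
        = -f 0 := by
        have hne := (mul_pos hA hS).ne'
        rw [mul_left_comm, ← mul_assoc, mul_assoc t₀, div_mul_cancel₀ _ hne]
      rw [hfe]
      nlinarith [mul_nonneg hA.le (sq_nonneg t₀)]
    obtain ⟨t, ht, hft⟩ := intermediate_value_Icc ht₀
      (show ContinuousOn f (Set.Icc 0 t₀) by simp only [hf]; fun_prop) ⟨hf0, h4⟩
    exact ⟨t, ht.1, hft⟩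
  obtain ⟨s, hs0, hs⟩ : ∃ s, 0 ≤ s ∧ p j + p k - 2 * s = dist (m j) (m k) :=
    ⟨(p j + p k - dist (m j) (m k)) / 2, by linarith, by ring⟩
  have htop : p + t • v ∈ hull m := by
    have h5 := hmem t (by linarith) ht.le
    obtain ⟨z, -, -, hz⟩ := regionF_arc hm hij hik hjk h5 (by
      simpa only [PiLp.add_apply, PiLp.smul_apply, smul_eq_mul, vj, vk, mul_one] using ht)
    rw [← hz]; exact rangeMap_mem_hull m z
  have hbot : p + (-s) • v ∈ hull m := by
    refine hedge _ (hmem (-s) (by linarith) ?_) ?_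
    · rw [hfe]
      have : -s * (p j + p k) + (-s) ^ 2 ≤ 0 := by nlinarith
      nlinarith [mul_nonneg hA.le (neg_nonneg.2 this)]
    · simp only [PiLp.add_apply, PiLp.smul_apply, smul_eq_mul, vj, vk]; linarith
  rcases ht0.eq_or_lt with h6 | h6
  · rw [← h6] at htop; simpa using htop
  · have hne : s + t ≠ 0 := by positivity
    have := convex_hull m htop hbot (a := s / (s + t)) (b := t / (s + t)) (by positivity)
      (by positivity) (by field_simp)
    convert this using 1
    ext b
    simp only [PiLp.add_apply, PiLp.smul_apply, smul_eq_mul]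
    field_simp
    ring

lemma regionF_subset_frontier : regionF m i j k ⊆ frontier (hull m) := by
  intro p hp
  have hd := receivers_dist_pos hm hjk
  refine mem_frontier_of_support
    (subset_closure (regionF_subset_hull hm hij hik hjk hp))
    (w := wt i j (-dist (m j) (m k)) (dist (m i) (m k)) (dist (m i) (m j)))
    (wt_ne_zero (neg_ne_zero.2 hd.ne')) fun z => ?_
  rw [lin_wt hij hik hjk, wdist_wt hij hik hjk]
  have := ptolemy m i j k z
  have := hp.1
  linarith

end

lemma rangeMap_sub_ne {m : Fin 3 → Plane} (hm : ¬ Collinear ℝ (Set.range m)) {j k : Fin 3}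
    (hjk : j ≠ k) (r : ℝ) : rangeMap m (m j) - rangeMap m (m k) ≠ r • one := by
  intro h
  have hd := receivers_dist_pos hm hjk
  have h1 := congrArg (fun p : TSpace => p j) h
  have h2 := congrArg (fun p : TSpace => p k) h
  simp [rangeMap] at h1 h2
  rw [dist_comm] at h1
  linarith

lemma mul_self_add_mem {X : Set TSpace} (f : TSpace →ₗ[ℝ] ℝ) (d : ℝ)
    (hX : ∀ p, p ∈ X ↔ f p = d) :
    ∀ p ∈ X, ∀ c ∈ X, ∀ t : ℝ, 0 ≤ t → p + t • (p - c) ∈ X := by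
  intro p hp c hc t _
  rw [hX] at *
  rw [map_add, map_smul, map_sub, hp, hc]; simp

/-- Ptolemy equality makes the quadratic inequality of `regionF` tight exactly on the arc, and the
linear one is tight exactly on the bounded edge; the open set U consists of the strict inequalities.
-/
lemma pieceF_eq {m : Fin 3 → Plane} (hm : ¬ Collinear ℝ (Set.range m)) (i : Fin 3) :
    pieceF m i = regionF m i (jj i) (kk i) := by
  have hij := jj_ne i
  have hik := kk_ne i
  have hjk := jj_ne_kk i
  have hcl := subset_closure.trans' (regionF_subset_hull hm hij hik hjk)
  have hX : regionF m i (jj i) (kk i) ⊆ planeF m i := fun p hp => hp.1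
  have hedge : boundedEdge m i ⊆ regionF m i (jj i) (kk i) :=
    (convex_regionF hm hij hik hjk).segment_subset receiver_mem_regionF
      receiver_mem_regionF'
  have hedge' : ∀ p ∈ boundedEdge m i, p (jj i) + p (kk i) = dist (m (jj i)) (m (kk i)) := by
    rintro p ⟨a, b, ha, hb, hab, rfl⟩
    simp only [rangeMap, PiLp.add_apply, PiLp.smul_apply, smul_eq_mul, dist_self]
    rw [dist_comm (m (kk i))]
    linear_combination dist (m (jj i)) (m (kk i)) * hab
  have harc : ∀ z ∈ arc m i, dist (m (jj i)) (m (kk i)) * dist z (m i) =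
      dist (m i) (m (kk i)) * dist z (m (jj i)) + dist (m i) (m (jj i)) * dist z (m (kk i)) :=
    fun z hz => by
      rw [mem_arc_iff hm] at hz
      exact ptolemy_of_arc hm hij hik hjk hz.1 hz.2
  rw [pieceF]
  refine enclosedRegion_eq (m := m) (U := {p | dist (m (jj i)) (m (kk i)) < p (jj i) + p (kk i) ∧
    dist (m i) (m (jj i)) * dist (m i) (m (kk i)) *
      (p (jj i) ^ 2 + p (kk i) ^ 2 - dist (m (jj i)) (m (kk i)) ^ 2) +
      2 * sideInner m i (jj i) (kk i) * (p (jj i) * p (kk i)) < 0}) ?_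
    (convex_regionF hm hij hik hjk) isClosed_regionF hX
    (fun p hp => ⟨closure_hull_subset_polyhedron m (hcl hp), hX hp⟩) (fun p hp => hp.1)
    (Set.union_subset ?_ hedge) ?_ ?_ receiver_mem_regionF
    receiver_mem_regionF' (rangeMap_sub_ne hm hjk)
  · exact mul_self_add_mem (lin (wt i (jj i) (dist (m (jj i)) (m (kk i))) (-dist (m i) (m (kk i)))
      (-dist (m i) (m (jj i))))) 0 fun p => by
        rw [lin_wt hij hik hjk, planeF, Set.mem_ofPred_eq]
        constructor <;> intro h <;> linarith
  · rintro _ ⟨z, hz, rfl⟩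
    exact rangeMap_mem_regionF (harc z hz)
  · refine isOpen_and (isOpen_lt ?_ ?_) (isOpen_lt ?_ ?_) <;> fun_prop
  · intro p hp
    constructor
    · rintro ⟨h1, h2⟩
      refine ⟨⟨hp, h1.le, h2.le⟩, ?_⟩
      rintro (⟨z, hz, rfl⟩ | h)
      · exact h2.ne (ptolemy_eq m (harc z hz))
      · exact h1.ne' (hedge' p h)
    · rintro ⟨h, hJ⟩
      obtain ⟨h0, h1⟩ := regionF_nonneg hm hij hik hjk h
      refine ⟨lt_of_le_of_ne h.2.1 fun e => hJ (Or.inr ?_), lt_of_le_of_ne h.2.2 fun e =>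
        hJ (Or.inl ?_)⟩
      · exact mem_edge_of_sum_eq hm hij hik hjk h.1 e.symm h0 h1
      · obtain ⟨z, z1, z2, rfl⟩ := regionF_arc hm hij hik hjk h e
        exact ⟨z, (mem_arc_iff hm i z).2 ⟨z1, z2⟩, rfl⟩

end

/-! ### Facet regions cut off by the sides and by the half-lines -/

section

/-- The convex subset of the facet bounded by the image of a side of the triangle. -/
def regionG (m : Fin 3 → Plane) (i j k : Fin 3) : Set TSpace :=
  {p | p j + p k = dist (m j) (m k) ∧ 0 ≤ p j ∧ 0 ≤ p k ∧
    dist (m j + (p j / dist (m j) (m k)) • (m k - m j)) (m i) ≤ p i ∧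
    dist (m j) (m k) * p i ≤ dist (m i) (m k) * p j + dist (m i) (m j) * p k}

/-- The unbounded convex subset of the facet bounded by the image of a half-line. -/
def regionL (m : Fin 3 → Plane) (a b c : Fin 3) : Set TSpace :=
  {p | p b - p a = dist (m a) (m b) ∧ 0 ≤ p a ∧
    dist (m a + (p a / dist (m a) (m b)) • (m a - m b)) (m c) ≤ p c ∧
    p c ≤ p a + dist (m a) (m c)}

lemma dist_line_convex (u v z : Plane) (d x y : ℝ) {a b : ℝ} (ha : 0 ≤ a) (hb : 0 ≤ b)
    (hab : a + b = 1) : dist (u + ((a * x + b * y) / d) • v) z ≤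
      a * dist (u + (x / d) • v) z + b * dist (u + (y / d) • v) z := by
  simp only [dist_eq_norm]
  have : u + ((a * x + b * y) / d) • v - z =
      a • (u + (x / d) • v - z) + b • (u + (y / d) • v - z) := by
    obtain rfl : b = 1 - a := by linarith
    module
  rw [this]
  refine (norm_add_le _ _).trans_eq ?_
  rw [norm_smul, norm_smul, Real.norm_of_nonneg ha, Real.norm_of_nonneg hb]

lemma dist_line_left (a b : Plane) {s : ℝ} (hs : 0 ≤ s) : dist (a + s • (b - a)) a = s * dist a b := by
  rw [dist_self_add_left, norm_smul, Real.norm_of_nonneg hs, dist_comm, dist_eq_norm]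

lemma dist_line_right (a b : Plane) {s : ℝ} (hs : s ≤ 1) :
    dist (a + s • (b - a)) b = (1 - s) * dist a b := by
  rw [dist_eq_norm, show a + s • (b - a) - b = (1 - s) • (a - b) by module, norm_smul,
    Real.norm_of_nonneg (by linarith), dist_eq_norm]

lemma dist_ray_left (a b : Plane) {s : ℝ} (hs : 0 ≤ s) : dist (a + s • (a - b)) a = s * dist a b := by
  rw [dist_self_add_left, norm_smul, Real.norm_of_nonneg hs, dist_eq_norm]

lemma dist_ray_right (a b : Plane) {s : ℝ} (hs : 0 ≤ s) :
    dist (a + s • (a - b)) b = (1 + s) * dist a b := by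
  rw [dist_eq_norm, show a + s • (a - b) - b = (1 + s) • (a - b) by module, norm_smul,
    Real.norm_of_nonneg (by linarith), dist_eq_norm]

section
variable {m : Fin 3 → Plane} (hm : ¬ Collinear ℝ (Set.range m)) {i j k : Fin 3} (hij : i ≠ j)
  (hik : i ≠ k) (hjk : j ≠ k)

lemma convex_regionG (m : Fin 3 → Plane) (i j k : Fin 3) : Convex ℝ (regionG m i j k) := by
  rintro x ⟨x1, x2, x3, x4, x5⟩ y ⟨y1, y2, y3, y4, y5⟩ a b ha hb hab
  simp only [regionG, Set.mem_ofPred_eq, PiLp.add_apply, PiLp.smul_apply, smul_eq_mul]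
  refine ⟨?_, by positivity, by positivity, ?_, ?_⟩
  · linear_combination a * x1 + b * y1 + dist (m j) (m k) * hab
  · have := dist_line_convex (m j) (m k - m j) (m i) (dist (m j) (m k)) (x j) (y j) ha hb hab
    have e1 := mul_le_mul_of_nonneg_left x4 ha
    have e2 := mul_le_mul_of_nonneg_left y4 hb
    linarith
  · have e1 := mul_le_mul_of_nonneg_left x5 ha
    have e2 := mul_le_mul_of_nonneg_left y5 hb
    linarith

lemma isClosed_regionG (m : Fin 3 → Plane) (i j k : Fin 3) : IsClosed (regionG m i j k) := by
  refine isClosed_and (isClosed_eq ?_ ?_) (isClosed_and (isClosed_le ?_ ?_)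
    (isClosed_and (isClosed_le ?_ ?_) (isClosed_and (isClosed_le ?_ ?_) (isClosed_le ?_ ?_)))) <;>
    fun_prop

include hm hjk in
lemma segment_mem_regionG (i : Fin 3) {z : Plane} (hz : z ∈ segment ℝ (m j) (m k)) :
    rangeMap m z ∈ regionG m i j k ∧ dist (m j + (rangeMap m z j / dist (m j) (m k)) •
      (m k - m j)) (m i) = rangeMap m z i := by
  have hd := receivers_dist_pos hm hjk
  rw [segment_eq_image'] at hz
  obtain ⟨s, ⟨hs0, hs1⟩, rfl⟩ := hz
  have e1 := dist_line_left (m j) (m k) hs0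
  have e2 := dist_line_right (m j) (m k) hs1
  simp only [regionG, Set.mem_ofPred_eq, rangeMap]
  have e3 : dist (m j + s • (m k - m j)) (m j) / dist (m j) (m k) = s := by
    rw [e1]; field_simp
  rw [e3]
  refine ⟨⟨by rw [e1, e2]; ring, dist_nonneg, dist_nonneg, le_rfl, ptolemy m i j k _⟩, rfl⟩

include hm hij hik hjk

/-- The points of the lower boundary of `regionG` belong to the image of the side. -/
lemma regionG_side {p : TSpace} (hp : p j + p k = dist (m j) (m k)) (hj : 0 ≤ p j) (hk : 0 ≤ p k)
    (h : dist (m j + (p j / dist (m j) (m k)) • (m k - m j)) (m i) = p i) :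
    ∃ z ∈ segment ℝ (m j) (m k), rangeMap m z = p := by
  have hd := receivers_dist_pos hm hjk
  have h1 : p j / dist (m j) (m k) ≤ 1 := by rw [div_le_one hd]; linarith
  have h0 : 0 ≤ p j / dist (m j) (m k) := div_nonneg hj hd.le
  refine ⟨m j + (p j / dist (m j) (m k)) • (m k - m j), ?_, ?_⟩
  · rw [segment_eq_image']
    exact ⟨p j / dist (m j) (m k), ⟨h0, h1⟩, rfl⟩
  · ext b
    rcases forall_three hij hik hjk b with rfl | rfl | rfl
    · exact h
    · simp only [rangeMap]; rw [dist_line_left _ _ h0]; field_simp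
    · simp only [rangeMap]; rw [dist_line_right _ _ h1]; field_simp; linarith

/-- Fixing p_j and p_k, the coordinate p_i runs over an interval whose lower end is on the image of
the side and whose upper end is on the bounded edge. -/
lemma regionG_subset_hull : regionG m i j k ⊆ hull m := by
  rintro p ⟨h1, h2, h3, h4, h5⟩
  have hd := receivers_dist_pos hm hjk
  have hex : ∀ t : ℝ, ∃ q : TSpace, q i = t ∧ ∀ b, b ≠ i → q b = p b := fun t =>
    ⟨WithLp.toLp 2 (fun b => if b = i then t else p b), by simp, fun b hb => by simp [hb]⟩
  obtain ⟨q, qi, qb⟩ := hex (dist (m j + (p j / dist (m j) (m k)) • (m k - m j)) (m i))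
  obtain ⟨r, ri, rb⟩ := hex ((dist (m i) (m k) * p j + dist (m i) (m j) * p k) / dist (m j) (m k))
  have hq : q ∈ hull m := by
    obtain ⟨z, -, hz⟩ := regionG_side (p := q) hm hij hik hjk (by rw [qb j hij.symm, qb k hik.symm, h1])
      (by rwa [qb j hij.symm]) (by rwa [qb k hik.symm]) (by rw [qi, qb j hij.symm])
    rw [← hz]; exact rangeMap_mem_hull m z
  have hr : r ∈ hull m := by
    refine (convex_hull m).segment_subset (rangeMap_mem_hull m _) (rangeMap_mem_hull m _)
      (mem_edge_of_sum_eq (i := i) (j := j) (k := k) hm hij hik hjk ?_ ?_ ?_ ?_)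
    · rw [ri, rb j hij.symm, rb k hik.symm]; field_simp
    · rw [rb j hij.symm, rb k hik.symm, h1]
    · rwa [rb j hij.symm]
    · rwa [rb k hik.symm]
  refine (convex_hull m).segment_subset hq hr (mem_segment_of_eq_off qb rb (by rwa [qi]) ?_)
  rw [ri, le_div_iff₀ hd]; linarith

lemma regionG_subset_frontier : regionG m i j k ⊆ frontier (hull m) := by
  intro p hp
  refine mem_frontier_of_support
    (subset_closure (regionG_subset_hull hm hij hik hjk hp)) (w := wt j k 1 1 0)
    (wt_ne_zero one_ne_zero) fun z => ?_
  rw [lin_wt hjk hij.symm hik.symm, wdist_wt hjk hij.symm hik.symm]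
  have := dist_triangle_left (m j) (m k) z
  have := hp.1
  linarith

omit hij hik in
-- At the two ends of the facet the lower and the upper bound of p_i coincide, so the inequalities
-- p_j ≥ 0 and p_k ≥ 0 contribute no boundary besides the edge.
lemma regionG_left {p : TSpace} (hp : p ∈ regionG m i j k) (h : p j = 0 ∨ p k = 0) :
    dist (m j) (m k) * p i = dist (m i) (m k) * p j + dist (m i) (m j) * p k := by
  obtain ⟨h1, h2, h3, h4, h5⟩ := hp
  have hd := receivers_dist_pos hm hjk
  refine le_antisymm h5 ?_
  rcases h with h | h
  · rw [h, zero_add] at h1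
    rw [h, zero_div, zero_smul, add_zero, dist_comm] at h4
    rw [h, h1]
    nlinarith
  · rw [h, add_zero] at h1
    rw [h1, div_self hd.ne', one_smul, add_sub_cancel, dist_comm] at h4
    rw [h, h1]
    nlinarith

end

lemma pieceG_eq {m : Fin 3 → Plane} (hm : ¬ Collinear ℝ (Set.range m)) (i : Fin 3) :
    pieceG m i = regionG m i (jj i) (kk i) := by
  have hij := jj_ne i
  have hik := kk_ne i
  have hjk := jj_ne_kk i
  have hd := receivers_dist_pos hm hjk
  have hcl := subset_closure.trans' (regionG_subset_hull hm hij hik hjk)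
  have hX : regionG m i (jj i) (kk i) ⊆ planeG m i := fun p hp => hp.1
  have hl := (segment_mem_regionG hm hjk i (left_mem_segment ℝ _ _)).1
  have hr := (segment_mem_regionG hm hjk i (right_mem_segment ℝ _ _)).1
  have hedge : boundedEdge m i ⊆ regionG m i (jj i) (kk i) :=
    (convex_regionG m _ _ _).segment_subset hl hr
  have hedge' : ∀ p ∈ boundedEdge m i, dist (m (jj i)) (m (kk i)) * p i =
      dist (m i) (m (kk i)) * p (jj i) + dist (m i) (m (jj i)) * p (kk i) := fun p hp =>
    ((convex_regionF hm hij hik hjk).segment_subset receiver_mem_regionF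
      receiver_mem_regionF' hp).1
  rw [pieceG]
  refine enclosedRegion_eq (m := m) (U := {p | 0 < p (jj i) ∧ 0 < p (kk i) ∧
    dist (m (jj i) + (p (jj i) / dist (m (jj i)) (m (kk i))) • (m (kk i) - m (jj i))) (m i) < p i ∧
    dist (m (jj i)) (m (kk i)) * p i <
      dist (m i) (m (kk i)) * p (jj i) + dist (m i) (m (jj i)) * p (kk i)}) ?_
    (convex_regionG m _ _ _) (isClosed_regionG m _ _ _) hX
    (fun p hp => ⟨closure_hull_subset_polyhedron m (hcl hp), hX hp⟩) (fun p hp => hp.1)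
    (Set.union_subset ?_ hedge) ?_ ?_ hl hr (rangeMap_sub_ne hm hjk)
  · exact mul_self_add_mem (lin (wt (jj i) (kk i) 1 1 0)) (dist (m (jj i)) (m (kk i))) fun p => by
      rw [lin_wt hjk hij.symm hik.symm, planeG, Set.mem_ofPred_eq]
      constructor <;> intro h <;> linarith
  · rintro _ ⟨z, hz, rfl⟩
    exact (segment_mem_regionG hm hjk i hz).1
  · refine isOpen_and (isOpen_lt ?_ ?_) (isOpen_and (isOpen_lt ?_ ?_) (isOpen_and
      (isOpen_lt ?_ ?_) (isOpen_lt ?_ ?_))) <;> fun_prop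
  · intro p hp
    constructor
    · rintro ⟨h1, h2, h3, h4⟩
      refine ⟨⟨hp, h1.le, h2.le, h3.le, h4.le⟩, ?_⟩
      rintro (⟨z, hz, rfl⟩ | h)
      · exact h3.ne (segment_mem_regionG hm hjk i hz).2
      · exact h4.ne (hedge' p h)
    · rintro ⟨h, hJ⟩
      have hnot : dist (m (jj i)) (m (kk i)) * p i ≠
          dist (m i) (m (kk i)) * p (jj i) + dist (m i) (m (jj i)) * p (kk i) := fun e =>
        hJ (Or.inr (mem_edge_of_sum_eq hm hij hik hjk e hp h.2.1 h.2.2.1))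
      refine ⟨lt_of_le_of_ne h.2.1 fun e => hnot ?_, lt_of_le_of_ne h.2.2.1 fun e => hnot ?_,
        lt_of_le_of_ne h.2.2.2.1 fun e => hJ (Or.inl ?_), lt_of_le_of_ne h.2.2.2.2 hnot⟩
      · exact regionG_left hm hjk h (Or.inl e.symm)
      · exact regionG_left hm hjk h (Or.inr e.symm)
      · exact regionG_side hm hij hik hjk hp h.2.1 h.2.2.1 e

section
variable {m : Fin 3 → Plane} (hm : ¬ Collinear ℝ (Set.range m)) {a b c : Fin 3} (hab : a ≠ b)
  (hac : a ≠ c) (hbc : b ≠ c)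

lemma convex_regionL (m : Fin 3 → Plane) (a b c : Fin 3) : Convex ℝ (regionL m a b c) := by
  rintro x ⟨x1, x2, x3, x4⟩ y ⟨y1, y2, y3, y4⟩ s t hs ht hst
  simp only [regionL, Set.mem_ofPred_eq, PiLp.add_apply, PiLp.smul_apply, smul_eq_mul]
  refine ⟨?_, by positivity, ?_, ?_⟩
  · linear_combination s * x1 + t * y1 + dist (m a) (m b) * hst
  · have := dist_line_convex (m a) (m a - m b) (m c) (dist (m a) (m b)) (x a) (y a) hs ht hst
    have e1 := mul_le_mul_of_nonneg_left x3 hs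
    have e2 := mul_le_mul_of_nonneg_left y3 ht
    linarith
  · have e1 := mul_le_mul_of_nonneg_left x4 hs
    have e2 := mul_le_mul_of_nonneg_left y4 ht
    have e3 : s * dist (m a) (m c) + t * dist (m a) (m c) = dist (m a) (m c) := by
      rw [← add_mul, hst, one_mul]
    linarith

lemma isClosed_regionL (m : Fin 3 → Plane) (a b c : Fin 3) : IsClosed (regionL m a b c) := by
  refine isClosed_and (isClosed_eq ?_ ?_) (isClosed_and (isClosed_le ?_ ?_)
    (isClosed_and (isClosed_le ?_ ?_) (isClosed_le ?_ ?_))) <;>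
    fun_prop

include hm hab in
lemma halfLine_mem_regionL (c : Fin 3) {z : Plane} (hz : z ∈ halfLine (m a) (m b)) :
    rangeMap m z ∈ regionL m a b c ∧ dist (m a + (rangeMap m z a / dist (m a) (m b)) •
      (m a - m b)) (m c) = rangeMap m z c := by
  have hd := receivers_dist_pos hm hab
  obtain ⟨s, hs, rfl⟩ := hz
  have e1 := dist_ray_left (m a) (m b) hs
  have e2 := dist_ray_right (m a) (m b) hs
  simp only [regionL, Set.mem_ofPred_eq, rangeMap]
  have e3 : dist (m a + s • (m a - m b)) (m a) / dist (m a) (m b) = s := by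
    rw [e1]; field_simp
  rw [e3]
  exact ⟨⟨by rw [e1, e2]; ring, dist_nonneg, le_rfl, dist_triangle _ _ _⟩, rfl⟩

include hm hab in
-- Adding t to p_a moves the point on the half-line by t, so its distance from m_c grows by at most
-- t.
lemma add_mem_regionL {p : TSpace} (hp : p ∈ regionL m a b c) {t : ℝ} (ht : 0 ≤ t) :
    p + t • one ∈ regionL m a b c := by
  obtain ⟨h1, h2, h3, h4⟩ := hp
  have hd := receivers_dist_pos hm hab
  simp only [regionL, Set.mem_ofPred_eq, PiLp.add_apply, PiLp.smul_apply, smul_eq_mul, one_apply,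
    mul_one]
  refine ⟨by linarith, by linarith, ?_, by linarith⟩
  have e : m a + ((p a + t) / dist (m a) (m b)) • (m a - m b) =
      m a + (p a / dist (m a) (m b)) • (m a - m b) + (t / dist (m a) (m b)) • (m a - m b) := by
    rw [add_div, add_smul, add_assoc]
  have e2 : dist (m a + ((p a + t) / dist (m a) (m b)) • (m a - m b))
      (m a + (p a / dist (m a) (m b)) • (m a - m b)) = t := by
    rw [e, dist_self_add_left, norm_smul, ← dist_eq_norm,
      Real.norm_of_nonneg (div_nonneg ht hd.le)]
    field_simp
  have := dist_triangle (m a + ((p a + t) / dist (m a) (m b)) • (m a - m b))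
    (m a + (p a / dist (m a) (m b)) • (m a - m b)) (m c)
  linarith

lemma mem_unboundedEdge_iff (m : Fin 3 → Plane) (a : Fin 3) (p : TSpace) :
    p ∈ unboundedEdge m a ↔ ∃ t : ℝ, 0 ≤ t ∧ p = rangeMap m (m a) + t • one := by
  constructor
  · rintro ⟨hp, h⟩
    obtain ⟨b, c, hab, hac, hbc⟩ := exists_others a
    refine ⟨p a, ?_, ?_⟩
    · have hb := h b hab.symm
      have : dist (m a) (m b) ≤ p a + p b := by
        rcases hab.lt_or_gt with hlt | hlt
        · have := (hp.1 a b hlt).2.2; rwa [dist_comm] at this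
        · have := (hp.1 b a hlt).2.2; linarith
      linarith
    · ext e
      simp only [rangeMap, PiLp.add_apply, PiLp.smul_apply, smul_eq_mul, one_apply, mul_one]
      by_cases he : e = a
      · rw [he, dist_self, zero_add]
      · have := h e he; linarith
  · rintro ⟨t, ht, rfl⟩
    refine ⟨closure_hull_subset_polyhedron m
      (add_smul_one_mem_closure m (rangeMap_mem_hull m _) ht), fun e he => ?_⟩
    simp [rangeMap]

include hab hac hbc in
lemma mem_unboundedEdge_of_eq {p : TSpace} (h1 : p b - p a = dist (m a) (m b)) (h2 : 0 ≤ p a)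
    (h3 : p c = p a + dist (m a) (m c)) : p ∈ unboundedEdge m a := by
  rw [mem_unboundedEdge_iff]
  refine ⟨p a, h2, ?_⟩
  ext e
  simp only [rangeMap, PiLp.add_apply, PiLp.smul_apply, smul_eq_mul, one_apply, mul_one]
  rcases forall_three hab hac hbc e with rfl | rfl | rfl
  · rw [dist_self, zero_add]
  · linarith
  · linarith

include hm hab in
lemma unboundedEdge_subset_regionL (c : Fin 3) : unboundedEdge m a ⊆ regionL m a b c := by
  intro p hp
  obtain ⟨t, ht, rfl⟩ := (mem_unboundedEdge_iff m a p).1 hp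
  exact add_mem_regionL hm hab (halfLine_mem_regionL hm hab c ⟨0, le_rfl, by simp⟩).1 ht

include hm hab hac hbc

lemma regionL_halfLine {p : TSpace} (h1 : p b - p a = dist (m a) (m b)) (h2 : 0 ≤ p a)
    (h : dist (m a + (p a / dist (m a) (m b)) • (m a - m b)) (m c) = p c) :
    ∃ z ∈ halfLine (m a) (m b), rangeMap m z = p := by
  have hd := receivers_dist_pos hm hab
  have h0 : 0 ≤ p a / dist (m a) (m b) := div_nonneg h2 hd.le
  refine ⟨_, ⟨p a / dist (m a) (m b), h0, rfl⟩, ?_⟩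
  ext e
  rcases forall_three hab hac hbc e with rfl | rfl | rfl
  · simp only [rangeMap]; rw [dist_ray_left _ _ h0]; field_simp
  · simp only [rangeMap]; rw [dist_ray_right _ _ h0]; field_simp; linarith
  · exact h

omit hm hab hac hbc in
lemma regionL_start {p : TSpace} (hp : p ∈ regionL m a b c) (h : p a = 0) :
    p c = p a + dist (m a) (m c) := by
  obtain ⟨h1, h2, h3, h4⟩ := hp
  rw [h, zero_div, zero_smul, add_zero] at h3
  linarith

/-- The points below the unbounded edge belong to the convex hull of the curve. -/
lemma regionL_subset : regionL m a b c ⊆ hull m ∪ unboundedEdge m a := by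
  intro p hp
  obtain ⟨h1, h2, h3, h4⟩ := id hp
  have hd := receivers_dist_pos hm hab
  have hdc := receivers_dist_pos hm hac
  rcases h4.eq_or_lt with h | h
  · exact Or.inr (mem_unboundedEdge_of_eq hab hac hbc h1 h2 h)
  left
  have hpa : 0 < p a := lt_of_le_of_ne h2 fun e =>
    h.ne (regionL_start hp e.symm)
  obtain ⟨q, qc, qe⟩ : ∃ q : TSpace,
      q c = dist (m a + (p a / dist (m a) (m b)) • (m a - m b)) (m c) ∧ ∀ e, e ≠ c → q e = p e :=
    ⟨WithLp.toLp 2 (fun e => if e = c then _ else p e), by simp; rfl, fun e he => by simp [he]⟩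
  have hq : q ∈ hull m := by
    obtain ⟨z, -, hz⟩ := regionL_halfLine (p := q) hm hab hac hbc (by rw [qe b hbc, qe a hac, h1])
      (by rwa [qe a hac]) (by rw [qe a hac, qc])
    rw [← hz]; exact rangeMap_mem_hull m z
  obtain ⟨δ, hδ⟩ : ∃ δ, δ = p a + dist (m a) (m c) - p c := ⟨_, rfl⟩
  have hδ0 : 0 < δ := by linarith
  -- Mixing T(m_a) and the far point T(z) with weights 1 - 1/N and 1/N reproduces p_a and p_b. Its
  -- c-coordinate is at least p_a + d_ac - 2 d_ac / N, which this N makes at least p_c.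
  obtain ⟨N, hN⟩ : ∃ N, N = 1 + 2 * dist (m a) (m c) / δ := ⟨_, rfl⟩
  have hN1 : 1 ≤ N := by rw [hN]; have : 0 < 2 * dist (m a) (m c) / δ := by positivity
                         linarith
  have hN0 : 0 < N := by linarith
  have hS : 0 ≤ N * (p a / dist (m a) (m b)) := by positivity
  set z : Plane := m a + (N * (p a / dist (m a) (m b))) • (m a - m b) with hz
  have za : dist z (m a) = N * p a := by rw [hz, dist_ray_left _ _ hS]; field_simp
  have zb : dist z (m b) = dist (m a) (m b) + N * p a := by
    rw [hz, dist_ray_right _ _ hS]; field_simp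
  have zc : N * p a - dist (m a) (m c) ≤ dist z (m c) := by
    have := dist_triangle z (m c) (m a)
    rw [dist_comm (m c) (m a)] at this
    linarith
  have hr : (1 - N⁻¹) • rangeMap m (m a) + N⁻¹ • rangeMap m z ∈ hull m :=
    convex_hull m (rangeMap_mem_hull m _) (rangeMap_mem_hull m _)
      (by have := inv_le_one_of_one_le₀ hN1; linarith) (by positivity) (by ring)
  refine (convex_hull m).segment_subset hq hr (mem_segment_of_eq_off qe ?_ (by rwa [qc]) ?_)
  · intro e he
    simp only [rangeMap, PiLp.add_apply, PiLp.smul_apply, smul_eq_mul]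
    rcases forall_three hab hac hbc e with rfl | rfl | rfl
    · rw [za, dist_self]; field_simp; ring
    · rw [zb]; field_simp; linear_combination (-N) * h1
    · exact absurd rfl he
  · simp only [rangeMap, PiLp.add_apply, PiLp.smul_apply, smul_eq_mul]
    have e1 : N⁻¹ * (N * p a - dist (m a) (m c)) ≤ N⁻¹ * dist z (m c) :=
      mul_le_mul_of_nonneg_left zc (by positivity)
    have e2 : N⁻¹ * (N * p a - dist (m a) (m c)) = p a - N⁻¹ * dist (m a) (m c) := by
      field_simp
    have e3 : N⁻¹ * (2 * dist (m a) (m c)) ≤ δ := by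
      rw [inv_mul_le_iff₀ hN0, hN, add_mul, div_mul_cancel₀ _ hδ0.ne']
      linarith
    linarith

lemma regionL_subset_closure : regionL m a b c ⊆ closure (hull m) := by
  intro p hp
  rcases regionL_subset hm hab hac hbc hp with h | h
  · exact subset_closure h
  · obtain ⟨t, ht, rfl⟩ := (mem_unboundedEdge_iff m a p).1 h
    exact add_smul_one_mem_closure m (rangeMap_mem_hull m _) ht

lemma regionL_subset_frontier : regionL m a b c ⊆ frontier (hull m) := by
  intro p hp
  refine mem_frontier_of_support (regionL_subset_closure hm hab hac hbc hp) (w := wt a b 1 (-1) 0)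
    (wt_ne_zero one_ne_zero) fun z => ?_
  rw [lin_wt hab hac hbc, wdist_wt hab hac hbc]
  have := dist_triangle z (m a) (m b)
  have := hp.1
  linarith

lemma pieceL_eq : pieceL m a b = regionL m a b c := by
  have hd := receivers_dist_pos hm hab
  have hdc := receivers_dist_pos hm hac
  have hX : regionL m a b c ⊆ planeL m a b := fun p hp => hp.1
  have h0 := (halfLine_mem_regionL (z := m a) hm hab c ⟨0, le_rfl, by simp⟩).1
  have h1 := (halfLine_mem_regionL hm hab c ⟨1, zero_le_one, rfl⟩).1
  have hray : ∀ p ∈ unboundedEdge m a, p c = p a + dist (m a) (m c) := fun p hp => by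
    have := hp.2 c hac.symm
    linarith
  rw [pieceL]
  refine enclosedRegion_eq (m := m) (U := {p | 0 < p a ∧
    dist (m a + (p a / dist (m a) (m b)) • (m a - m b)) (m c) < p c ∧
    p c < p a + dist (m a) (m c)}) ?_
    (convex_regionL m _ _ _) (isClosed_regionL m _ _ _) hX
    (fun p hp => ⟨closure_hull_subset_polyhedron m (regionL_subset_closure hm hab hac hbc hp), hX hp⟩)
    (fun p hp => hp.1) (Set.union_subset ?_ (unboundedEdge_subset_regionL hm hab c)) ?_ ?_ h1 h0 ?_
  · exact mul_self_add_mem (lin (wt b a 1 (-1) 0)) (dist (m a) (m b)) fun p => by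
      rw [lin_wt hab.symm hbc hac, planeL, Set.mem_ofPred_eq]
      constructor <;> intro h <;> linarith
  · rintro _ ⟨z, hz, rfl⟩
    exact (halfLine_mem_regionL hm hab c hz).1
  · refine isOpen_and (isOpen_lt ?_ ?_) (isOpen_and (isOpen_lt ?_ ?_) (isOpen_lt ?_ ?_)) <;>
      fun_prop
  · intro p hp
    constructor
    · rintro ⟨h1, h2, h3⟩
      refine ⟨⟨hp, h1.le, h2.le, h3.le⟩, ?_⟩
      rintro (⟨z, hz, rfl⟩ | h)
      · exact h2.ne (halfLine_mem_regionL hm hab c hz).2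
      · exact h3.ne (hray p h)
    · rintro ⟨h, hJ⟩
      have hnot : p c ≠ p a + dist (m a) (m c) := fun e =>
        hJ (Or.inr (mem_unboundedEdge_of_eq hab hac hbc hp h.2.1 e))
      refine ⟨lt_of_le_of_ne h.2.1 fun e => hnot (regionL_start h e.symm),
        lt_of_le_of_ne h.2.2.1 fun e => hJ (Or.inl ?_), lt_of_le_of_ne h.2.2.2 hnot⟩
      exact regionL_halfLine hm hab hac hbc hp h.2.1 e
  -- The two test points are T(2 m_a - m_b) and T(m_a). If they differed by a multiple of `one`, the
  -- distance from 2 m_a - m_b to m_c would be d_ab + d_ac, contradicting the strict Cauchy-Schwarz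
  -- inequality at m_a.
  · intro r h
    have ha := congrArg (fun p : TSpace => p a) h
    have hc := congrArg (fun p : TSpace => p c) h
    simp only [rangeMap, PiLp.sub_apply, PiLp.smul_apply, smul_eq_mul, one_apply, mul_one,
      dist_self, dist_ray_left _ _ zero_le_one, one_mul, sub_zero] at ha hc
    have hlt := (abs_lt.1 (abs_sideInner_lt hm hab hac hbc)).2
    have hsq := dist_sq (m a + (1 : ℝ) • (m a - m b)) (m c)
    have hb := dist_sq (m a) (m b)
    have hcc := dist_sq (m a) (m c)
    have e : dist (m a + (1 : ℝ) • (m a - m b)) (m c) = dist (m a) (m b) + dist (m a) (m c) := by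
      linarith
    rw [e] at hsq
    simp only [one_smul, PiLp.add_apply, PiLp.sub_apply] at hsq
    simp only [sideInner] at hlt
    nlinarith

end

end

/-! ### Classification of the frontier of the hull -/

section

lemma regionF_symm (m : Fin 3 → Plane) (i j k : Fin 3) : regionF m i j k = regionF m i k j := by
  ext p
  have e : sideInner m i j k = sideInner m i k j := by simp only [sideInner]; ring
  simp only [regionF, Set.mem_ofPred_eq, dist_comm (m k) (m j), e]
  constructor <;> rintro ⟨h1, h2, h3⟩ <;> exact ⟨by linarith, by linarith, by linarith⟩

lemma regionG_symm {m : Fin 3 → Plane} (hm : ¬ Collinear ℝ (Set.range m)) {j k : Fin 3}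
    (hjk : j ≠ k) (i : Fin 3) : regionG m i j k ⊆ regionG m i k j := by
  rintro p ⟨h1, h2, h3, h4, h5⟩
  have hd := receivers_dist_pos hm hjk
  refine ⟨by rw [dist_comm, ← h1, add_comm], h3, h2, ?_, by rw [dist_comm (m k)]; linarith⟩
  convert h4 using 2
  have : p k / dist (m k) (m j) = 1 - p j / dist (m j) (m k) := by
    rw [dist_comm (m k), eq_sub_iff_add_eq, ← add_div, add_comm, h1, div_self hd.ne']
  rw [this]
  module

/-- The points of the curved and of the flat parts of the boundary. -/
def OnPieces (m : Fin 3 → Plane) (p : TSpace) : Prop :=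
  p ∈ rangeMap m '' posLocus m ∨ ∃ i j k : Fin 3, i ≠ j ∧ i ≠ k ∧ j ≠ k ∧
    (p ∈ regionF m i j k ∨ p ∈ regionG m i j k ∨ p ∈ regionL m j k i)

section
variable {m : Fin 3 → Plane} (hm : ¬ Collinear ℝ (Set.range m))

/-- The determinant of the weighted sum of the Hessians of the distances. -/
lemma hessian_det (y : Plane) (hy : y ∉ Set.range m) (κ : ℝ) {μ : Fin 3 → ℝ}
    (hμ : ∀ b, μ b = κ * bary m b y / dist y (m b) ^ 2) :
    (∑ b, μ b * (y 0 - m b 0) ^ 2) * (∑ b, μ b * (y 1 - m b 1) ^ 2) -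
      (∑ b, μ b * ((y 0 - m b 0) * (y 1 - m b 1))) ^ 2 =
    κ ^ 2 * area m ^ 2 * (bary m 0 y * bary m 1 y * bary m 2 y * pw m y) /
      (dist y (m 0) * dist y (m 1) * dist y (m 2)) ^ 2 := by
  by_cases hA : area m = 0
  · have hb : ∀ b, bary m b y = 0 := fun b => by rw [bary, hA, div_zero]
    have : ∀ b, μ b = 0 := fun b => by rw [hμ, hb]; simp
    simp [this, hb]
  have h : ∀ b, dist y (m b) ≠ 0 := fun b => dist_ne_zero.2 fun e => hy ⟨b, e.symm⟩
  have h0 := h 0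
  have h1 := h 1
  have h2 := h 2
  have c0 : bary m 0 y * area m = (m 1 0 - y 0) * (m 2 1 - y 1) - (m 1 1 - y 1) * (m 2 0 - y 0) := by
    rw [bary, div_mul_cancel₀ _ hA]; simp [cr]
  have c1 : bary m 1 y * area m = (m 2 0 - y 0) * (m 0 1 - y 1) - (m 2 1 - y 1) * (m 0 0 - y 0) := by
    rw [bary, div_mul_cancel₀ _ hA]; simp [cr]
  have c2 : bary m 2 y * area m = (m 0 0 - y 0) * (m 1 1 - y 1) - (m 0 1 - y 1) * (m 1 0 - y 0) := by
    rw [bary, div_mul_cancel₀ _ hA]; simp [cr]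
  -- Cauchy-Binet: the determinant of ∑ μ_b u_b u_bᵀ is ∑ μ_b μ_c cr(u_b, u_c)², and these
  -- determinants are the barycentric coordinates times the area.
  have e : (∑ b, μ b * (y 0 - m b 0) ^ 2) * (∑ b, μ b * (y 1 - m b 1) ^ 2) -
      (∑ b, μ b * ((y 0 - m b 0) * (y 1 - m b 1))) ^ 2 =
      μ 1 * μ 2 * (bary m 0 y * area m) ^ 2 + μ 2 * μ 0 * (bary m 1 y * area m) ^ 2 +
        μ 0 * μ 1 * (bary m 2 y * area m) ^ 2 := by
    rw [c0, c1, c2]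
    simp only [Fin.sum_univ_three]
    ring
  rw [e, hμ, hμ, hμ, pw, Fin.sum_univ_three]
  generalize dist y (m 0) = t0 at *
  generalize dist y (m 1) = t1 at *
  generalize dist y (m 2) = t2 at *
  field_simp

include hm

/-- At a critical point the weights are proportional to `bary m b y * dist y (m b)`. -/
lemma exists_scale {w : Fin 3 → ℝ} (hw : w ≠ 0) {y : Plane} (hy : y ∉ Set.range m)
    (hmin : ∀ z, wdist m w y ≤ wdist m w z) :
    ∃ κ : ℝ, κ ≠ 0 ∧ ∀ b, w b = κ * (bary m b y * dist y (m b)) := by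
  have h : ∀ b, dist y (m b) ≠ 0 := fun b => dist_ne_zero.2 fun e => hy ⟨b, e.symm⟩
  have hu := bary_unique hm y (fun b => w b / dist y (m b)) fun e => by
    rw [← first_order hy hmin (EuclideanSpace.single e 1)]
    refine Finset.sum_congr rfl fun b _ => ?_
    have : dot (y - m b) (EuclideanSpace.single e 1) = y e - m b e := by
      fin_cases e <;> simp [dot]
    rw [this]; ring
  have hb : ∀ b, w b = (∑ b, w b / dist y (m b)) * (bary m b y * dist y (m b)) := fun b => by
    have := hu b
    rw [div_eq_iff (h b)] at this
    rw [← mul_assoc]; exact this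
  refine ⟨_, fun e => hw ?_, hb⟩
  ext b
  rw [hb, e, zero_mul]; rfl

lemma mem_posLocus_of_min {w : Fin 3 → ℝ} (hw : w ≠ 0) {y : Plane} (hy : y ∉ Set.range m)
    (hmin : ∀ z, wdist m w y ≤ wdist m w z) : y ∈ posLocus m := by
  obtain ⟨κ, hκ, hb⟩ := exists_scale hm hw hy hmin
  have h : ∀ b, 0 < dist y (m b) := fun b => dist_pos.2 fun e => hy ⟨b, e.symm⟩
  have hdet := hessian_det y hy κ (μ := fun b => w b / dist y (m b) ^ 3) fun b => by
    have := (h b).ne'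
    rw [hb]; field_simp
  -- The second derivative in the directions (s, 1) is a nonnegative quadratic polynomial in s; its
  -- discriminant is -4 times the Hessian determinant.
  have hd : discrim (∑ b, w b / dist y (m b) ^ 3 * (y 1 - m b 1) ^ 2)
      (-2 * ∑ b, w b / dist y (m b) ^ 3 * ((y 0 - m b 0) * (y 1 - m b 1)))
      (∑ b, w b / dist y (m b) ^ 3 * (y 0 - m b 0) ^ 2) ≤ 0 := by
    refine discrim_le_zero fun s => ?_
    have := second_order hy hmin !₂[s, 1]
    refine this.trans_eq ?_
    simp only [Fin.sum_univ_three, cr]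
    simp
    ring
  have hnn : 0 ≤ κ ^ 2 * area m ^ 2 * (bary m 0 y * bary m 1 y * bary m 2 y * pw m y) /
      (dist y (m 0) * dist y (m 1) * dist y (m 2)) ^ 2 := by
    rw [← hdet]
    rw [discrim] at hd
    nlinarith
  have h0 := h 0
  have h1 := h 1
  have h2 := h 2
  have hA := area_ne_zero hm
  by_contra hneg
  have hneg' := mul_neg_of_pos_of_neg (show 0 < κ ^ 2 * area m ^ 2 by positivity) (not_le.1 hneg)
  exact hnn.not_gt (div_neg_of_neg_of_pos hneg' (by positivity))

omit hm in
lemma wdist_scale {w : Fin 3 → ℝ} {y : Plane} {κ : ℝ}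
    (hb : ∀ b, w b = κ * (bary m b y * dist y (m b))) (z : Plane) :
    wdist m w z = κ * ∑ b, bary m b y * dist y (m b) * dist z (m b) := by
  rw [wdist, Finset.mul_sum]
  refine Finset.sum_congr rfl fun b _ => ?_
  rw [hb]; ring

omit hm in
lemma sum_bary_self (y : Plane) : ∑ b, bary m b y * dist y (m b) * dist y (m b) = pw m y := by
  rw [pw]; exact Finset.sum_congr rfl fun b _ => by ring

/-- The strict triangle inequality for the weights of a point of an outer region. -/
lemma sum_weights_pos {i j k : Fin 3} (hij : i ≠ j) (hik : i ≠ k) (hjk : j ≠ k) {y : Plane}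
    (hi : bary m i y < 0) (hj : 0 < bary m j y) (hk : 0 < bary m k y) :
    0 < ∑ b, bary m b y * dist y (m b) := by
  rw [sum_three hij hik hjk]
  have h0 := bary_vec m y 0
  have h1 := bary_vec m y 1
  rw [sum_three hij hik hjk] at h0 h1
  have hcr : cr (m j - y) (m k - y) ≠ 0 := by
    rw [← bary_mul_cr hm hij hik hjk]
    exact mul_ne_zero hi.ne (cr_sides_ne_zero hm hij hik hjk)
  have ei := dist_sq y (m i)
  have ej := dist_sq y (m j)
  have ek := dist_sq y (m k)
  simp only [cr, PiLp.sub_apply] at hcr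
  -- Strict Cauchy-Schwarz for y - m_j and y - m_k. Since -β_i (y - m_i) = β_j (y - m_j) + β_k (y -
  -- m_k), it amounts to the strict triangle inequality for these vectors.
  have hdot : |(y 0 - m j 0) * (y 0 - m k 0) + (y 1 - m j 1) * (y 1 - m k 1)| <
      dist y (m j) * dist y (m k) := by
    apply abs_lt_of_sq_lt_sq _ (by positivity)
    rw [mul_pow, ej, ek]
    nlinarith [pow_pos (abs_pos.2 hcr) 2, sq_abs ((m j 0 - y 0) * (m k 1 - y 1) -
      (m j 1 - y 1) * (m k 0 - y 0))]
  have hlt := (abs_lt.1 hdot).2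
  have key : (-bary m i y * dist y (m i)) ^ 2 <
      (bary m j y * dist y (m j) + bary m k y * dist y (m k)) ^ 2 := by
    have e : (-bary m i y * dist y (m i)) ^ 2 = (bary m j y * dist y (m j)) ^ 2 +
        (bary m k y * dist y (m k)) ^ 2 + 2 * (bary m j y * bary m k y) *
        ((y 0 - m j 0) * (y 0 - m k 0) + (y 1 - m j 1) * (y 1 - m k 1)) := by
      simp only [mul_pow, ei, ej, ek]
      linear_combination (bary m i y * (y 0 - m i 0) - bary m j y * (y 0 - m j 0)
        - bary m k y * (y 0 - m k 0)) * h0 + (bary m i y * (y 1 - m i 1)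
        - bary m j y * (y 1 - m j 1) - bary m k y * (y 1 - m k 1)) * h1
    rw [e]
    nlinarith [mul_lt_mul_of_pos_left hlt (mul_pos hj hk)]
  have := abs_lt_of_sq_lt_sq key (by positivity)
  have := (abs_lt.1 this).2
  linarith

omit hm in
lemma mem_halfLine {a b z : Plane} (hab : a ≠ b) (h : dist z b = dist z a + dist a b) :
    z ∈ halfLine a b := by
  have hw := dist_add_dist_eq_iff.1 h.symm
  obtain ⟨t, ⟨ht0, ht1⟩, ht⟩ := hw
  have h1 : t < 1 := lt_of_le_of_ne ht1 fun e => hab (by rw [← ht, e]; simp)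
  have h2 : 1 - t ≠ 0 := by linarith
  refine ⟨t / (1 - t), div_nonneg ht0 (by linarith), ?_⟩
  rw [AffineMap.lineMap_apply, vsub_eq_sub, vadd_eq_add] at ht
  have e0 := congrArg (fun v : Plane => v 0) ht
  have e1 := congrArg (fun v : Plane => v 1) ht
  simp at e0 e1
  refine plane_ext ?_ ?_
  · simp; field_simp; linarith
  · simp; field_simp; linarith

omit hm in
lemma mem_of_argmin {w : Fin 3 → ℝ} {M : ℝ} {q : TSpace} {C : Set TSpace} (hC : Convex ℝ C)
    (hq : q ∈ convexHull ℝ (rangeMap m '' {z | wdist m w z = M}))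
    (h : ∀ z, wdist m w z = M → rangeMap m z ∈ C) : q ∈ C :=
  convexHull_min (by rintro _ ⟨z, hz, rfl⟩; exact h z hz) hC hq

lemma dist_of_bary_eq_zero {i j k : Fin 3} (hij : i ≠ j) (hik : i ≠ k) (hjk : j ≠ k) {y : Plane}
    (h : bary m i y = 0) : dist y (m j) = |bary m k y| * dist (m j) (m k) := by
  have hs := bary_sum hm y
  have hc := eq_combo hm y
  rw [sum_three hij hik hjk, h] at hs hc
  have : y - m j = bary m k y • (m k - m j) := by
    conv_lhs => rw [hc]
    rw [show bary m j y = 1 - bary m k y by linarith]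
    module
  rw [dist_eq_norm, this, norm_smul, Real.norm_eq_abs, ← dist_eq_norm, dist_comm]

/-- If β_i = 0, then w_i = 0 and the minimizers solve an equality case of the triangle inequality
for the other two receivers, which gives a side or a half-line. If no β_b vanishes, y is the unique
minimizer unless it is on the circle, where every minimizer satisfies Ptolemy's equality. -/
lemma onPieces_of_critical {w : Fin 3 → ℝ} (hw : w ≠ 0) (hs : 0 ≤ ∑ b, w b) {q : TSpace} {c : ℝ}
    (hc : 0 ≤ c) (hcw : c * ∑ b, w b = 0) {y : Plane} (hy : y ∉ Set.range m)
    (hmin : ∀ z, wdist m w y ≤ wdist m w z)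
    (hq : q ∈ convexHull ℝ (rangeMap m '' {z | wdist m w z = wdist m w y})) :
    OnPieces m (q + c • one) := by
  obtain ⟨κ, hκ, hb⟩ := exists_scale hm hw hy hmin
  have hpos := mem_posLocus_of_min hm hw hy hmin
  have hT : ∀ b, 0 < dist y (m b) := fun b => dist_pos.2 fun e => hy ⟨b, e.symm⟩
  have hsum : ∑ b, w b = κ * ∑ b, bary m b y * dist y (m b) := by
    rw [Finset.mul_sum]; exact Finset.sum_congr rfl fun b _ => hb b
  -- A positive total weight rules out any displacement along `one` and fixes the sign of κ.
  have hscale : 0 < ∑ b, bary m b y * dist y (m b) → 0 < κ ∧ c = 0 := fun h => by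
    have h1 : 0 < κ := by
      refine lt_of_le_of_ne ?_ hκ.symm
      rw [hsum] at hs
      exact nonneg_of_mul_nonneg_left hs h
    rw [hsum] at hcw
    exact ⟨h1, (mul_eq_zero.1 hcw).resolve_right (mul_pos h1 h).ne'⟩
  have hunique : c = 0 → (∀ z, wdist m w z = wdist m w y → z = y) → OnPieces m (q + c • one) := by
    rintro rfl h
    have : q ∈ ({rangeMap m y} : Set TSpace) := mem_of_argmin (convex_singleton _) hq
      fun z hz => by rw [h z hz]; rfl
    rw [zero_smul, add_zero, this]
    exact Or.inl ⟨y, hpos, rfl⟩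
  have hval : 0 < κ → ∀ z, wdist m w z = wdist m w y →
      ∑ b, bary m b y * dist y (m b) * dist z (m b) = pw m y := fun h z hz => by
    rw [wdist_scale hb, wdist_scale hb, sum_bary_self] at hz
    exact mul_left_cancel₀ h.ne' hz
  by_cases hzero : ∃ i, bary m i y = 0
  · obtain ⟨i, hi⟩ := hzero
    obtain ⟨j, k, hij, hik, hjk⟩ := exists_others i
    have hd := receivers_dist_pos hm hjk
    have hsb := bary_sum hm y
    rw [sum_three hij hik hjk, hi, zero_add] at hsb
    have hTj := dist_of_bary_eq_zero hm hij hik hjk hi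
    have hTk := dist_of_bary_eq_zero hm hik hij hjk.symm hi
    rw [dist_comm (m k)] at hTk
    have hj0 : bary m j y ≠ 0 := fun e => by
      rw [e, abs_zero, zero_mul] at hTk; exact (hT k).ne' hTk
    have hk0 : bary m k y ≠ 0 := fun e => by
      rw [e, abs_zero, zero_mul] at hTj; exact (hT j).ne' hTj
    have hwi : w i = 0 := by rw [hb, hi]; ring
    have hwd : ∀ z, wdist m w z = w j * dist z (m j) + w k * dist z (m k) := fun z => by
      rw [wdist, sum_three hij hik hjk, hwi]; ring
    have hws : ∑ b, w b = w j + w k := by rw [sum_three hij hik hjk, hwi]; ring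
    have ray : ∀ j k : Fin 3, i ≠ j → i ≠ k → j ≠ k → bary m j y < 0 → 0 < bary m k y →
        (∀ z, wdist m w z = w j * dist z (m j) + w k * dist z (m k)) →
        bary m j y + bary m k y = 1 → dist y (m j) = |bary m k y| * dist (m j) (m k) →
        dist y (m k) = |bary m j y| * dist (m j) (m k) → OnPieces m (q + c • one) := by
      intro j k hij hik hjk hj hk hwd hsb hTj hTk
      have hd := receivers_dist_pos hm hjk
      rw [abs_of_pos hk] at hTj
      rw [abs_of_neg hj] at hTk
      obtain ⟨ω, hω⟩ : ∃ ω, ω = κ * (bary m k y * -bary m j y * dist (m j) (m k)) := ⟨_, rfl⟩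
      have hwj : w j = -ω := by rw [hb, hω, hTj]; ring
      have hwk : w k = ω := by rw [hb, hω, hTk]; ring
      have hP : 0 < bary m k y * -bary m j y * dist (m j) (m k) :=
        mul_pos (mul_pos hk (by linarith)) hd
      have hy1 : dist y (m j) - dist y (m k) = dist (m j) (m k) := by
        rw [hTj, hTk]; linear_combination dist (m j) (m k) * hsb
      -- For negative ω the value at m_j would be smaller than the value at y.
      have hω0 : 0 < ω := by
        by_contra! hle
        have hlt : ω < 0 := lt_of_le_of_ne hle (by rw [hω]; exact mul_ne_zero hκ hP.ne')
        have := hmin (m j)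
        rw [hwd, hwd, hwj, hwk, dist_self] at this
        nlinarith
      refine Or.inr ⟨i, k, j, hik, hij, hjk.symm, Or.inr (Or.inr ?_)⟩
      -- Here the weights are opposite and c may be positive; the displacement is absorbed because
      -- `regionL` is stable under adding multiples of `one`.
      refine add_mem_regionL hm hjk.symm (mem_of_argmin (convex_regionL m _ _ _) hq fun z hz => ?_) hc
      refine (halfLine_mem_regionL hm hjk.symm i (mem_halfLine (receivers_ne hm hjk.symm) ?_)).1
      rw [hwd, hwd, hwj, hwk] at hz
      rw [dist_comm (m k)]
      have : ω * (dist z (m j) - dist z (m k)) = ω * (dist (m j) (m k)) := by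
        rw [← hy1]; linarith
      have := mul_left_cancel₀ hω0.ne' this
      linarith
    rcases hj0.lt_or_gt with hj | hj
    · exact ray j k hij hik hjk hj (by linarith) hwd hsb hTj hTk
    rcases hk0.lt_or_gt with hk | hk
    · refine ray k j hik hij hjk.symm hk hj (fun z => by rw [hwd, add_comm]) (by linarith) ?_ ?_
      · rw [dist_comm (m k)]; exact hTk
      · rw [dist_comm (m k)]; exact hTj
    · rw [abs_of_pos hk] at hTj
      rw [abs_of_pos hj] at hTk
      obtain ⟨ω, hω⟩ : ∃ ω, ω = κ * (bary m k y * bary m j y * dist (m j) (m k)) := ⟨_, rfl⟩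
      have hwj : w j = ω := by rw [hb, hω, hTj]; ring
      have hwk : w k = ω := by rw [hb, hω, hTk]; ring
      have hω0 : 0 < ω := by
        refine lt_of_le_of_ne (by rw [hws, hwj, hwk] at hs; linarith) (Ne.symm ?_)
        rw [hω]; exact mul_ne_zero hκ (mul_pos (mul_pos hk hj) hd).ne'
      have hc0 : c = 0 := by
        rw [hws, hwj, hwk] at hcw
        exact (mul_eq_zero.1 hcw).resolve_right (by linarith)
      refine Or.inr ⟨i, j, k, hij, hik, hjk, Or.inr (Or.inl ?_)⟩
      rw [hc0, zero_smul, add_zero]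
      refine mem_of_argmin (convex_regionG m _ _ _) hq fun z hz => ?_
      refine (segment_mem_regionG hm hjk i ?_).1
      rw [mem_segment_iff_wbtw, ← dist_add_dist_eq_iff]
      rw [hwd, hwd, hwj, hwk, hTj, hTk] at hz
      have h3 : ω * (dist (m j) z + dist z (m k)) = ω * dist (m j) (m k) := by
        rw [dist_comm (m j) z]
        linear_combination hz + ω * dist (m j) (m k) * hsb
      exact mul_left_cancel₀ hω0.ne' h3
  push Not at hzero
  rw [posLocus_eq hm] at hpos
  rcases hpos with ht | hr
  · have hlt : ∀ b, 0 < bary m b y := fun b => lt_of_le_of_ne (ht b) (hzero b).symm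
    obtain ⟨hκ0, hc0⟩ := hscale (Finset.sum_pos (fun b _ => mul_pos (hlt b) (hT b)) ⟨0, by simp⟩)
    exact hunique hc0 fun z hz => eq_of_tri hm hlt (hval hκ0 z hz).le
  · obtain ⟨i, hr⟩ := Set.mem_iUnion.1 hr
    obtain ⟨j, k, hij, hik, hjk⟩ := exists_others i
    have hi := lt_of_le_of_ne hr.1 (hzero i)
    have hlt : ∀ b, b ≠ i → 0 < bary m b y := fun b hbi =>
      lt_of_le_of_ne (hr.2.1 b hbi) (hzero b).symm
    obtain ⟨hκ0, hc0⟩ := hscale (sum_weights_pos hm hij hik hjk hi (hlt j hij.symm)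
      (hlt k hik.symm))
    rcases hr.2.2.lt_or_eq with hp | hp
    · exact hunique hc0 fun z hz => eq_of_reg hm hi hlt hp (hval hκ0 z hz).le
    · refine Or.inr ⟨i, j, k, hij, hik, hjk, Or.inl ?_⟩
      rw [hc0, zero_smul, add_zero]
      refine mem_of_argmin (convex_regionF hm hij hik hjk) hq fun z hz => rangeMap_mem_regionF ?_
      have h1 := weights_of_arc hij hik hjk hr hp
      have h2 := weights_of_arc hik hij hjk.symm hr hp
      rw [dist_comm (m k) (m j)] at h2
      have h3 := hval hκ0 z hz
      rw [hp, sum_three hij hik hjk] at h3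
      have hne : bary m i y * dist y (m i) ≠ 0 := mul_ne_zero hi.ne (hT i).ne'
      apply mul_left_cancel₀ hne
      linear_combination dist (m j) (m k) * h3 - dist z (m j) * h1 - dist z (m k) * h2

/-- Move from m_i directly away from m_k. The distances from m_i and m_k both grow at full rate and
that from m_j strictly slower; as w_i + w_k = -w_j, the derivative is a negative multiple of w_j. -/
lemma weight_nonpos {w : Fin 3 → ℝ} {i j k : Fin 3} (hij : i ≠ j) (hik : i ≠ k) (hjk : j ≠ k)
    (hs : ∑ b, w b = 0) (hmin : ∀ z, wdist m w (m i) ≤ wdist m w z) : w j ≤ 0 := by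
  have h := first_order_receiver hm hij hik hjk hmin (m i - m k)
  have hdj := receivers_dist_pos hm hij
  have hdk := receivers_dist_pos hm hik
  have hlt := (abs_lt.1 (abs_sideInner_lt hm hij hik hjk)).2
  rw [sum_three hij hik hjk] at hs
  have e1 : dot (m i - m j) (m i - m k) = sideInner m i j k := by
    simp [dot, sideInner]; ring
  have e2 : dot (m i - m k) (m i - m k) = dist (m i) (m k) ^ 2 := by
    rw [dist_sq]; simp [dot]; ring
  rw [e1, e2, ← dist_eq_norm, sq, mul_div_assoc, div_self hdk.ne', mul_one] at h
  by_contra! hj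
  have h2 : sideInner m i j k / dist (m i) (m j) < dist (m i) (m k) := by
    rw [div_lt_iff₀ hdj]; linarith
  have h3 := mul_lt_mul_of_pos_left h2 hj
  have h4 : w i = -(w j + w k) := by linarith
  rw [h4] at h
  nlinarith

/-- A single minimizer gives a point of an unbounded edge. Two give a bounded edge, where c > 0
would force all weights to vanish by `weight_nonpos`. Three are impossible: the weights would be
nonnegative, the function convex, and a midpoint of a side another minimizer. -/
lemma onPieces_of_receivers {w : Fin 3 → ℝ} (hw : w ≠ 0) {q : TSpace} {c M : ℝ}
    (hc : 0 ≤ c) (hcw : c * ∑ b, w b = 0) (hmin : ∀ z, M ≤ wdist m w z)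
    (hrec : ∀ z, wdist m w z = M → z ∈ Set.range m)
    (hq : q ∈ convexHull ℝ (rangeMap m '' {z | wdist m w z = M})) :
    OnPieces m (q + c • one) := by
  obtain ⟨_, ⟨z, hz, -⟩⟩ := convexHull_nonempty_iff.1 ⟨q, hq⟩
  obtain ⟨a, rfl⟩ := hrec z hz
  by_cases hone : ∀ b, b ≠ a → wdist m w (m b) ≠ M
  · obtain ⟨b, e, hab, hae, hbe⟩ := exists_others a
    have : q ∈ ({rangeMap m (m a)} : Set TSpace) := mem_of_argmin (convex_singleton _) hq
      fun z hz => by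
        obtain ⟨b, rfl⟩ := hrec z hz
        by_cases hb : b = a
        · rw [hb]; rfl
        · exact absurd hz (hone b hb)
    rw [Set.mem_singleton_iff] at this
    refine Or.inr ⟨e, a, b, hae.symm, hbe.symm, hab, Or.inr (Or.inr ?_)⟩
    exact unboundedEdge_subset_regionL hm hab e ((mem_unboundedEdge_iff m a _).2 ⟨c, hc, by rw [this]⟩)
  push Not at hone
  obtain ⟨b, hba, hb⟩ := hone
  obtain ⟨e, hbe, hae⟩ := exists_third hba
  have hwa := weight_nonneg_of_receiver hm (w := w) (i := a) fun z => by
    have : wdist m w (m a) = M := hz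
    rw [this]; exact hmin z
  have hwb := weight_nonneg_of_receiver hm (w := w) (i := b) fun z => by rw [hb]; exact hmin z
  by_cases hem : wdist m w (m e) = M
  · exfalso
    have hwe := weight_nonneg_of_receiver hm (w := w) (i := e) fun z => by rw [hem]; exact hmin z
    obtain ⟨x, hx⟩ : ∃ x, x = midpoint ℝ (m a) (m b) := ⟨_, rfl⟩
    have hwn : ∀ d, 0 ≤ w d := fun d => by
      rcases forall_three hba.symm hae hbe d with rfl | rfl | rfl <;> assumption
    have hle : wdist m w x ≤ M := by
      have hsum : wdist m w x ≤ (wdist m w (m a) + wdist m w (m b)) / 2 := by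
        rw [wdist, wdist, wdist, ← Finset.sum_add_distrib, Finset.sum_div]
        refine Finset.sum_le_sum fun d _ => ?_
        have : dist x (m d) ≤ (dist (m a) (m d) + dist (m b) (m d)) / 2 := by
          have := dist_midpoint_midpoint_le (m a) (m b) (m d) (m d)
          rwa [midpoint_self, ← hx] at this
        have := mul_le_mul_of_nonneg_left this (hwn d)
        linarith
      have : wdist m w (m a) = M := hz
      linarith
    obtain ⟨d, hd⟩ := hrec x (le_antisymm hle (hmin x))
    have hbar : ∀ d, bary m d x = if d = e then 0 else 1 / 2 := fun d => by
      refine bary_eq_of_combo hm (l := fun d => if d = e then 0 else 1 / 2) ?_ ?_ d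
      · rw [sum_three hba.symm hae hbe]; simp [hae, hbe]; norm_num
      · rw [sum_three hba.symm hae hbe, hx, midpoint_eq_smul_add]; simp [hae, hbe]
    have h1 := hbar d
    rw [← hd, bary_self hm] at h1
    split_ifs at h1 <;> norm_num at h1
  · have hseg : q ∈ segment ℝ (rangeMap m (m a)) (rangeMap m (m b)) :=
      mem_of_argmin (convex_segment _ _) hq fun z hz => by
        obtain ⟨d, rfl⟩ := hrec z hz
        rcases forall_three hba.symm hae hbe d with rfl | rfl | rfl
        · exact left_mem_segment ℝ _ _
        · exact right_mem_segment ℝ _ _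
        · exact absurd hz hem
    rcases hc.eq_or_lt with h | h
    · rw [← h, zero_smul, add_zero]
      refine Or.inr ⟨e, a, b, hae.symm, hbe.symm, hba.symm, Or.inr (Or.inl ?_)⟩
      exact (convex_regionG m _ _ _).segment_subset
        (segment_mem_regionG hm hba.symm e (left_mem_segment ℝ _ _)).1
        (segment_mem_regionG hm hba.symm e (right_mem_segment ℝ _ _)).1 hseg
    · exfalso
      have hs := (mul_eq_zero.1 hcw).resolve_left h.ne'
      have h1 := weight_nonpos hm hba.symm hae hbe hs fun z => by
        have : wdist m w (m a) = M := hz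
        rw [this]; exact hmin z
      have h2 := weight_nonpos hm hba hbe hae hs fun z => by rw [hb]; exact hmin z
      rw [sum_three hba.symm hae hbe] at hs
      apply hw
      ext d
      rcases forall_three hba.symm hae hbe d with rfl | rfl | rfl <;> simp <;> linarith

lemma onPieces_of_mem_frontier {p : TSpace} (hp : p ∈ frontier (hull m)) : OnPieces m p := by
  obtain ⟨w, hw, hs, M, q, c, hc, hcw, rfl, hmin, hq⟩ := exists_face hm hp
  by_cases h : ∃ y, wdist m w y = M ∧ y ∉ Set.range m
  · obtain ⟨y, rfl, hy⟩ := h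
    exact onPieces_of_critical hm hw hs hc hcw hy hmin hq
  · push Not at h
    exact onPieces_of_receivers hm hw hc hcw hmin h hq

/-- At a receiver the corresponding coordinate function supports the hull; elsewhere the weights β_b
|y - m_b| do. -/
lemma rangeMap_mem_frontier {y : Plane} (hy : y ∈ posLocus m) :
    rangeMap m y ∈ frontier (hull m) := by
  by_cases hr : y ∈ Set.range m
  · obtain ⟨a, rfl⟩ := hr
    obtain ⟨j, k, hij, hik, hjk⟩ := exists_others a
    refine mem_frontier_of_support (subset_closure (rangeMap_mem_hull m _)) (w := wt a j 1 0 0)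
      (wt_ne_zero one_ne_zero) fun z => ?_
    rw [lin_wt hij hik hjk, wdist_wt hij hik hjk]
    simp [rangeMap]
  have hT : ∀ b, dist y (m b) ≠ 0 := fun b => dist_ne_zero.2 fun e => hr ⟨b, e.symm⟩
  refine mem_frontier_of_support (subset_closure (rangeMap_mem_hull m _))
    (w := fun b => bary m b y * dist y (m b)) ?_ fun z => ?_
  · intro h
    have hs := bary_sum hm y
    rw [Finset.sum_eq_zero fun b _ => (mul_eq_zero.1 (congrFun h b)).resolve_right (hT b)] at hs
    exact zero_ne_one hs
  · have e : lin (fun b => bary m b y * dist y (m b)) (rangeMap m y) = pw m y := sum_bary_self y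
    rw [e]
    rw [posLocus_eq hm] at hy
    rcases hy with h | h
    · exact pw_le_of_tri h z
    · obtain ⟨i, hi⟩ := Set.mem_iUnion.1 h
      exact pw_le_of_reg hi z

lemma mem_frontier_iff (p : TSpace) : p ∈ frontier (hull m) ↔ OnPieces m p := by
  refine ⟨onPieces_of_mem_frontier hm, ?_⟩
  rintro (⟨y, hy, rfl⟩ | ⟨i, j, k, hij, hik, hjk, h | h | h⟩)
  · exact rangeMap_mem_frontier hm hy
  · exact regionF_subset_frontier hm hij hik hjk h
  · exact regionG_subset_frontier hm hij hik hjk h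
  · exact regionL_subset_frontier hm hjk hij.symm hik.symm h

lemma onPieces_iff (p : TSpace) : OnPieces m p ↔ p ∈ rangeMap m '' posLocus m ∪
    (⋃ i, pieceF m i) ∪ (⋃ i, pieceG m i) ∪
      ⋃ i, (pieceL m (jj i) (kk i) ∪ pieceL m (kk i) (jj i)) := by
  have hL1 : ∀ i, pieceL m (jj i) (kk i) = regionL m (jj i) (kk i) i := fun i =>
    pieceL_eq hm (jj_ne_kk i) (jj_ne i).symm (kk_ne i).symm
  have hL2 : ∀ i, pieceL m (kk i) (jj i) = regionL m (kk i) (jj i) i := fun i =>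
    pieceL_eq hm (jj_ne_kk i).symm (kk_ne i).symm (jj_ne i).symm
  simp only [pieceF_eq hm, pieceG_eq hm, hL1, hL2, Set.mem_union, Set.mem_iUnion]
  have hor : ∀ i j k : Fin 3, i ≠ j → i ≠ k → j ≠ k → (j = jj i ∧ k = kk i) ∨
      (j = kk i ∧ k = jj i) := by decide
  constructor
  · rintro (h | ⟨i, j, k, hij, hik, hjk, h⟩)
    · exact Or.inl (Or.inl (Or.inl h))
    · rcases hor i j k hij hik hjk with ⟨rfl, rfl⟩ | ⟨rfl, rfl⟩
      · rcases h with h | h | h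
        · exact Or.inl (Or.inl (Or.inr ⟨i, h⟩))
        · exact Or.inl (Or.inr ⟨i, h⟩)
        · exact Or.inr ⟨i, Or.inl h⟩
      · rcases h with h | h | h
        · exact Or.inl (Or.inl (Or.inr ⟨i, regionF_symm m i _ _ ▸ h⟩))
        · exact Or.inl (Or.inr ⟨i, regionG_symm hm hjk i h⟩)
        · exact Or.inr ⟨i, Or.inr h⟩
  · rintro (((h | ⟨i, h⟩) | ⟨i, h⟩) | ⟨i, h | h⟩)
    · exact Or.inl h
    · exact Or.inr ⟨i, jj i, kk i, jj_ne i, kk_ne i, jj_ne_kk i, Or.inl h⟩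
    · exact Or.inr ⟨i, jj i, kk i, jj_ne i, kk_ne i, jj_ne_kk i, Or.inr (Or.inl h)⟩
    · exact Or.inr ⟨i, jj i, kk i, jj_ne i, kk_ne i, jj_ne_kk i, Or.inr (Or.inr h)⟩
    · exact Or.inr ⟨i, kk i, jj i, kk_ne i, jj_ne i, (jj_ne_kk i).symm, Or.inr (Or.inr h)⟩

/-- The hull lacks exactly the unbounded edges without their end points. -/
lemma hull_eq_closure_diff : hull m = closure (hull m) \
    ⋃ a, (unboundedEdge m a \ {rangeMap m (m a)}) := by
  apply Set.Subset.antisymm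
  · refine fun p hp => ⟨subset_closure hp, fun h => ?_⟩
    obtain ⟨a, ha, hne⟩ := Set.mem_iUnion.1 h
    apply hne
    obtain ⟨b, c, hab, hac, hbc⟩ := exists_others a
    have h1 := ha.2 b hab.symm
    have h2 := ha.2 c hac.symm
    -- The functional 2 p_a - p_b - p_c is minimal along the edge. A point of the plane where it
    -- attains its minimum lies on both half-lines from m_a pointing away from m_b and from m_c,
    -- hence is m_a.
    have hface := (mem_convexHull_face (lin (wt a b 2 (-1) (-1)))
      (M := -dist (m a) (m b) - dist (m a) (m c)) (S := Set.range (rangeMap m)) (by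
        rintro _ ⟨z, rfl⟩
        rw [lin_rangeMap, wdist_wt hab hac hbc]
        have := dist_triangle z (m a) (m b)
        have := dist_triangle z (m a) (m c)
        linarith) hp).2 (by rw [lin_wt hab hac hbc]; linarith)
    refine convexHull_min ?_ (convex_singleton (rangeMap m (m a))) hface
    rintro _ ⟨⟨z, rfl⟩, hz⟩
    rw [lin_rangeMap, wdist_wt hab hac hbc] at hz
    have t1 := dist_triangle z (m a) (m b)
    have t2 := dist_triangle z (m a) (m c)
    have l1 := mem_halfLine (receivers_ne hm hab) (show dist z (m b) = _ by linarith)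
    have l2 := mem_halfLine (receivers_ne hm hac) (show dist z (m c) = _ by linarith)
    obtain ⟨s, hs, e1⟩ := l1
    obtain ⟨t, ht, e2⟩ := l2
    have hbar : bary m b z = -s := by
      refine (bary_eq_of_combo hm (l := wt a b (1 + s) (-s) 0) ?_ ?_ b).trans (by
        simp [wt, hab.symm])
      · rw [sum_three hab hac hbc]; simp [wt, hab.symm, hac.symm, hbc.symm]
      · rw [sum_three hab hac hbc, e1]; simp [wt, hab.symm, hac.symm, hbc.symm]; module
    have hbar2 : bary m b z = 0 := by
      refine (bary_eq_of_combo hm (l := wt a b (1 + t) 0 (-t)) ?_ ?_ b).trans (by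
        simp [wt, hab.symm])
      · rw [sum_three hab hac hbc]; simp [wt, hab.symm, hac.symm, hbc.symm]
      · rw [sum_three hab hac hbc, e2]; simp [wt, hab.symm, hac.symm, hbc.symm]; module
    have : s = 0 := by linarith
    rw [this, zero_smul, add_zero] at e1
    rw [e1]; rfl
  · rintro p ⟨hp, hn⟩
    by_cases hi : p ∈ interior (hull m)
    · exact interior_subset hi
    rcases onPieces_of_mem_frontier hm ⟨hp, hi⟩ with ⟨y, hy, rfl⟩ | ⟨i, j, k, hij, hik, hjk, h | h | h⟩
    · exact rangeMap_mem_hull m y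
    · exact regionF_subset_hull hm hij hik hjk h
    · exact regionG_subset_hull hm hij hik hjk h
    · rcases regionL_subset hm hjk hij.symm hik.symm h with h | h
      · exact h
      · by_cases he : p = rangeMap m (m j)
        · rw [he]; exact rangeMap_mem_hull m _
        · exact (hn (Set.mem_iUnion.2 ⟨j, ⟨h, he⟩⟩)).elim

lemma enclosedRegion_frontier :
    enclosedRegion Set.univ (polyhedron m) (frontier (hull m)) = closure (hull m) := by
  refine enclosedRegion_eq (m := m) (U := interior (hull m)) (fun _ _ _ _ _ _ => trivial)
    (convex_hull m).closure isClosed_closure (Set.subset_univ _) (closure_hull_subset_polyhedron m)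
    subset_rfl frontier_subset_closure isOpen_interior (fun p _ => ?_)
    (subset_closure (rangeMap_mem_hull m (m 0))) (subset_closure (rangeMap_mem_hull m (m 1)))
    (rangeMap_sub_ne hm (by decide))
  rw [frontier, Set.mem_sdiff]
  constructor
  · exact fun h => ⟨subset_closure (interior_subset h), fun h2 => h2.2 h⟩
  · rintro ⟨h1, h2⟩
    by_contra h3
    exact h2 ⟨h1, h3⟩

end

end

/-! ### The Gaussian curvature of the image -/

section

lemma fderiv_apply_of_line {f : Plane → TSpace} {x v : Plane} (hf : DifferentiableAt ℝ f x) (b : Fin 3)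
    {c : ℝ} (h : HasDerivAt (fun t : ℝ => f (x + t • v) b) c 0) : fderiv ℝ f x v b = c := by
  have h1 : HasDerivAt (fun t : ℝ => f (x + t • v)) (fderiv ℝ f x v) 0 := by
    have h2 := hf.hasFDerivAt.hasLineDerivAt v
    exact h2
  have h3 := (EuclideanSpace.proj (𝕜 := ℝ) b).hasFDerivAt.comp_hasDerivAt (0 : ℝ) h1
  exact h3.unique h

lemma contDiffAt_rangeMap {m : Fin 3 → Plane} {x : Plane} (hx : x ∉ Set.range m) {n : WithTop ℕ∞} :
    ContDiffAt ℝ n (rangeMap m) x := by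
  rw [contDiffAt_euclidean]
  intro b
  exact contDiffAt_id.dist ℝ contDiffAt_const fun h => hx ⟨b, h.symm⟩

lemma dot_single (e : Plane) (i : Fin 2) : dot e (EuclideanSpace.single i 1) = e i := by
  fin_cases i <;> simp [dot]

lemma partialD_rangeMap {m : Fin 3 → Plane} {x : Plane} (hx : x ∉ Set.range m) (i : Fin 2) (b : Fin 3) :
    partialD (rangeMap m) i x b = (x i - m b i) / dist x (m b) := by
  refine fderiv_apply_of_line ((contDiffAt_rangeMap hx (n := 1)).differentiableAt one_ne_zero) b ?_
  have hb : x + (0 : ℝ) • (EuclideanSpace.single i 1 : Plane) ≠ m b := by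
    rw [zero_smul, add_zero]; exact fun h => hx ⟨b, h.symm⟩
  have := hasDerivAt_dist hb
  rw [dot_single, zero_smul, add_zero] at this
  exact this

lemma partialD2_rangeMap {m : Fin 3 → Plane} {x : Plane} (hx : x ∉ Set.range m) (i j : Fin 2) (b : Fin 3) :
    partialD2 (rangeMap m) i j x b = ((if i = j then 1 else 0) * dist x (m b) ^ 2
      - (x i - m b i) * (x j - m b j)) / dist x (m b) ^ 3 := by
  refine fderiv_apply_of_line ?_ b ?_
  · have h := (contDiffAt_rangeMap hx (n := 2)).fderiv_right (m := 1) (by norm_num)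
    exact (h.differentiableAt one_ne_zero).clm_apply (differentiableAt_const _)
  · have := hasDerivAt_dot_div (v := EuclideanSpace.single j 1) (EuclideanSpace.single i 1)
      (fun h : x = m b => hx ⟨b, h.symm⟩)
    simp only [dot_single] at this
    have h2 := (eventually_nonreceiver hx).filter_mono
      (tendsto_line x (EuclideanSpace.single j 1)) 
    refine HasDerivAt.congr_of_eventuallyEq (f := fun s : ℝ => (x + s • EuclideanSpace.single j (1:ℝ) - m b : Plane) i /
      dist (x + s • EuclideanSpace.single j (1:ℝ)) (m b)) ?_ ?_
    · refine HasDerivAt.congr_deriv this ?_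
      simp
    · filter_upwards [Filter.mem_map.1 h2] with s hs
      exact partialD_rangeMap hs i b

/-- Lagrange's identity for the cross product. -/
lemma firstForm_det (m : Fin 3 → Plane) (x : Plane) : firstForm (rangeMap m) 0 0 x * firstForm (rangeMap m) 1 1 x
    - firstForm (rangeMap m) 0 1 x ^ 2 = ‖normalVec (rangeMap m) x‖ ^ 2 := by
  rw [EuclideanSpace.norm_sq_eq]
  simp only [firstForm, PiLp.inner_apply, Fin.sum_univ_three, normalVec, Real.norm_eq_abs, sq_abs,
    cross_apply]
  simp
  ring

section
variable {m : Fin 3 → Plane} (hm : ¬ Collinear ℝ (Set.range m)) {x : Plane} (hx : x ∉ Set.range m)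
include hm hx

/-- The normal is proportional to the critical weights β_b |x - m_b|, which links curvature to the
second order condition. -/
lemma normalVec_apply (b : Fin 3) : normalVec (rangeMap m) x b = area m * bary m b x * dist x (m b) /
    (dist x (m 0) * dist x (m 1) * dist x (m 2)) := by
  have hT : ∀ b, dist x (m b) ≠ 0 := fun b => dist_ne_zero.2 fun h => hx ⟨b, h.symm⟩
  have h0 := hT 0
  have h1 := hT 1
  have h2 := hT 2
  have hA := area_ne_zero hm
  have key : area m * bary m b x = cr (m (b + 1) - x) (m (b + 2) - x) := mul_div_cancel₀ _ hA
  rw [key]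
  simp only [normalVec, crossProduct, LinearMap.mk₂_apply, partialD_rangeMap hx]
  fin_cases b
  · simp [cr]; field_simp; ring
  · simp [cr]; field_simp; ring
  · simp [cr]; field_simp; ring

lemma normalVec_ne_zero : normalVec (rangeMap m) x ≠ 0 := by
  intro h
  have hT : ∀ b, dist x (m b) ≠ 0 := fun b => dist_ne_zero.2 fun h => hx ⟨b, h.symm⟩
  have hs := bary_sum hm x
  have : ∀ b, bary m b x = 0 := by
    intro b
    have h1 := normalVec_apply hm hx b
    rw [h] at h1
    simpa [hT, area_ne_zero hm] using h1.symm
  simp [this] at hs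

/-- The second fundamental form is the sum of the Hessians of the distances weighted by the unit
normal. Each Hessian is (|u|² I - u uᵀ)/|u|³ with u = x - m_b, which has rank one, so `hessian_det`
applies with κ = area / P and the curvature is a positive multiple of β₀β₁β₂ · pw. -/
lemma gaussCurvature_nonneg_iff : 0 ≤ gaussCurvature (rangeMap m) x ↔ x ∈ posLocus m := by
  have hT : ∀ b, dist x (m b) ≠ 0 := fun b => dist_ne_zero.2 fun h => hx ⟨b, h.symm⟩
  have hA := area_ne_zero hm
  set N := ‖normalVec (rangeMap m) x‖ with hN
  have hN0 : 0 < N := norm_pos_iff.2 (normalVec_ne_zero hm hx)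
  set P := dist x (m 0) * dist x (m 1) * dist x (m 2) with hP
  have hP0 : P ≠ 0 := mul_ne_zero (mul_ne_zero (hT 0) (hT 1)) (hT 2)
  have hμ : ∀ b, normalVec (rangeMap m) x b / dist x (m b) ^ 3 =
      area m / P * bary m b x / dist x (m b) ^ 2 := by
    intro b
    have := hT b
    rw [normalVec_apply hm hx, ← hP]
    field_simp
  have hsf : ∀ i j, secondForm (rangeMap m) i j x = N⁻¹ * ∑ b, normalVec (rangeMap m) x b /
      dist x (m b) ^ 3 * ((if i = j then 1 else 0) * dist x (m b) ^ 2
      - (x i - m b i) * (x j - m b j)) := by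
    intro i j
    rw [secondForm, unitNormal, inner_smul_right, PiLp.inner_apply, ← hN]
    congr 1
    refine Finset.sum_congr rfl fun b _ => ?_
    rw [partialD2_rangeMap hx]
    simp
    ring
  have hdet := hessian_det x hx (area m / P) hμ
  rw [← hP] at hdet
  have h00 : secondForm (rangeMap m) 0 0 x = N⁻¹ * ∑ b, normalVec (rangeMap m) x b /
      dist x (m b) ^ 3 * (x 1 - m b 1) ^ 2 := by
    rw [hsf]; congr 1
    refine Finset.sum_congr rfl fun b _ => ?_
    rw [dist_sq, if_pos rfl]; ring
  have h11 : secondForm (rangeMap m) 1 1 x = N⁻¹ * ∑ b, normalVec (rangeMap m) x b /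
      dist x (m b) ^ 3 * (x 0 - m b 0) ^ 2 := by
    rw [hsf]; congr 1
    refine Finset.sum_congr rfl fun b _ => ?_
    rw [dist_sq, if_pos rfl]; ring
  have h01 : secondForm (rangeMap m) 0 1 x = -(N⁻¹ * ∑ b, normalVec (rangeMap m) x b /
      dist x (m b) ^ 3 * ((x 0 - m b 0) * (x 1 - m b 1))) := by
    rw [hsf, ← mul_neg, ← Finset.sum_neg_distrib]; congr 1
    refine Finset.sum_congr rfl fun b _ => ?_
    rw [if_neg (by decide)]; ring
  have hval : gaussCurvature (rangeMap m) x = ((area m / P) ^ 2 * area m ^ 2 / P ^ 2 / N ^ 4) *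
      (bary m 0 x * bary m 1 x * bary m 2 x * pw m x) := by
    rw [gaussCurvature, firstForm_det, h00, h11, h01, ← hN]
    have e : ∀ A B C : ℝ, N⁻¹ * A * (N⁻¹ * B) - (-(N⁻¹ * C)) ^ 2 = (B * A - C ^ 2) * (N⁻¹) ^ 2 := by
      intros; ring
    simp only [mul_assoc] at hdet e ⊢
    rw [e, hdet]
    field_simp
  rw [hval, posLocus, Set.mem_ofPred_eq]
  have : 0 < (area m / P) ^ 2 * area m ^ 2 / P ^ 2 / N ^ 4 := by positivity
  exact mul_nonneg_iff_of_pos_left this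

end

lemma nonnegCurved_eq {m : Fin 3 → Plane} (hm : ¬ Collinear ℝ (Set.range m)) :
    nonnegCurved m = rangeMap m '' (posLocus m \ Set.range m) := by
  rw [nonnegCurved]
  congr 1
  ext x
  rw [Set.mem_ofPred_eq, Set.mem_sdiff]
  constructor
  · rintro ⟨h1, h2⟩
    exact ⟨(gaussCurvature_nonneg_iff hm h1).1 h2, h1⟩
  · rintro ⟨h1, h2⟩
    exact ⟨h2, (gaussCurvature_nonneg_iff hm h2).2 h1⟩

end

/-! ### The four regions of nonnegative curvature -/

section

section
variable {m : Fin 3 → Plane} (hm : ¬ Collinear ℝ (Set.range m))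
include hm

/-- Differences of the squared distance equations are linear, and two of them determine the point
because the receivers are not collinear. -/
lemma rangeMap_injective : Function.Injective (rangeMap m) := by
  intro y z h
  have hd : ∀ b, (y 0 - m b 0) ^ 2 + (y 1 - m b 1) ^ 2 = (z 0 - m b 0) ^ 2 + (z 1 - m b 1) ^ 2 := by
    intro b
    have : dist y (m b) = dist z (m b) := congrArg (fun p : TSpace => p b) h
    rw [← dist_sq, ← dist_sq, this]
  have hA := area_ne_zero hm
  have h0 := hd 0
  have h1 := hd 1
  have h2 := hd 2
  have ha : area m = (m 1 0 - m 0 0) * (m 2 1 - m 0 1) - (m 1 1 - m 0 1) * (m 2 0 - m 0 0) := by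
    simp [area, cr]
  apply plane_ext <;> apply mul_left_cancel₀ hA <;> rw [ha]
  · linear_combination (1 / 2) * (m 2 1 - m 0 1) * (h0 - h1) - (1 / 2) * (m 1 1 - m 0 1) * (h0 - h2)
  · linear_combination (1 / 2) * (m 1 0 - m 0 0) * (h0 - h2) - (1 / 2) * (m 2 0 - m 0 0) * (h0 - h1)

/-- The map is proper because its first coordinate already tends to infinity. Closures and
components can thus be computed in the plane. -/
lemma isClosedEmbedding_rangeMap : Topology.IsClosedEmbedding (rangeMap m) := by
  have hc : Continuous (rangeMap m) := by unfold rangeMap; fun_prop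
  refine .of_continuous_injective_isClosedMap hc (rangeMap_injective hm) ?_
  refine (isProperMap_iff_tendsto_cocompact.2 ⟨hc, ?_⟩).isClosedMap
  rw [← Metric.cobounded_eq_cocompact, ← Metric.cobounded_eq_cocompact, ← tendsto_norm_atTop_iff_cobounded]
  refine Filter.tendsto_atTop_mono (fun x => ?_) (Metric.tendsto_dist_left_cobounded_atTop (m 0))
  have := PiLp.norm_apply_le (rangeMap m x) 0
  rwa [Real.norm_eq_abs, rangeMap, PiLp.toLp_apply, abs_of_nonneg dist_nonneg, dist_comm] at this

lemma bary_combo {i j k : Fin 3} (hij : i ≠ j) (hik : i ≠ k) (hjk : j ≠ k) {x : Plane} {α β γ : ℝ}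
    (h : α + β + γ = 1) (hx : x = α • m i + β • m j + γ • m k) :
    bary m i x = α ∧ bary m j x = β ∧ bary m k x = γ := by
  have := bary_eq_of_combo hm (x := x) (l := fun b => if b = i then α else if b = j then β else γ)
    (by rw [sum_three hij hik hjk]; simpa [hij.symm, hik.symm, hjk.symm] using h)
    (by rw [sum_three hij hik hjk]; simpa [hij.symm, hik.symm, hjk.symm] using hx)
  refine ⟨?_, ?_, ?_⟩ <;> rw [this] <;> simp [hij.symm, hik.symm, hjk.symm]

lemma eq_combo_three {i j k : Fin 3} (hij : i ≠ j) (hik : i ≠ k) (hjk : j ≠ k) (x : Plane) :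
    x = bary m i x • m i + bary m j x • m j + bary m k x • m k := by
  conv_lhs => rw [eq_combo hm x, sum_three hij hik hjk]

lemma eq_receiver {i j k : Fin 3} (hij : i ≠ j) (hik : i ≠ k) (hjk : j ≠ k) {x : Plane}
    (hi : bary m i x = 0) (hj : bary m j x = 0) : x = m k := by
  have hs := bary_sum hm x
  rw [sum_three hij hik hjk, hi, hj, zero_add, zero_add] at hs
  rw [eq_combo_three hm hij hik hjk x, hi, hj, hs]; simp

/-- The triangle and the three regions beyond its sides. -/
def region (m : Fin 3 → Plane) (o : Option (Fin 3)) : Set Plane := o.elim (tri m) (reg m)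

omit hm in
lemma isClosed_region (o : Option (Fin 3)) : IsClosed (region m o) := by
  cases o with
  | none =>
    change IsClosed {x | ∀ b, 0 ≤ bary m b x}
    simp only [Set.ofPred_forall]
    exact isClosed_iInter fun b => isClosed_le continuous_const (continuous_bary m b)
  | some i =>
    change IsClosed {x | bary m i x ≤ 0 ∧ (∀ b, b ≠ i → 0 ≤ bary m b x) ∧ pw m x ≤ 0}
    refine (isClosed_le (continuous_bary m i) continuous_const).and (IsClosed.and ?_
      (isClosed_le (continuous_pw m) continuous_const))
    simp only [Set.ofPred_forall]
    exact isClosed_iInter fun b => isClosed_iInter fun _ =>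
      isClosed_le continuous_const (continuous_bary m b)

/-- Two outer regions share only points with two vanishing coordinates. On the triangle and an outer
region β_i = 0 and 0 ≥ pw = β_j β_k |m_j - m_k|², so a second coordinate vanishes as well. -/
lemma region_inter {o o' : Option (Fin 3)} (h : o ≠ o') {x : Plane} (hx : x ∈ region m o)
    (hx' : x ∈ region m o') : x ∈ Set.range m := by
  have key : ∀ i, x ∈ tri m → x ∈ reg m i → x ∈ Set.range m := by
    intro i ht hr
    obtain ⟨j, k, hij, hik, hjk⟩ := exists_others i
    have h1 := hr.1
    have h2 := hr.2.2
    have hi : bary m i x = 0 := le_antisymm h1 (ht i)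
    rw [pw_eq hm hij hik hjk, hi] at h2
    have hd := receivers_dist_pos hm hjk
    have h3 := mul_nonneg (ht j) (ht k)
    have h4 : bary m j x * bary m k x = 0 := by
      by_contra h5
      have : 0 < bary m j x * bary m k x := lt_of_le_of_ne h3 (Ne.symm h5)
      have := mul_pos this (pow_pos hd 2)
      linarith
    rcases mul_eq_zero.1 h4 with h5 | h5
    · exact ⟨k, (eq_receiver hm hij hik hjk hi h5).symm⟩
    · exact ⟨j, (eq_receiver hm hik hij hjk.symm hi h5).symm⟩
  cases o with
  | none =>
    cases o' with
    | none => exact absurd rfl h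
    | some i => exact key i hx hx'
  | some i =>
    cases o' with
    | none => exact key i hx' hx
    | some j =>
      have hij : i ≠ j := fun e => h (congrArg some e)
      obtain ⟨k, hik, hjk⟩ := exists_third hij
      have hi : bary m i x = 0 := le_antisymm hx.1 (hx'.2.1 i hij)
      have hj : bary m j x = 0 := le_antisymm hx'.1 (hx.2.1 j hij.symm)
      exact ⟨k, (eq_receiver hm hij hik hjk hi hj).symm⟩

/-- A receiver in one of the regions is the origin of a segment in that region. -/
lemma exists_segment {o : Option (Fin 3)} {a : Fin 3} (ha : m a ∈ region m o) :
    ∃ v : Plane, ∀ t : ℝ, 0 < t → t < 1 → m a + t • v ∈ region m o \ Set.range m := by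
  have hne : ∀ {x : Plane} {b c : Fin 3}, b ≠ c → bary m b x ≠ 0 → bary m c x ≠ 0 → x ∉ Set.range m := by
    rintro x b c hbc hb hc ⟨d, rfl⟩
    by_cases hd : b = d
    · exact hc (bary_of_ne hm (fun e => hbc (hd.trans e.symm)))
    · exact hb (bary_of_ne hm hd)
  cases o with
  | none =>
    obtain ⟨j, k, hij, hik, hjk⟩ := exists_others a
    refine ⟨m j - m a, fun t ht0 ht1 => ?_⟩
    obtain ⟨h1, h2, h3⟩ := bary_combo hm hij hik hjk (x := m a + t • (m j - m a)) (α := 1 - t)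
      (β := t) (γ := 0) (by ring) (by module)
    refine ⟨fun b => ?_, hne hij (by rw [h1]; linarith) (by rw [h2]; linarith)⟩
    rcases forall_three hij hik hjk b with rfl | rfl | rfl
    · rw [h1]; linarith
    · rw [h2]; linarith
    · rw [h3]
  | some i =>
    have hia : i ≠ a := by
      rintro rfl
      have := ha.1
      rw [bary_self hm] at this
      linarith
    obtain ⟨k, hik, hak⟩ := exists_third hia
    -- The extension of the side m_i m_a beyond m_a, which stays outside the circle.
    refine ⟨m a - m i, fun t ht0 ht1 => ?_⟩
    obtain ⟨h1, h2, h3⟩ := bary_combo hm hia hik hak (x := m a + t • (m a - m i)) (α := -t)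
      (β := 1 + t) (γ := 0) (by ring) (by module)
    refine ⟨⟨by rw [h1]; linarith, fun b hb => ?_, ?_⟩,
      hne hia (by rw [h1]; linarith) (by rw [h2]; linarith)⟩
    · rcases forall_three hia hik hak b with rfl | rfl | rfl
      · exact absurd rfl hb
      · rw [h2]; linarith
      · rw [h3]
    · rw [pw_eq hm hia hik hak, h1, h2, h3]
      have : 0 ≤ t * (1 + t) * dist (m i) (m a) ^ 2 := by positivity
      linarith

lemma region_subset_closure (o : Option (Fin 3)) :
    region m o ⊆ closure (region m o \ Set.range m) := by
  intro x hx
  by_cases h : x ∈ Set.range m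
  · obtain ⟨a, rfl⟩ := h
    obtain ⟨v, hv⟩ := exists_segment hm hx
    refine mem_closure_of_tendsto (b := nhdsWithin (0 : ℝ) (Set.Ioi 0))
      ((tendsto_line (m a) v).mono_left nhdsWithin_le_nhds) ?_
    filter_upwards [Ioo_mem_nhdsGT (zero_lt_one' ℝ)] with t ht
    exact hv t ht.1 ht.2
  · exact subset_closure ⟨hx, h⟩

lemma region_sdiff_nonempty (o : Option (Fin 3)) : (region m o \ Set.range m).Nonempty := by
  rw [← closure_nonempty_iff]
  refine Set.Nonempty.mono (region_subset_closure hm o) ?_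
  cases o with
  | none =>
    refine ⟨m 0, fun b => ?_⟩
    by_cases h : b = 0
    · rw [h, bary_self hm]; exact zero_le_one
    · rw [bary_of_ne hm h]
  | some i =>
    obtain ⟨j, k, hij, hik, hjk⟩ := exists_others i
    refine ⟨m j, (bary_of_ne hm hij).le, fun b hb => ?_, ?_⟩
    · by_cases h : b = j
      · rw [h, bary_self hm]; exact zero_le_one
      · rw [bary_of_ne hm h]
    · rw [pw_eq hm hij hik hjk, bary_of_ne hm hij, bary_of_ne hm hjk.symm]; simp

/-- Removing the vertices amounts to the strict inequalities β_b < 1, which keep the set convex. -/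
lemma isPreconnected_tri : IsPreconnected (tri m \ Set.range m) := by
  have : tri m \ Set.range m = {x | ∀ b, 0 ≤ bary m b x ∧ bary m b x < 1} := by
    ext x
    rw [Set.mem_sdiff, Set.mem_ofPred_eq]
    have hs := bary_sum hm x
    constructor
    · rintro ⟨h, hx⟩ b
      refine ⟨h b, ?_⟩
      by_contra! hb
      obtain ⟨j, k, hij, hik, hjk⟩ := exists_others b
      rw [sum_three hij hik hjk] at hs
      have h1 := h j
      have h2 := h k
      exact hx ⟨b, (eq_receiver hm hjk hij.symm hik.symm (by linarith) (by linarith)).symm⟩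
    · intro h
      refine ⟨fun b => (h b).1, ?_⟩
      rintro ⟨b, rfl⟩
      have := (h b).2
      rw [bary_self hm] at this
      exact lt_irrefl _ this
  rw [this]
  refine Convex.isPreconnected ?_
  intro x hx y hy a c ha hc hac b
  have e : bary m b (a • x + c • y) = a * bary m b x + c * bary m b y := by
    obtain rfl : a = 1 - c := by linarith
    rw [bary, bary, bary, mul_div_assoc', mul_div_assoc', ← add_div]
    congr 1
    simp [cr]
    ring
  have h1 := hx b
  have h2 := hy b
  rw [e]
  refine ⟨add_nonneg (mul_nonneg ha h1.1) (mul_nonneg hc h2.1), ?_⟩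
  rcases ha.eq_or_lt with rfl | ha
  · obtain rfl : c = 1 := by linarith
    linarith [h2.2]
  · have := mul_lt_mul_of_pos_left h1.2 ha
    have := mul_le_mul_of_nonneg_left h2.2.le hc
    linarith

/-- On the ray from m_i through the point of the side with parameter s, the point with scale t has
pw = t (L s - t D s), so being outside the circle means t ≥ L s / D s. Shifting t by this bound
exhibits the region as the continuous image of a convex set. -/
lemma isPreconnected_reg (i : Fin 3) : IsPreconnected (reg m i \ Set.range m) := by
  obtain ⟨j, k, hij, hik, hjk⟩ := exists_others i
  set p := dist (m i) (m j) with hp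
  set q := dist (m i) (m k) with hq
  set d := dist (m j) (m k) with hd
  have hp0 : 0 < p := receivers_dist_pos hm hij
  have hq0 : 0 < q := receivers_dist_pos hm hik
  set L : ℝ → ℝ := fun s => (1 - s) * p ^ 2 + s * q ^ 2 with hL
  set D : ℝ → ℝ := fun s => L s - s * (1 - s) * d ^ 2 with hD
  have hD0 : ∀ s, 0 < D s := by
    intro s
    have h : D s = dist ((1 - s) • m j + s • m k) (m i) ^ 2 := by
      simp only [hD, hL, hp, hq, hd, dist_sq]
      simp
      ring
    rw [h]
    refine pow_pos (dist_pos.2 fun e => ?_) 2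
    have := (bary_combo hm hij hik hjk (x := (1 - s) • m j + s • m k) (α := 0) (β := 1 - s) (γ := s)
      (by ring) (by module)).1
    rw [e, bary_self hm] at this
    exact one_ne_zero this
  set t : ℝ × ℝ → ℝ := fun z => L z.1 / D z.1 + z.2 with ht
  set F : ℝ × ℝ → Plane := fun z =>
    (1 - t z) • m i + (t z * (1 - z.1)) • m j + (t z * z.1) • m k with hF
  -- The half-strip without its corners (0, 0) and (1, 0), the parameters of m_j and m_k.
  set K : Set (ℝ × ℝ) := {z | 0 ≤ z.1 ∧ z.1 ≤ 1 ∧ 0 ≤ z.2 ∧ 0 < z.1 + z.2 ∧ 0 < 1 - z.1 + z.2} with hK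
  have hFb : ∀ z, bary m i (F z) = 1 - t z ∧ bary m j (F z) = t z * (1 - z.1) ∧
      bary m k (F z) = t z * z.1 := fun z => bary_combo hm hij hik hjk (by ring) rfl
  have hpw : ∀ s t : ℝ, (1 - t) * (t * (1 - s)) * p ^ 2 + (1 - t) * (t * s) * q ^ 2 +
      t * (1 - s) * (t * s) * d ^ 2 = t * (L s - t * D s) := by
    intro s t
    simp only [hD, hL]; ring
  have himg : reg m i \ Set.range m = F '' K := by
    ext x
    constructor
    · rintro ⟨hx, hr⟩
      have h1 := hx.1
      have hj := hx.2.1 j hij.symm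
      have hk := hx.2.1 k hik.symm
      have h3 := hx.2.2
      have hs := bary_sum hm x
      rw [sum_three hij hik hjk] at hs
      rw [pw_eq hm hij hik hjk] at h3
      obtain ⟨T, hT⟩ : ∃ T, T = 1 - bary m i x := ⟨_, rfl⟩
      have hT1 : 1 ≤ T := by linarith
      have hT0 : T ≠ 0 := by linarith
      obtain ⟨s, hs'⟩ : ∃ s, s = bary m k x / T := ⟨_, rfl⟩
      have ek : bary m k x = T * s := by rw [hs']; field_simp
      have ej : bary m j x = T * (1 - s) := by linarith
      have ei : bary m i x = 1 - T := by linarith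
      have hs0 : 0 ≤ s := by rw [hs']; exact div_nonneg hk (by linarith)
      have hs1 : s ≤ 1 := by
        by_contra! h
        rw [ej] at hj
        nlinarith
      rw [ei, ej, ek, hpw] at h3
      have hLD : L s / D s ≤ T := by
        rw [div_le_iff₀ (hD0 s)]
        by_contra! h
        have := mul_pos (show 0 < T by linarith) (sub_pos.2 h)
        linarith
      have htT : t (s, T - L s / D s) = T := by simp only [ht]; ring
      have hne : ∀ σ : ℝ, (σ = 0 ∨ σ = 1) → s = σ → L s / D s < T := by
        intro σ hσ hsσ
        refine lt_of_le_of_ne hLD fun e => hr ?_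
        have hLD1 : L s / D s = 1 := by
          have : L s = D s := by
            simp only [hD]
            rcases hσ with rfl | rfl <;> rw [hsσ] <;> ring
          rw [this, div_self (hD0 s).ne']
        rw [hLD1] at e
        rw [← e] at ei ej ek
        rcases hσ with rfl | rfl
        · exact ⟨j, (eq_receiver hm hik hij hjk.symm (by rw [ei]; ring) (by rw [ek, hsσ]; ring)).symm⟩
        · exact ⟨k, (eq_receiver hm hij hik hjk (by rw [ei]; ring) (by rw [ej, hsσ]; ring)).symm⟩
      refine ⟨(s, T - L s / D s), ?_, ?_⟩
      · rw [hK, Set.mem_ofPred_eq]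
        refine ⟨hs0, hs1, sub_nonneg.2 hLD, ?_, ?_⟩
        · rcases hs0.eq_or_lt with h | h
          · have := hne 0 (Or.inl rfl) h.symm
            dsimp only; linarith
          · dsimp only; linarith
        · rcases hs1.eq_or_lt with h | h
          · have := hne 1 (Or.inr rfl) h
            dsimp only; linarith
          · dsimp only; linarith
      · simp only [hF, htT]
        rw [← ei, ← ej, ← ek]
        exact (eq_combo_three hm hij hik hjk x).symm
    · rintro ⟨z, hz, rfl⟩
      rw [hK, Set.mem_ofPred_eq] at hz
      obtain ⟨h1, h2, h3, h4, h5⟩ := hz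
      obtain ⟨bi, bj, bk⟩ := hFb z
      have hDL : D z.1 ≤ L z.1 := by
        have : 0 ≤ z.1 * (1 - z.1) * d ^ 2 := mul_nonneg (mul_nonneg h1 (by linarith)) (sq_nonneg _)
        simp only [hD]; linarith
      have hLD : 1 ≤ L z.1 / D z.1 := (one_le_div₀ (hD0 _)).2 hDL
      have htz : t z = L z.1 / D z.1 + z.2 := rfl
      have ht1 : 1 ≤ t z := by linarith
      refine ⟨⟨by rw [bi]; linarith, fun b hb => ?_, ?_⟩, ?_⟩
      · rcases forall_three hij hik hjk b with rfl | rfl | rfl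
        · exact absurd rfl hb
        · rw [bj]; exact mul_nonneg (by linarith) (by linarith)
        · rw [bk]; exact mul_nonneg (by linarith) h1
      · rw [pw_eq hm hij hik hjk, bi, bj, bk, hpw]
        have : L z.1 ≤ t z * D z.1 := by
          rw [← div_le_iff₀ (hD0 _)]; linarith
        exact mul_nonpos_of_nonneg_of_nonpos (by linarith) (by linarith)
      · rintro ⟨b, hb⟩
        rcases forall_three hij hik hjk b with rfl | rfl | rfl
        · rw [← hb, bary_self hm] at bi
          linarith
        · rw [← hb, bary_of_ne hm hij] at bi
          rw [← hb, bary_of_ne hm hjk.symm] at bk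
          rcases mul_eq_zero.1 bk.symm with h | h <;> linarith
        · rw [← hb, bary_of_ne hm hik] at bi
          rw [← hb, bary_of_ne hm hjk] at bj
          rcases mul_eq_zero.1 bj.symm with h | h <;> linarith
  rw [himg]
  have hcont : Continuous F := by
    have h1 : Continuous L := by simp only [hL]; fun_prop
    have h2 : Continuous D := by simp only [hD]; fun_prop
    have h3 : Continuous t := by
      simp only [ht]
      exact ((h1.comp continuous_fst).div (h2.comp continuous_fst) fun z => (hD0 z.1).ne').add
        continuous_snd
    simp only [hF]
    fun_prop
  refine IsPreconnected.image (Convex.isPreconnected ?_) F hcont.continuousOn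
  intro z hz z' hz' a c ha hc hac
  rw [hK, Set.mem_ofPred_eq] at hz hz' ⊢
  obtain ⟨h1, h2, h3, h4, h5⟩ := hz
  obtain ⟨g1, g2, g3, g4, g5⟩ := hz'
  obtain rfl : a = 1 - c := by linarith
  simp only [Prod.fst_add, Prod.snd_add, Prod.smul_fst, Prod.smul_snd, smul_eq_mul]
  have pos : ∀ u v : ℝ, 0 < u → 0 < v → 0 < (1 - c) * u + c * v := by
    intro u v hu hv
    rcases hc.eq_or_lt with rfl | hc
    · simpa using hu
    · have := mul_nonneg ha hu.le
      have := mul_pos hc hv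
      linarith
  refine ⟨by positivity, ?_, by positivity, ?_, ?_⟩
  · have := mul_le_mul_of_nonneg_left h2 ha
    have := mul_le_mul_of_nonneg_left g2 hc
    linarith
  · have := pos _ _ h4 g4
    linarith
  · have := pos _ _ h5 g5
    linarith

lemma isPreconnected_region (o : Option (Fin 3)) : IsPreconnected (region m o \ Set.range m) := by
  cases o with
  | none => exact isPreconnected_tri hm
  | some i => exact isPreconnected_reg hm i

lemma iUnion_region : ⋃ o, region m o = posLocus m := by
  rw [posLocus_eq hm, Set.iUnion_option]
  rfl

end

/-- The components of a finite disjoint union of relatively closed connected sets. -/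
lemma connectedComponentIn_eq {ι X : Type*} [Finite ι] [TopologicalSpace X] {A C : ι → Set X}
    (hA : ∀ i, IsPreconnected (A i)) (hC : ∀ i, IsClosed (C i)) (hAC : ∀ i, A i ⊆ C i)
    (hdisj : ∀ i j, i ≠ j → Disjoint (C i ∩ C j) (⋃ l, A l)) {i : ι} {p : X} (hp : p ∈ A i) :
    connectedComponentIn (⋃ l, A l) p = A i := by
  refine Set.Subset.antisymm ?_
    ((hA i).subset_connectedComponentIn hp (Set.subset_iUnion A i))
  intro q hq
  have hKS := connectedComponentIn_subset (⋃ l, A l) p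
  obtain ⟨j, hj⟩ := Set.mem_iUnion.1 (hKS hq)
  by_cases hij : j = i
  · rwa [← hij]
  exfalso
  -- The component is covered by the closed set C i and the finite union of the other C l. Meeting
  -- both, it must contain a common point, which `hdisj` excludes.
  obtain ⟨r, hr, hri, hrj⟩ := isPreconnected_closed_iff.1
    (isPreconnected_connectedComponentIn (F := ⋃ l, A l) (x := p)) (C i) (⋃ l : {l // l ≠ i}, C l)
    (hC i) (isClosed_iUnion_of_finite fun l => hC l) (by
      intro z hz
      obtain ⟨l, hl⟩ := Set.mem_iUnion.1 (hKS hz)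
      by_cases h : l = i
      · exact Or.inl (h ▸ hAC l hl)
      · exact Or.inr (Set.mem_iUnion.2 ⟨⟨l, h⟩, hAC l hl⟩))
    ⟨p, mem_connectedComponentIn (Set.mem_iUnion.2 ⟨i, hp⟩), hAC i hp⟩
    ⟨q, hq, Set.mem_iUnion.2 ⟨⟨j, hij⟩, hAC j hj⟩⟩
  obtain ⟨⟨l, hl⟩, hrl⟩ := Set.mem_iUnion.1 hrj
  exact Set.disjoint_left.1 (hdisj i l (Ne.symm hl)) ⟨hri, hrl⟩ (hKS hr)

section
variable {m : Fin 3 → Plane} (hm : ¬ Collinear ℝ (Set.range m))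
include hm

/-- The regions without the receivers are connected, and in the nonnegative locus their closed hosts
are disjoint, so they are the components; taking closures restores the receivers. -/
lemma curvedRegions_eq : curvedRegions m = Set.range fun o => rangeMap m '' region m o := by
  have hT := isClosedEmbedding_rangeMap hm
  have hinj := rangeMap_injective hm
  have hS : nonnegCurved m = ⋃ o, rangeMap m '' (region m o \ Set.range m) := by
    rw [nonnegCurved_eq hm, ← iUnion_region hm, Set.iUnion_sdiff, Set.image_iUnion]
  have hcomp : ∀ o, ∀ p ∈ rangeMap m '' (region m o \ Set.range m),
      closure (connectedComponentIn (nonnegCurved m) p) = rangeMap m '' region m o := by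
    intro o p hp
    rw [hS, connectedComponentIn_eq (C := fun o => rangeMap m '' region m o)
      (fun o => (isPreconnected_region hm o).image _ hT.continuous.continuousOn)
      (fun o => hT.isClosedMap _ (isClosed_region o))
      (fun o => Set.image_mono Set.sdiff_subset) ?_ hp]
    · rw [hT.closure_image_eq]
      congr 1
      exact Set.Subset.antisymm (closure_minimal Set.sdiff_subset (isClosed_region o))
        (region_subset_closure hm o)
    · intro o o' hne
      rw [Set.disjoint_left]
      rintro _ ⟨⟨x, hx, rfl⟩, y, hy, hyx⟩ hU
      obtain ⟨l, z, hz, hzx⟩ := Set.mem_iUnion.1 hU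
      rw [hinj hyx] at hy
      rw [hinj hzx] at hz
      exact hz.2 (region_inter hm hne hx hy)
  ext V
  constructor
  · rintro ⟨p, hp, rfl⟩
    rw [hS] at hp
    obtain ⟨o, ho⟩ := Set.mem_iUnion.1 hp
    exact ⟨o, (hcomp o p ho).symm⟩
  · rintro ⟨o, rfl⟩
    obtain ⟨x, hx⟩ := region_sdiff_nonempty hm o
    refine ⟨rangeMap m x, ?_, (hcomp o _ ⟨x, hx, rfl⟩).symm⟩
    rw [hS]
    exact Set.mem_iUnion.2 ⟨o, x, hx, rfl⟩

lemma ncard_curvedRegions : (curvedRegions m).ncard = 4 := by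
  have hinj : Function.Injective fun o => rangeMap m '' region m o := by
    intro o o' h
    by_contra hne
    have h1 : region m o = region m o' := (rangeMap_injective hm).image_injective h
    obtain ⟨x, hx, hxm⟩ := region_sdiff_nonempty hm o
    exact hxm (region_inter hm hne hx (h1 ▸ hx))
  rw [curvedRegions_eq hm, ← Set.image_univ, Set.ncard_image_of_injective _ hinj, Set.ncard_univ]
  simp

lemma sUnion_curvedRegions : ⋃₀ curvedRegions m = rangeMap m '' posLocus m := by
  rw [curvedRegions_eq hm, Set.sUnion_range, ← Set.image_iUnion, iUnion_region hm]

end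

end

end RangeHull

end

theorem mainTheorem5 (m : Fin 3 → RangeHull.Plane) (hm : ¬ Collinear ℝ (Set.range m)) :
    (RangeHull.curvedRegions m).ncard = 4 ∧
    frontier (RangeHull.hull m) =
      ⋃₀ RangeHull.curvedRegions m ∪ (⋃ i, RangeHull.pieceF m i) ∪ (⋃ i, RangeHull.pieceG m i) ∪
        ⋃ i, (RangeHull.pieceL m (RangeHull.jj i) (RangeHull.kk i) ∪
          RangeHull.pieceL m (RangeHull.kk i) (RangeHull.jj i)) ∧
    RangeHull.hull m =
      RangeHull.enclosedRegion Set.univ (RangeHull.polyhedron m) (frontier (RangeHull.hull m)) \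
        ⋃ a, (RangeHull.unboundedEdge m a \ {RangeHull.rangeMap m (m a)}) := by
  refine ⟨RangeHull.ncard_curvedRegions hm, ?_, ?_⟩
  · ext p
    rw [RangeHull.sUnion_curvedRegions hm, RangeHull.mem_frontier_iff hm, RangeHull.onPieces_iff hm]
  · rw [RangeHull.enclosedRegion_frontier hm]
    exact RangeHull.hull_eq_closure_diff hm
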